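/- Let $\rho\in[-1,1]$, $\rho_*=\sqrt{1-\rho^2}$ and $\lambda\in\mathbb R$. For a Brownian motion $Z$ write $Z^{[\mu]}_t=Z_t+\mu t$. For $w>0$ and $a\in\mathbb R$ put $q_a=\frac{w^{a}-1}{a}$ if $a\ne0$, and let $q_0=\log w$ (its limit value). With $w\ge 1$ define $$\tilde\mu_2=\rho^2w^{\lambda}(w-1)+\rho_*^2\,q_{1+\lambda},$$ $$\tilde\mu_3=\rho^3w^{\frac32\lambda}(w-1)^2(w+2)+3\rho\rho_*^2\,w^{\frac12\lambda}\left(q_{3+\lambda}-q_{1+\lambda}\right),$$ $$\tilde\mu_4=\rho^4w^{2\lambda}(w-1)^2(w^4+2w^3+3w^2-3)+6\rho^2\rho_*^2\,w^{\lambda}\left(w\,q_{5+\lambda}-2q_{3+\lambda}+q_{1+\lambda}\right)+\tfrac32\rho_*^4\left(-w^{1+\lambda}q_{5+\lambda}+(w^{3+\lambda}+1)\,q_{3+\lambda}-q_{1+\lambda}\right).$$ (a) Canonical form. Let $S\ge0$ and $w=e^S$. Let $Z,X$ be independent Brownian motions with respect to a filtration, and let $(\tilde F,\tilde\sigma)$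 be a continuous adapted solution of $$d\tilde F_s=\tilde\sigma_s\left(\rho\,dZ^{[\lambda/2]}_s+\rho_*\,dX_s\right),\qquad d\tilde\sigma_s=\tilde\sigma_s\,dZ^{[\lambda/2]}_s,\qquad \tilde\sigma_0=1,\quad \tilde F_0=-\rho\left(e^{\lambda S/2}-1\right);$$ the law of $\tilde F_S$ is the canonical NSVh distribution with parameters $(S,\rho,\lambda)$. Then $\tilde F_S$ has a finite fourth moment, $E(\tilde F_S)=0$, and $E(\tilde F_S^{\,n})=\tilde\mu_n$ for $n=2,3,4$. If $S>0$, then $\tilde\mu_2>0$, and the skewness and the excess kurtosis of $\tilde F_S$ are $s=\tilde\mu_3/\tilde\mu_2^{3/2}$ and $\kappa=\tilde\mu_4/\tilde\mu_2^2-3$. (b) Original form. Let $\sigma_0>0$, $\alpha>0$, $F_0\in\mathbb R$, $T\ge0$ and $w=e^{\alpha^2T}$. Let $(F,\sigma)$ be a continuous adapted solution of $$dF_t=\sigma_t\left(\rho\,dZ^{[\lambda\alpha/2]}_t+\rho_*\,dX_t\right),\qquad d\sigma_t=\alpha\,\sigma_t\,dZ^{[\lambda\alpha/2]}_t,$$ with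 initial values $F_0$ and $\sigma_0$, where $Z,X$ are independent Brownian motions with respect to a filtration. Put $\bar F_T=F_0+\frac{\sigma_0\rho}{\alpha}\left(e^{\lambda\alpha^2T/2}-1\right)$. Then $F_T$ has a finite fourth moment, $E(F_T)=\bar F_T$, and $E\left((F_T-\bar F_T)^n\right)=(\sigma_0/\alpha)^n\,\tilde\mu_n$ for $n=2,3,4$. If $T>0$, the skewness and the excess kurtosis of $F_T$ are again $s=\tilde\mu_3/\tilde\mu_2^{3/2}$ and $\kappa=\tilde\mu_4/\tilde\mu_2^2-3$. (c) Normal SABR case. If $\lambda=0$ and $w=e^S$ with $S>0$, then $$\tilde\mu_2=w-1,\qquad s=\rho(w+2)\sqrt{w-1},\qquad \kappa=(w-1)\left(\frac{4\rho^2+1}{5}\,(w^3+3w^2+6w+5)+1\right).$$ -/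

import Mathlib

open MeasureTheory ProbabilityTheory Filter
open scoped NNReal

noncomputable section

namespace NSVh

variable {Ω : Type*} {mΩ : MeasurableSpace Ω}

/-- `Z` and `X` are independent standard Brownian motions with respect to the filtration `𝓕`:
both are adapted Brownian motions, they are independent of each other as processes, and the
increments of the pair after time `s` are independent of `𝓕 s`. -/
structure IsIndepBMPair (P : Measure Ω) (𝓕 : Filtration ℝ≥0 mΩ) (Z X : ℝ≥0 → Ω → ℝ) : Prop where
  brownian_Z : IsBrownianReal Z P
  brownian_X : IsBrownianReal X P
  indep : IndepFun (fun ω t => Z t ω) (fun ω t => X t ω) P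
  adapted_Z : StronglyAdapted 𝓕 Z
  adapted_X : StronglyAdapted 𝓕 X
  indep_increments : ∀ s t : ℝ≥0, s ≤ t →
    Indep (MeasurableSpace.comap (fun ω => (Z t ω - Z s ω, X t ω - X s ω)) inferInstance)
      (𝓕 s) P

/-- Brownian motion with drift, `Z^{[μ]}_t = Z_t + μ t`. -/
def drifted (Z : ℝ≥0 → Ω → ℝ) (μ : ℝ) (t : ℝ≥0) (ω : Ω) : ℝ := Z t ω + μ * (t : ℝ)

/-- `I_t = ∫₀ᵗ H dB` (Itô integral) for every `t`: the left-endpoint Riemann sums over the uniform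
partitions of `[0, t]` converge to `I_t` in probability. For a continuous adapted integrand `H` and
a continuous semimartingale `B`, the Itô integral is exactly this limit. -/
def IsItoIntegral (P : Measure Ω) (H B I : ℝ≥0 → Ω → ℝ) : Prop :=
  ∀ t : ℝ≥0, TendstoInMeasure P
    (fun (n : ℕ) (ω : Ω) => ∑ i ∈ Finset.range n,
      H (t * (i : ℝ≥0) / (n : ℝ≥0)) ω *
        (B (t * ((i : ℝ≥0) + 1) / (n : ℝ≥0)) ω - B (t * (i : ℝ≥0) / (n : ℝ≥0)) ω))
    atTop (I t)

/-- `(F, σ)` is a (continuous, adapted) solution of the NSVh system driven by `(Z, X)`,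
`dF = σ (ρ dZ^{[λα/2]} + √(1 - ρ²) dX)`, `dσ = α σ dZ^{[λα/2]}`,
with the initial values `F₀` and `σ₀`. -/
structure IsSolution (P : Measure Ω) (𝓕 : Filtration ℝ≥0 mΩ) (Z X F σ : ℝ≥0 → Ω → ℝ)
    (F₀ σ₀ α ρ lam : ℝ) : Prop where
  bm : IsIndepBMPair P 𝓕 Z X
  adapted_F : StronglyAdapted 𝓕 F
  adapted_σ : StronglyAdapted 𝓕 σ
  continuous_F : ∀ᵐ ω ∂P, Continuous (fun t => F t ω)
  continuous_σ : ∀ᵐ ω ∂P, Continuous (fun t => σ t ω)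
  init_F : ∀ᵐ ω ∂P, F 0 ω = F₀
  init_σ : ∀ᵐ ω ∂P, σ 0 ω = σ₀
  sde_F : IsItoIntegral P σ
    (fun t ω => ρ * drifted Z (lam * α / 2) t ω + √(1 - ρ ^ 2) * X t ω)
    (fun t ω => F t ω - F 0 ω)
  sde_σ : IsItoIntegral P σ (fun t ω => α * drifted Z (lam * α / 2) t ω)
    (fun t ω => σ t ω - σ 0 ω)

/-- `F̄_t = F₀ + (σ₀ ρ / α) (e^{λ α² t / 2} - 1)`. -/
def Fbar (F₀ σ₀ α ρ lam : ℝ) (t : ℝ≥0) : ℝ :=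
  F₀ + σ₀ * ρ / α * (Real.exp (lam * α ^ 2 * (t : ℝ) / 2) - 1)

/-- The canonical NSVh system for the terminal time `S`,
`dF = σ (ρ dZ^{[λ/2]} + √(1 - ρ²) dX)`, `dσ = σ dZ^{[λ/2]}`, `σ_0 = 1`.
The change of variables `(α / σ₀) (F_t - F̄_T)`, `S = α² T`, has initial value
`(α / σ₀) (F₀ - F̄_T) = -ρ (e^{λ S / 2} - 1)`. The law of `F_S` is the canonical NSVh
distribution with parameters `(S, ρ, λ)`. -/
def IsCanonicalSolution (P : Measure Ω) (𝓕 : Filtration ℝ≥0 mΩ) (Z X F σ : ℝ≥0 → Ω → ℝ)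
    (S : ℝ≥0) (ρ lam : ℝ) : Prop :=
  IsSolution P 𝓕 Z X F σ (-(ρ * (Real.exp (lam * (S : ℝ) / 2) - 1))) 1 1 ρ lam

/-- Skewness. -/
def skewness (Y : Ω → ℝ) (P : Measure Ω) : ℝ :=
  centralMoment Y 3 P / centralMoment Y 2 P ^ (3 / 2 : ℝ)

/-- Excess kurtosis. -/
def exKurtosis (Y : Ω → ℝ) (P : Measure Ω) : ℝ :=
  centralMoment Y 4 P / centralMoment Y 2 P ^ 2 - 3

/-- `(w ^ a - 1) / a`, with its limit value `log w` at `a = 0`. -/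
def powQuot (w a : ℝ) : ℝ := if a = 0 then Real.log w else (w ^ a - 1) / a

/-- The expression for the second moment; `1 - ρ ^ 2` is `ρ_*²`. -/
def mu2 (ρ lam w : ℝ) : ℝ :=
  ρ ^ 2 * w ^ lam * (w - 1) + (1 - ρ ^ 2) * powQuot w (1 + lam)

/-- The expression for the third moment. -/
def mu3 (ρ lam w : ℝ) : ℝ :=
  ρ ^ 3 * w ^ (3 / 2 * lam) * (w - 1) ^ 2 * (w + 2) +
    3 * ρ * (1 - ρ ^ 2) * w ^ (1 / 2 * lam) * (powQuot w (3 + lam) - powQuot w (1 + lam))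

/-- The expression for the fourth moment. -/
def mu4 (ρ lam w : ℝ) : ℝ :=
  ρ ^ 4 * w ^ (2 * lam) * (w - 1) ^ 2 * (w ^ 4 + 2 * w ^ 3 + 3 * w ^ 2 - 3) +
    6 * ρ ^ 2 * (1 - ρ ^ 2) * w ^ lam *
      (w * powQuot w (5 + lam) - 2 * powQuot w (3 + lam) + powQuot w (1 + lam)) +
    3 / 2 * (1 - ρ ^ 2) ^ 2 *
      (-(w ^ (1 + lam) * powQuot w (5 + lam)) + (w ^ (3 + lam) + 1) * powQuot w (3 + lam) -
        powQuot w (1 + lam))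

end NSVh

end

noncomputable section

namespace NSVh

open Topology

variable {Ω : Type*} {mΩ : MeasurableSpace Ω}

/-! The volatility equation forces `σ_t = σ₀ G_t` almost surely, where `G_t = exp (α Z_t + (λ - 1)/2
· α² t)` is `geom` (`volatility_eq`). Subtracting `ρ/α` times the volatility equation from the
equation for `F` removes the `dZ` part, so the rescaled terminal value `(α/σ₀)(F_T - F̄_T)` equals
`ρ (G_T - E G_T) + ρ_* ∫ α G dX`. The integral against `X` is never constructed: the rescaled value
is obtained as an almost sure limit, along a subsequence, of the discretizations `mixture`
(`IsSolution.exists_seq_tendsto_canonical`).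

Given `Z`, the sum `mixSum` is centered Gaussian with variance `mixVar` (`integral_mul_mixSum_pow`).
Odd powers of it therefore drop out, and the moments of `mixture` reduce to lognormal moments and to
expectations of `mixVar` and `mixVar²`, possibly weighted by powers of `G_T`. These are single and
double Riemann sums of exponentials, whose limits are the quotients `q_a` because `q_a(e^s) = ∫₀ˢ
e^{au} du`. Eighth moments of `mixture` are bounded uniformly in the grid, which lets moments up to
the fourth pass to the limit (`tendsto_integral_of_sq_bounded`).

Uniqueness for the volatility equation is proved from the Riemann-sum definition of the integral,
without Itô's formula. With `Y = 1/G` (`invGeom`), the increment of `σY` over `[0, T]` telescopes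
along a grid into three sums (`mul_invGeom_sub_eq`): Euler errors weighted by `Y`, products of Euler
errors with increments of `Y`, and deterministic one-step defects. The first is a limit of
martingale-type sums and is small by orthogonality and mean-square continuity of the truncated `σ`;
the second is handled by a weighted Young inequality; the third vanishes because the defect has mean
and second moment `o(1/n)`. All estimates hold on the event that `σ` and `Y` stay below `K` at the
grid points, and these events exhaust the space up to a null set. -/

/-! ### The quotients `q_a` as functions of `s = log w`. -/

lemma mul_powQuot_exp (a s : ℝ) : a * powQuot (Real.exp s) a = Real.exp (a * s) - 1 := by
  unfold powQuot
  split_ifs with h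
  · simp [h]
  · rw [← Real.exp_mul, mul_comm s a]; field_simp

lemma powQuot_exp_zero (a : ℝ) : powQuot (Real.exp 0) a = 0 := by
  unfold powQuot
  split_ifs <;> simp

/-- With `w = e^s` the quotient is `∫₀ˢ e^{au} du`, with no exception at `a = 0`; from here on the
case split in `powQuot` plays no role. -/
lemma hasDerivAt_powQuot_exp (a s : ℝ) :
    HasDerivAt (fun s => powQuot (Real.exp s) a) (Real.exp (a * s)) s := by
  unfold powQuot
  split_ifs with h
  · simpa [h] using hasDerivAt_id' s
  · have h1 : HasDerivAt (fun s : ℝ => Real.exp (a * s)) (Real.exp (a * s) * a) s := by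
      simpa using ((hasDerivAt_id s).const_mul a).exp
    refine ((h1.sub_const 1).div_const a).congr_deriv (by field_simp) |>.congr_of_eventuallyEq ?_
    refine Eventually.of_forall fun x => ?_
    simp only [← Real.exp_mul, mul_comm x a]

lemma powQuot_exp_pos {s : ℝ} (hs : 0 < s) (a : ℝ) : 0 < powQuot (Real.exp s) a := by
  have hm : StrictMono (fun s => powQuot (Real.exp s) a) :=
    strictMono_of_deriv_pos fun x => by
      rw [(hasDerivAt_powQuot_exp a x).deriv]; exact Real.exp_pos _
  exact (powQuot_exp_zero a).symm.trans_lt (hm hs)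

lemma mu2_pos {ρ : ℝ} (hρ : |ρ| ≤ 1) (lam : ℝ) {s : ℝ} (hs : 0 < s) :
    0 < mu2 ρ lam (Real.exp s) := by
  have h1 : ρ ^ 2 ≤ 1 := by simpa using (sq_le_one_iff_abs_le_one ρ).2 hρ
  have h2 := powQuot_exp_pos hs (1 + lam)
  have h3 : 0 < Real.exp s ^ lam * (Real.exp s - 1) :=
    mul_pos (Real.rpow_pos_of_pos (Real.exp_pos s) _) (by linarith [Real.add_one_lt_exp hs.ne'])
  unfold mu2
  rw [mul_assoc]
  rcases (sq_nonneg ρ).eq_or_lt with h | h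
  · rw [← h]; linarith
  · nlinarith [mul_pos h h3, mul_nonneg (sub_nonneg.2 h1) h2.le]

/-! ### Limits of single and double Riemann sums. -/

/-- Error of the left-endpoint Riemann sums of a Lipschitz function. -/
lemma abs_riemannSum_sub_le {G g : ℝ → ℝ} {S C : ℝ} (hS : 0 ≤ S) (hC : 0 ≤ C)
    (hG : ∀ s, HasDerivAt G (g s) s)
    (hg : ∀ x ∈ Set.Icc 0 S, ∀ y ∈ Set.Icc 0 S, |g x - g y| ≤ C * |x - y|)
    {n : ℕ} (hn : n ≠ 0) {j : ℕ} (hj : j ≤ n) :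
    |S / n * ∑ i ∈ Finset.range j, g (S * i / n) - (G (S * j / n) - G 0)| ≤
      j * (C * (S / n) ^ 2) := by
  have hn' : (0 : ℝ) < n := by positivity
  induction j with
  | zero => simp
  | succ j ih =>
    have hjn : (j : ℝ) + 1 ≤ n := by exact_mod_cast hj
    set x := S * j / n with hx
    set y := S * ((j + 1 : ℕ) : ℝ) / n with hy
    have hxy : y - x = S / n := by rw [hx, hy]; push_cast; field_simp; ring
    have hd : 0 ≤ S / n := by positivity
    have hx0 : 0 ≤ x := by positivity
    have hyS : y ≤ S := by
      rw [hy, div_le_iff₀ hn']; push_cast; gcongr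
    -- The mean value inequality is applied to `s ↦ G s - s * g x`, whose derivative `g s - g x` is
    -- at most `C` times the mesh on this interval.
    have hstep : |G y - G x - (y - x) * g x| ≤ C * (S / n) ^ 2 := by
      have := (convex_Icc x y).norm_image_sub_le_of_norm_hasDerivWithin_le
        (f := fun s => G s - s * g x) (f' := fun s => g s - g x) (C := C * (S / n))
        (fun s _ => (((hG s).fun_sub ((hasDerivAt_id' s).mul_const (g x))).congr_deriv
          (by ring)).hasDerivWithinAt)
        (fun s hs => by
          refine (hg s ⟨hx0.trans hs.1, hs.2.trans hyS⟩ x ⟨hx0, by linarith⟩).trans ?_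
          rw [abs_of_nonneg (by linarith [hs.1])]
          gcongr
          linarith [hs.2])
        (Set.left_mem_Icc.2 (by linarith)) (Set.right_mem_Icc.2 (by linarith))
      rw [Real.norm_eq_abs, Real.norm_eq_abs, abs_of_nonneg (by linarith : 0 ≤ y - x), hxy] at this
      rw [hxy]
      calc _ = |G y - y * g x - (G x - x * g x)| := by rw [← hxy]; ring_nf
        _ ≤ _ := this
        _ = _ := by ring
    rw [Finset.sum_range_succ]
    calc _ = |(S / n * ∑ i ∈ Finset.range j, g (S * i / n) - (G x - G 0)) -
            (G y - G x - (y - x) * g x)| := by rw [hxy, ← hx]; ring_nf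
      _ ≤ _ := abs_sub _ _
      _ ≤ j * (C * (S / n) ^ 2) + C * (S / n) ^ 2 := add_le_add (ih (by omega)) hstep
      _ = _ := by push_cast; ring

lemma exists_lipschitz_Icc {g : ℝ → ℝ} (hg : ContDiff ℝ 1 g) (S : ℝ) :
    ∃ C : ℝ, 0 ≤ C ∧ ∀ x ∈ Set.Icc 0 S, ∀ y ∈ Set.Icc 0 S, |g x - g y| ≤ C * |x - y| := by
  obtain ⟨K, hK⟩ := hg.contDiffOn.exists_lipschitzOnWith (by norm_num) (convex_Icc 0 S)
    isCompact_Icc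
  exact ⟨K, K.2, fun x hx y hy => by simpa [Real.dist_eq] using hK.dist_le_mul x hx y hy⟩

lemma tendsto_riemannSum {G g : ℝ → ℝ} {S : ℝ} (hS : 0 ≤ S)
    (hG : ∀ s, HasDerivAt G (g s) s) (hg : ContDiff ℝ 1 g) :
    Tendsto (fun n : ℕ => S / n * ∑ i ∈ Finset.range n, g (S * i / n)) atTop (𝓝 (G S - G 0)) := by
  obtain ⟨C, hC, hL⟩ := exists_lipschitz_Icc hg S
  rw [tendsto_iff_dist_tendsto_zero]
  refine squeeze_zero' (Eventually.of_forall fun _ => dist_nonneg) ?_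
    (tendsto_const_div_atTop_nhds_zero_nat (C * S ^ 2))
  filter_upwards [eventually_ne_atTop 0] with n hn
  have hn' : (n : ℝ) ≠ 0 := by exact_mod_cast hn
  have := abs_riemannSum_sub_le hS hC hG hL hn le_rfl
  rw [mul_div_cancel_right₀ _ hn'] at this
  rw [Real.dist_eq]
  refine this.trans_eq ?_
  field_simp

lemma tendsto_sum_exp_powQuot {S : ℝ} (hS : 0 ≤ S) (a : ℝ) :
    Tendsto (fun n : ℕ => S / n * ∑ i ∈ Finset.range n, Real.exp (a * (S * i / n))) atTop
      (𝓝 (powQuot (Real.exp S) a)) := by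
  have := tendsto_riemannSum hS (hasDerivAt_powQuot_exp a) (by fun_prop)
  rwa [powQuot_exp_zero, sub_zero] at this

lemma contDiff_powQuot_exp (a : ℝ) : ContDiff ℝ 1 (fun s => powQuot (Real.exp s) a) := by
  rw [contDiff_one_iff_deriv]
  refine ⟨fun s => (hasDerivAt_powQuot_exp a s).differentiableAt, ?_⟩
  rw [funext fun s => (hasDerivAt_powQuot_exp a s).deriv]
  fun_prop

lemma sum_sum_symm (n : ℕ) (f : ℕ → ℕ → ℝ) (hf : ∀ i j, f i j = f j i) :
    ∑ i ∈ Finset.range n, ∑ j ∈ Finset.range n, f i j =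
      2 * ∑ j ∈ Finset.range n, ∑ i ∈ Finset.range j, f i j + ∑ i ∈ Finset.range n, f i i := by
  induction n with
  | zero => simp
  | succ n ih =>
    simp only [Finset.sum_range_succ, Finset.sum_add_distrib] at ih ⊢
    rw [ih, Finset.sum_congr rfl fun j _ => hf n j]
    ring

/-- By symmetry the sum is twice its part below the diagonal, up to a negligible diagonal. There the
inner sum approximates `q_{5+λ}`, so the limit is `2 ∫₀ˢ e^{(1+λ)t} q_{5+λ}(e^t) dt`; the stated
expression is an explicit antiderivative. The kernel is that of `E (G_s² G_t²)` for `s ≤ t`. -/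
lemma tendsto_double_sum_exp {S : ℝ} (hS : 0 ≤ S) (lam : ℝ) {f : ℕ → ℕ → ℕ → ℝ}
    (hsymm : ∀ n i j, f n i j = f n j i)
    (hf : ∀ n i j, i ≤ j → f n i j =
      Real.exp ((5 + lam) * (S * i / n) + (1 + lam) * (S * j / n))) :
    Tendsto (fun n : ℕ => (S / n) ^ 2 *
        ∑ i ∈ Finset.range n, ∑ j ∈ Finset.range n, f n i j) atTop
      (𝓝 (1 / 2 * (-(Real.exp S ^ (1 + lam) * powQuot (Real.exp S) (5 + lam)) +
        (Real.exp S ^ (3 + lam) + 1) * powQuot (Real.exp S) (3 + lam) -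
        powQuot (Real.exp S) (1 + lam)))) := by
  set q : ℝ → ℝ → ℝ := fun a s => powQuot (Real.exp s) a with hq
  have hqm : ∀ a s, a * q a s = Real.exp (a * s) - 1 := mul_powQuot_exp
  have hqd : ∀ a s, HasDerivAt (q a) (Real.exp (a * s)) s := hasDerivAt_powQuot_exp
  have hq0 : ∀ a, q a 0 = 0 := powQuot_exp_zero
  have hed : ∀ a s : ℝ, HasDerivAt (fun s => Real.exp (a * s)) (Real.exp (a * s) * a) s :=
    fun a s => by simpa using ((hasDerivAt_id s).const_mul a).exp
  -- the limit as an antiderivative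
  have hG : ∀ s, HasDerivAt (fun s => 1 / 2 * (-(Real.exp ((1 + lam) * s) * q (5 + lam) s) +
      (Real.exp ((3 + lam) * s) + 1) * q (3 + lam) s - q (1 + lam) s))
      (2 * (Real.exp ((1 + lam) * s) * q (5 + lam) s)) s := by
    intro s
    refine HasDerivAt.congr_deriv ((((((hed (1 + lam) s).mul (hqd (5 + lam) s)).neg).add
      (((hed (3 + lam) s).add_const 1).mul (hqd (3 + lam) s))).sub
      (hqd (1 + lam) s)).const_mul (1 / 2)) ?_
    -- Both products have exponent `6 + 2λ`; together with `a * q_a = e^{as} - 1` for `a = 3 + λ`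
    -- and `a = 5 + λ` this reduces the derivative to a multiple of `q_{5+λ}`.
    have e1 : Real.exp ((1 + lam) * s) * Real.exp ((5 + lam) * s) =
        Real.exp ((3 + lam) * s) * Real.exp ((3 + lam) * s) := by
      rw [← Real.exp_add, ← Real.exp_add]; ring_nf
    linear_combination (1 / 2 : ℝ) * Real.exp ((3 + lam) * s) * hqm (3 + lam) s
      - (1 / 2) * Real.exp ((1 + lam) * s) * hqm (5 + lam) s + (-1) * e1
  have hlim : 1 / 2 * (-(Real.exp S ^ (1 + lam) * powQuot (Real.exp S) (5 + lam)) +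
        (Real.exp S ^ (3 + lam) + 1) * powQuot (Real.exp S) (3 + lam) -
        powQuot (Real.exp S) (1 + lam)) =
      1 / 2 * (-(Real.exp ((1 + lam) * S) * q (5 + lam) S) +
      (Real.exp ((3 + lam) * S) + 1) * q (3 + lam) S - q (1 + lam) S) := by
    simp only [← Real.exp_mul, mul_comm S, hq]
  rw [hlim]
  have hcont := contDiff_powQuot_exp (5 + lam)
  have hmain := tendsto_riemannSum hS hG (by fun_prop)
  simp only [hq0, mul_zero, sub_zero, neg_zero, add_zero] at hmain
  -- the inner sums
  obtain ⟨C, hC, hL⟩ := exists_lipschitz_Icc (g := fun s => Real.exp ((5 + lam) * s))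
    (by fun_prop) S
  have hinner : ∀ n : ℕ, n ≠ 0 → ∀ j ≤ n,
      |S / n * ∑ i ∈ Finset.range j, Real.exp ((5 + lam) * (S * i / n)) - q (5 + lam) (S * j / n)|
        ≤ C * S ^ 2 / n := by
    intro n hn j hj
    have hn' : (0 : ℝ) < n := by positivity
    have := abs_riemannSum_sub_le hS hC (hqd (5 + lam)) hL hn hj
    rw [hq0, sub_zero] at this
    refine this.trans ?_
    calc (j : ℝ) * (C * (S / n) ^ 2) ≤ n * (C * (S / n) ^ 2) := by gcongr
      _ = _ := by field_simp
  -- The diagonal has only `n` terms against a weight `(S/n)²`, so it is a convergent Riemann sum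
  -- times `S/n`.
  have hdiag := (tendsto_sum_exp_powQuot hS (6 + 2 * lam)).mul
    (tendsto_const_div_atTop_nhds_zero_nat S)
  rw [mul_zero] at hdiag
  have herr := ((tendsto_sum_exp_powQuot hS (1 + lam)).mul
    (tendsto_const_div_atTop_nhds_zero_nat (2 * (C * S ^ 2))))
  rw [mul_zero] at herr
  -- Replacing each inner sum by `q_{5+λ}` costs at most `C S²/n`, uniformly in `j`.
  have hoff : Tendsto (fun n : ℕ => (S / n) ^ 2 * (2 * ∑ j ∈ Finset.range n,
      ∑ i ∈ Finset.range j, f n i j) - S / n * ∑ j ∈ Finset.range n,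
        (2 * (Real.exp ((1 + lam) * (S * j / n)) * q (5 + lam) (S * j / n)))) atTop (𝓝 0) := by
    refine squeeze_zero_norm' ?_ herr
    filter_upwards [eventually_ne_atTop 0] with n hn
    have hn' : (0 : ℝ) < n := by positivity
    have e : (S / n) ^ 2 * (2 * ∑ j ∈ Finset.range n, ∑ i ∈ Finset.range j, f n i j) -
        S / n * ∑ j ∈ Finset.range n,
          (2 * (Real.exp ((1 + lam) * (S * j / n)) * q (5 + lam) (S * j / n))) =
        S / n * ∑ j ∈ Finset.range n, 2 * Real.exp ((1 + lam) * (S * j / n)) *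
          (S / n * ∑ i ∈ Finset.range j, Real.exp ((5 + lam) * (S * i / n))
            - q (5 + lam) (S * j / n)) := by
      rw [pow_two, mul_assoc, ← mul_sub, Finset.mul_sum, Finset.mul_sum, ← Finset.sum_sub_distrib]
      congr 1
      refine Finset.sum_congr rfl fun j hj => ?_
      rw [Finset.sum_congr rfl fun i hi => hf n i j (Finset.mem_range.1 hi).le]
      simp only [Real.exp_add]
      rw [← Finset.sum_mul]
      ring
    rw [e, Real.norm_eq_abs, abs_mul, abs_of_nonneg (by positivity : 0 ≤ S / n), mul_assoc]
    gcongr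
    refine (Finset.abs_sum_le_sum_abs _ _).trans ?_
    rw [Finset.sum_mul]
    refine Finset.sum_le_sum fun j hj => ?_
    rw [abs_mul, abs_of_pos (by positivity)]
    calc _ ≤ 2 * Real.exp ((1 + lam) * (S * j / n)) * (C * S ^ 2 / n) := by
          gcongr
          exact hinner n hn j (Finset.mem_range.1 hj).le
      _ = _ := by ring
  have := (hoff.add hmain).add hdiag
  simp only [zero_add, add_zero] at this
  refine this.congr fun n => ?_
  rw [sum_sum_symm n (f n) (hsymm n)]
  rw [Finset.sum_congr rfl fun i _ => hf n i i le_rfl]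
  have e2 : ∀ i : ℕ, (5 + lam) * (S * i / n) + (1 + lam) * (S * i / n) =
    (6 + 2 * lam) * (S * i / n) := fun i => by ring
  simp only [e2]
  ring

/-- A total of `n` equal one-step quantities over a mesh `T/n` is governed by the first-order term
of `φ` at `0`. -/
lemma tendsto_nat_mul_comp_div {φ : ℝ → ℝ} {φ' : ℝ} (h : HasDerivAt φ φ' 0) (h0 : φ 0 = 0)
    (T : ℝ) : Tendsto (fun n : ℕ => n * φ (T / n)) atTop (𝓝 (φ' * T)) := by
  have h2 : HasDerivAt (fun x => φ (T * x)) (φ' * T) 0 := by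
    have := HasDerivAt.comp (h₂ := φ) (h₂' := φ') (0 : ℝ) (by simpa using h)
      ((hasDerivAt_id (0 : ℝ)).const_mul T)
    simpa [Function.comp_def] using this
  have h3 := h2.tendsto_slope_zero.comp (tendsto_inv_atTop_nhds_zero_nat (𝕜 := ℝ) |>.comp
    (tendsto_id) |> fun h => tendsto_nhdsWithin_iff.2 ⟨h, (eventually_ne_atTop 0).mono fun n hn =>
      by simpa using hn⟩)
  refine h3.congr fun n => ?_
  simp [h0, div_eq_mul_inv]

/-! ### Algebra of the case `λ = 0`, where all exponents are natural numbers. -/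

lemma normalSABR_mu2 (ρ w : ℝ) : mu2 ρ 0 w = w - 1 := by
  simp [mu2, powQuot]; ring

lemma normalSABR_skewness (ρ : ℝ) {w : ℝ} (hw : 1 < w) :
    mu3 ρ 0 w / mu2 ρ 0 w ^ (3 / 2 : ℝ) = ρ * (w + 2) * √(w - 1) := by
  have h3 : w ^ (3 : ℝ) = w ^ 3 := by exact_mod_cast Real.rpow_natCast w 3
  have e : mu3 ρ 0 w = ρ * (w - 1) ^ 2 * (w + 2) := by
    simp [mu3, powQuot, h3]; ring
  rw [e, normalSABR_mu2]
  have hw' : 0 < w - 1 := by linarith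
  have : (w - 1) ^ (3 / 2 : ℝ) = (w - 1) * √(w - 1) := by
    rw [Real.sqrt_eq_rpow, show (3 / 2 : ℝ) = 1 + 1 / 2 by norm_num, Real.rpow_add hw',
      Real.rpow_one]
  rw [this]
  have hs : √(w - 1) ≠ 0 := (Real.sqrt_pos.2 hw').ne'
  have hss : √(w - 1) * √(w - 1) = w - 1 := Real.mul_self_sqrt hw'.le
  rw [div_eq_iff (mul_ne_zero hw'.ne' hs)]
  linear_combination (-(ρ * (w + 2) * (w - 1))) * hss

lemma normalSABR_kurtosis (ρ : ℝ) {w : ℝ} (hw : 1 < w) :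
    mu4 ρ 0 w / mu2 ρ 0 w ^ 2 - 3 =
      (w - 1) * ((4 * ρ ^ 2 + 1) / 5 * (w ^ 3 + 3 * w ^ 2 + 6 * w + 5) + 1) := by
  have h3 : w ^ (3 : ℝ) = w ^ 3 := by exact_mod_cast Real.rpow_natCast w 3
  have h5 : w ^ (5 : ℝ) = w ^ 5 := by exact_mod_cast Real.rpow_natCast w 5
  have hw' : w - 1 ≠ 0 := by linarith
  rw [normalSABR_mu2]
  simp [mu4, powQuot, h3, h5]
  field_simp
  ring

/-! ### Gaussian moments -/

section Gaussian

lemma mem_interior_integrableExpSet_gaussianReal (v : ℝ≥0) (t : ℝ) :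
    t ∈ interior (integrableExpSet (fun x : ℝ => x) (gaussianReal 0 v)) := by simp

lemma integrable_pow_mul_exp_gaussianReal (v : ℝ≥0) (t : ℝ) (k : ℕ) :
    Integrable (fun x : ℝ => x ^ k * Real.exp (t * x)) (gaussianReal 0 v) :=
  integrable_pow_mul_exp_of_mem_interior_integrableExpSet
    (mem_interior_integrableExpSet_gaussianReal v t) k

lemma integral_exp_gaussianReal (v : ℝ≥0) (t : ℝ) :
    ∫ x, Real.exp (t * x) ∂(gaussianReal 0 v) = Real.exp (v * t ^ 2 / 2) := by
  have := congrFun (mgf_fun_id_gaussianReal (μ := 0) (v := v)) t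
  simpa [mgf] using this

/-- Differentiation under the integral sign in `t` raises the power by one; the polynomial prefactor
obeys the recursion `p ↦ p' + v t p`. -/
lemma integral_pow_succ_mul_exp_gaussianReal (v : ℝ≥0) (k : ℕ) {p p' : ℝ → ℝ}
    (hp : ∀ t, HasDerivAt p (p' t) t)
    (h : ∀ t, ∫ x, x ^ k * Real.exp (t * x) ∂(gaussianReal 0 v) =
      p t * Real.exp (v * t ^ 2 / 2)) (t : ℝ) :
    ∫ x, x ^ (k + 1) * Real.exp (t * x) ∂(gaussianReal 0 v) =
      (p' t + v * t * p t) * Real.exp (v * t ^ 2 / 2) := by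
  have h1 := hasDerivAt_integral_pow_mul_exp_real
    (mem_interior_integrableExpSet_gaussianReal v t) k
  have h2 : HasDerivAt (fun t => p t * Real.exp (v * t ^ 2 / 2))
      (p' t * Real.exp (v * t ^ 2 / 2) + p t * (Real.exp (v * t ^ 2 / 2) * (v * t))) t := by
    refine (hp t).mul (HasDerivAt.exp ?_)
    refine ((((hasDerivAt_id' t).pow 2).const_mul (v : ℝ)).div_const 2).congr_deriv ?_
    simp; ring
  rw [funext h] at h1
  rw [h1.unique h2]; ring

lemma integral_id_mul_exp_gaussianReal (v : ℝ≥0) (t : ℝ) :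
    ∫ x, x * Real.exp (t * x) ∂(gaussianReal 0 v) = v * t * Real.exp (v * t ^ 2 / 2) := by
  simpa using integral_pow_succ_mul_exp_gaussianReal v 0 (p := fun _ => 1) (p' := fun _ => 0)
    (fun t => hasDerivAt_const t 1) (by simpa using integral_exp_gaussianReal v) t

lemma integral_sq_mul_exp_gaussianReal (v : ℝ≥0) (t : ℝ) :
    ∫ x, x ^ 2 * Real.exp (t * x) ∂(gaussianReal 0 v) =
      (v + v ^ 2 * t ^ 2) * Real.exp (v * t ^ 2 / 2) := by
  rw [integral_pow_succ_mul_exp_gaussianReal v 1 (p := fun t => v * t) (p' := fun _ => v)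
    (fun t => by simpa using (hasDerivAt_id' t).const_mul (v : ℝ))
    (by simpa using integral_id_mul_exp_gaussianReal v) t]
  ring

lemma integral_cube_mul_exp_gaussianReal (v : ℝ≥0) (t : ℝ) :
    ∫ x, x ^ 3 * Real.exp (t * x) ∂(gaussianReal 0 v) =
      (3 * v ^ 2 * t + v ^ 3 * t ^ 3) * Real.exp (v * t ^ 2 / 2) := by
  rw [integral_pow_succ_mul_exp_gaussianReal v 2 (p := fun t => v + v ^ 2 * t ^ 2)
    (p' := fun t => v ^ 2 * (2 * t))
    (fun t => by
      simpa using (((hasDerivAt_id' t).fun_pow 2).const_mul ((v : ℝ) ^ 2)).const_add (v : ℝ))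
    (integral_sq_mul_exp_gaussianReal v) t]
  ring

lemma integral_id_gaussianReal_zero (v : ℝ≥0) : ∫ x, x ∂(gaussianReal 0 v) = 0 := by simp

lemma integral_sq_gaussianReal (v : ℝ≥0) : ∫ x, x ^ 2 ∂(gaussianReal 0 v) = v := by
  simpa using integral_sq_mul_exp_gaussianReal v 0

lemma integral_cube_gaussianReal (v : ℝ≥0) : ∫ x, x ^ 3 ∂(gaussianReal 0 v) = 0 := by
  simpa using integral_cube_mul_exp_gaussianReal v 0

lemma integral_pow_four_gaussianReal (v : ℝ≥0) :
    ∫ x, x ^ 4 ∂(gaussianReal 0 v) = 3 * v ^ 2 := by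
  have := integral_pow_succ_mul_exp_gaussianReal v 3
    (p := fun t => 3 * v ^ 2 * t + v ^ 3 * t ^ 3)
    (p' := fun t => 3 * v ^ 2 + v ^ 3 * (3 * t ^ 2))
    (fun t => by
      simpa using ((hasDerivAt_id' t).const_mul (3 * (v : ℝ) ^ 2)).fun_add
        (((hasDerivAt_id' t).fun_pow 3).const_mul ((v : ℝ) ^ 3)))
    (integral_cube_mul_exp_gaussianReal v) 0
  simpa using this

/-- Scaling by `√v`. It is used for the eighth moment, where only the power of `v` matters and not
the constant. -/
lemma integral_pow_gaussianReal_scale (v : ℝ≥0) (k : ℕ) :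
    ∫ x, x ^ (2 * k) ∂(gaussianReal 0 v) = v ^ k * ∫ x, x ^ (2 * k) ∂(gaussianReal 0 1) := by
  have h : gaussianReal 0 v = (gaussianReal 0 1).map (√v * ·) := by
    rw [gaussianReal_map_const_mul]
    congr 1
    · simp
    · ext; simp
  rw [h, integral_map (by fun_prop) (by fun_prop), ← integral_const_mul]
  refine integral_congr_ae (Eventually.of_forall fun x => ?_)
  simp only [mul_pow, pow_mul, Real.sq_sqrt v.coe_nonneg]

lemma integral_comp_of_hasLaw {P : Measure Ω} {X : Ω → ℝ} {v : ℝ≥0}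
    (hX : HasLaw X (gaussianReal 0 v) P) {f : ℝ → ℝ} (hf : Continuous f) :
    ∫ ω, f (X ω) ∂P = ∫ x, f x ∂(gaussianReal 0 v) := by
  rw [← hX.map_eq, integral_map hX.aemeasurable hf.aestronglyMeasurable]

lemma integrable_comp_of_hasLaw {P : Measure Ω} {X : Ω → ℝ} {v : ℝ≥0}
    (hX : HasLaw X (gaussianReal 0 v) P) {f : ℝ → ℝ} (hf : Continuous f)
    (hi : Integrable f (gaussianReal 0 v)) : Integrable (fun ω => f (X ω)) P := by
  rw [← hX.map_eq, integrable_map_measure hf.aestronglyMeasurable hX.aemeasurable] at hi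
  exact hi

end Gaussian

/-! ### Functions in all `L^p` spaces, `p < ∞` -/

/-- `f` has finite absolute moments of all orders. -/
def HasAllMoments (f : Ω → ℝ) (P : Measure Ω) : Prop := ∀ p : ENNReal, p ≠ ⊤ → MemLp f p P

namespace HasAllMoments

variable {P : Measure Ω} {f g : Ω → ℝ}

lemma integrable (hf : HasAllMoments f P) : Integrable f P :=
  memLp_one_iff_integrable.1 (hf 1 (by simp))

lemma mul (hf : HasAllMoments f P) (hg : HasAllMoments g P) :
    HasAllMoments (fun ω => f ω * g ω) P := by
  intro p hp
  have : ENNReal.HolderTriple (2 * p) (2 * p) p := ⟨by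
    rw [ENNReal.mul_inv (by simp) (by simp), ← add_mul, ENNReal.inv_two_add_inv_two, one_mul]⟩
  exact MemLp.mul' (hg (2 * p) (ENNReal.mul_ne_top (by simp) hp))
    (hf (2 * p) (ENNReal.mul_ne_top (by simp) hp))

lemma add (hf : HasAllMoments f P) (hg : HasAllMoments g P) :
    HasAllMoments (fun ω => f ω + g ω) P := fun p hp => (hf p hp).add (hg p hp)

lemma sub (hf : HasAllMoments f P) (hg : HasAllMoments g P) :
    HasAllMoments (fun ω => f ω - g ω) P := fun p hp => (hf p hp).sub (hg p hp)

lemma const [IsFiniteMeasure P] (c : ℝ) : HasAllMoments (fun _ => c) P :=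
  fun _ _ => memLp_const c

lemma const_mul (hf : HasAllMoments f P) (c : ℝ) : HasAllMoments (fun ω => c * f ω) P :=
  fun p hp => (hf p hp).const_mul c

lemma pow [IsFiniteMeasure P] (hf : HasAllMoments f P) (k : ℕ) :
    HasAllMoments (fun ω => f ω ^ k) P := by
  induction k with
  | zero => simpa using const (P := P) 1
  | succ k ih => simpa only [pow_succ] using ih.mul hf

lemma sum {ι : Type*} (s : Finset ι) {f : ι → Ω → ℝ} (hf : ∀ i ∈ s, HasAllMoments (f i) P) :
    HasAllMoments (fun ω => ∑ i ∈ s, f i ω) P := fun p hp =>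
  memLp_finsetSum s fun i hi => hf i hi p hp

lemma of_hasLaw {v : ℝ≥0} (hf : HasLaw f (gaussianReal 0 v) P) : HasAllMoments f P := by
  intro p hp
  have := memLp_id_gaussianReal' (μ := 0) (v := v) p hp
  rw [← hf.map_eq, memLp_map_measure_iff (by fun_prop) hf.aemeasurable] at this
  exact this

lemma exp_of_hasLaw {v : ℝ≥0} (hf : HasLaw f (gaussianReal 0 v) P) (a : ℝ) :
    HasAllMoments (fun ω => Real.exp (a * f ω)) P := by
  intro p hp
  have hm : AEStronglyMeasurable (fun ω => Real.exp (a * f ω)) P :=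
    (Real.measurable_exp.comp_aemeasurable (hf.aemeasurable.const_mul a)).aestronglyMeasurable
  have := hf.isProbabilityMeasure
  rcases eq_or_ne p 0 with rfl | hp0
  · simpa using hm
  rw [← integrable_norm_rpow_iff hm hp0 hp]
  have := integrable_comp_of_hasLaw hf (f := fun x => Real.exp (p.toReal * a * x)) (by fun_prop)
    (integrable_exp_mul_gaussianReal _)
  refine this.congr (Eventually.of_forall fun ω => ?_)
  simp only [Real.norm_eq_abs, Real.abs_exp, ← Real.exp_mul]
  ring_nf

end HasAllMoments

/-! ### Convergence -/

section Convergence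

variable {P : Measure Ω}

/-- Fatou's lemma applied to the squares; square integrability of the limit is a conclusion. -/
lemma sq_fatou {f : ℕ → Ω → ℝ} {g : Ω → ℝ} {C : ℝ}
    (hf : ∀ n, MemLp (f n) 2 P) (hC : ∀ n, ∫ ω, f n ω ^ 2 ∂P ≤ C)
    (h : ∀ᵐ ω ∂P, Tendsto (fun n => f n ω) atTop (𝓝 (g ω))) :
    MemLp g 2 P ∧ ∫ ω, g ω ^ 2 ∂P ≤ C := by
  have hg : AEStronglyMeasurable g P :=
    aestronglyMeasurable_of_tendsto_ae _ (fun n => (hf n).1) h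
  have hC0 : 0 ≤ C := (integral_nonneg fun ω => sq_nonneg (f 0 ω)).trans (hC 0)
  have h1 : ∫⁻ ω, ENNReal.ofReal (g ω ^ 2) ∂P ≤ ENNReal.ofReal C := by
    calc ∫⁻ ω, ENNReal.ofReal (g ω ^ 2) ∂P
        = ∫⁻ ω, liminf (fun n => ENNReal.ofReal (f n ω ^ 2)) atTop ∂P := by
          refine lintegral_congr_ae ?_
          filter_upwards [h] with ω hω
          exact ((ENNReal.tendsto_ofReal (hω.pow 2)).liminf_eq).symm
      _ ≤ liminf (fun n => ∫⁻ ω, ENNReal.ofReal (f n ω ^ 2) ∂P) atTop :=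
          lintegral_liminf_le' fun n => ((hf n).1.aemeasurable.pow_const 2).ennreal_ofReal
      _ ≤ ENNReal.ofReal C := by
          refine liminf_le_of_le (by isBoundedDefault) fun b hb => ?_
          obtain ⟨n, hn⟩ := hb.exists
          refine hn.trans ?_
          rw [← ofReal_integral_eq_lintegral_ofReal (hf n).integrable_sq
            (Eventually.of_forall fun ω => sq_nonneg _)]
          exact ENNReal.ofReal_le_ofReal (hC n)
  have hi : Integrable (fun ω => g ω ^ 2) P := by
    refine ⟨hg.pow 2, ?_⟩
    rw [hasFiniteIntegral_iff_ofReal (Eventually.of_forall fun ω => sq_nonneg _)]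
    exact h1.trans_lt ENNReal.ofReal_lt_top
  refine ⟨(memLp_two_iff_integrable_sq hg).2 hi, ?_⟩
  rw [← ofReal_integral_eq_lintegral_ofReal hi (Eventually.of_forall fun ω => sq_nonneg _)] at h1
  exact (ENNReal.ofReal_le_ofReal_iff hC0).1 h1

/-- Convergence of the means of an `L²`-bounded a.e. convergent sequence. -/
lemma tendsto_integral_of_sq_bounded [IsProbabilityMeasure P] {f : ℕ → Ω → ℝ} {g : Ω → ℝ} {C : ℝ}
    (hf : ∀ n, MemLp (f n) 2 P) (hC : ∀ n, ∫ ω, f n ω ^ 2 ∂P ≤ C)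
    (h : ∀ᵐ ω ∂P, Tendsto (fun n => f n ω) atTop (𝓝 (g ω))) :
    Tendsto (fun n => ∫ ω, f n ω ∂P) atTop (𝓝 (∫ ω, g ω ∂P)) := by
  obtain ⟨hg, hgC⟩ := sq_fatou hf hC h
  have hC0 : 0 ≤ C := (integral_nonneg fun ω => sq_nonneg (f 0 ω)).trans (hC 0)
  have hfi : ∀ n, Integrable (f n) P := fun n => (hf n).integrable (by norm_num)
  have hgi : Integrable g P := hg.integrable (by norm_num)
  have hdi : ∀ n, Integrable (fun ω => (f n ω - g ω) ^ 2) P := fun n =>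
    ((hf n).sub hg).integrable_sq
  have hd : ∀ n, ∫ ω, (f n ω - g ω) ^ 2 ∂P ≤ 4 * C := by
    intro n
    calc ∫ ω, (f n ω - g ω) ^ 2 ∂P ≤ ∫ ω, (2 * f n ω ^ 2 + 2 * g ω ^ 2) ∂P := by
          refine integral_mono (hdi n) (((hf n).integrable_sq.const_mul 2).add
            (hg.integrable_sq.const_mul 2)) fun ω => ?_
          dsimp only
          nlinarith [sq_nonneg (f n ω + g ω)]
      _ = 2 * ∫ ω, f n ω ^ 2 ∂P + 2 * ∫ ω, g ω ^ 2 ∂P := by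
          rw [integral_add ((hf n).integrable_sq.const_mul 2) (hg.integrable_sq.const_mul 2),
            integral_const_mul, integral_const_mul]
      _ ≤ 4 * C := by linarith [hC n]
  rw [Metric.tendsto_atTop]
  intro ε hε
  -- The cut-off level makes `4 * C / M < ε / 2`. Below it dominated convergence applies; above it
  -- `|x| ≤ x ^ 2 / M`.
  set M : ℝ := 8 * C / ε + 1 with hM
  have hMpos : 0 < M := by positivity
  have hmin : Tendsto (fun n => ∫ ω, min |f n ω - g ω| M ∂P) atTop (𝓝 (∫ _, (0 : ℝ) ∂P)) := by
    refine tendsto_integral_of_dominated_convergence (fun _ => M) (fun n => ?_)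
      (integrable_const M) (fun n => Eventually.of_forall fun ω => ?_) ?_
    · exact (((hfi n).sub hgi).abs.1.inf aestronglyMeasurable_const)
    · rw [Real.norm_eq_abs, abs_of_nonneg (le_min (abs_nonneg _) hMpos.le)]
      exact min_le_right _ _
    · filter_upwards [h] with ω hω
      have h1 : Tendsto (fun n => min |f n ω - g ω| M) atTop (𝓝 (min |g ω - g ω| M)) :=
        ((hω.sub_const (g ω)).abs).min tendsto_const_nhds
      simpa [hMpos.le] using h1
  rw [integral_zero, Metric.tendsto_atTop] at hmin
  obtain ⟨N, hN⟩ := hmin (ε / 2) (by positivity)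
  refine ⟨N, fun n hn => ?_⟩
  have h1 := hN n hn
  rw [Real.dist_eq, sub_zero] at h1
  have hmi : Integrable (fun ω => min |f n ω - g ω| M) P :=
    ((hfi n).sub hgi).abs.inf (integrable_const M)
  rw [Real.dist_eq, ← integral_sub (hfi n) hgi]
  calc |∫ ω, (f n ω - g ω) ∂P| ≤ ∫ ω, |f n ω - g ω| ∂P := abs_integral_le_integral_abs
    _ ≤ ∫ ω, (min |f n ω - g ω| M + (f n ω - g ω) ^ 2 / M) ∂P := by
        refine integral_mono ((hfi n).sub hgi).abs (hmi.add ((hdi n).div_const M)) fun ω => ?_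
        dsimp only
        rcases le_total |f n ω - g ω| M with h | h
        · rw [min_eq_left h]; linarith [div_nonneg (sq_nonneg (f n ω - g ω)) hMpos.le]
        · rw [min_eq_right h]
          have : |f n ω - g ω| ≤ (f n ω - g ω) ^ 2 / M := by
            rw [le_div_iff₀ hMpos, ← sq_abs (f n ω - g ω), sq]
            gcongr
          linarith
    _ = ∫ ω, min |f n ω - g ω| M ∂P + (∫ ω, (f n ω - g ω) ^ 2 ∂P) / M := by
        rw [integral_add hmi ((hdi n).div_const M), integral_div]
    _ ≤ ∫ ω, min |f n ω - g ω| M ∂P + 4 * C / M := by gcongr; exact hd n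
    _ < ε / 2 + ε / 2 := by
        refine add_lt_add ((le_abs_self _).trans_lt h1) ?_
        rw [div_lt_iff₀ hMpos, hM]
        field_simp
        linarith
    _ = ε := by ring

/-- Finitely many sequences that converge in measure converge a.e. along a common subsequence. -/
lemma exists_common_seq_tendsto_ae {f : ℕ → ℕ → Ω → ℝ} {g : ℕ → Ω → ℝ} (N : ℕ)
    (h : ∀ i < N, TendstoInMeasure P (f i) atTop (g i)) :
    ∃ ns : ℕ → ℕ, StrictMono ns ∧
      ∀ i < N, ∀ᵐ ω ∂P, Tendsto (fun m => f i (ns m) ω) atTop (𝓝 (g i ω)) := by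
  induction N with
  | zero => exact ⟨id, strictMono_id, by simp⟩
  | succ N ih =>
    obtain ⟨ns, hns, hc⟩ := ih fun i hi => h i (by omega)
    obtain ⟨ms, hms, hd⟩ := ((h N (by omega)).comp hns.tendsto_atTop).exists_seq_tendsto_ae
    refine ⟨ns ∘ ms, hns.comp hms, fun i hi => ?_⟩
    rcases Nat.lt_succ_iff_lt_or_eq.1 hi with hi | rfl
    · filter_upwards [hc i hi] with ω hω using hω.comp hms.tendsto_atTop
    · exact hd

end Convergence

/-! ### Orthogonality of martingale increments -/

section Orthogonality

variable {P : Measure Ω}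

lemma indepFun_of_indep_comap {m : MeasurableSpace Ω} {ξ η : Ω → ℝ}
    (hξ : StronglyMeasurable[m] ξ) (hη : Indep (MeasurableSpace.comap η inferInstance) m P) :
    IndepFun ξ η P := by
  rw [IndepFun_iff_Indep]
  exact (indep_of_indep_of_le_right hη hξ.measurable.comap_le).symm

lemma memLp_mul_of_bounded {ξ η : Ω → ℝ} {C : ℝ} (hξ : AEStronglyMeasurable ξ P)
    (hC : ∀ ω, |ξ ω| ≤ C) (hη : MemLp η 2 P) : MemLp (fun ω => ξ ω * η ω) 2 P :=
  MemLp.mul' hη (memLp_top_of_bound hξ C (Eventually.of_forall hC))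

/-- Second moment of a discrete stochastic integral. -/
lemma integral_sum_mul_sq [IsProbabilityMeasure P] (𝓖 : Filtration ℕ mΩ) {ξ η : ℕ → Ω → ℝ} {C : ℝ}
    (hξ : ∀ i, StronglyMeasurable[𝓖 i] (ξ i)) (hC : ∀ i ω, |ξ i ω| ≤ C)
    (hη : ∀ i, StronglyMeasurable[𝓖 (i + 1)] (η i)) (hη2 : ∀ i, MemLp (η i) 2 P)
    (hη0 : ∀ i, ∫ ω, η i ω ∂P = 0)
    (hind : ∀ i, Indep (MeasurableSpace.comap (η i) inferInstance) (𝓖 i) P) (N : ℕ) :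
    StronglyMeasurable[𝓖 N] (fun ω => ∑ i ∈ Finset.range N, ξ i ω * η i ω) ∧
    MemLp (fun ω => ∑ i ∈ Finset.range N, ξ i ω * η i ω) 2 P ∧
    ∫ ω, (∑ i ∈ Finset.range N, ξ i ω * η i ω) ^ 2 ∂P =
      ∑ i ∈ Finset.range N, (∫ ω, ξ i ω ^ 2 ∂P) * ∫ ω, η i ω ^ 2 ∂P := by
  have hξm : ∀ i, StronglyMeasurable (ξ i) := fun i => (hξ i).mono (𝓖.le i)
  have hηm : ∀ i, StronglyMeasurable (η i) := fun i => (hη i).mono (𝓖.le (i + 1))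
  induction N with
  | zero => exact ⟨by simpa using stronglyMeasurable_const, by simp, by simp⟩
  | succ N ih =>
    obtain ⟨h1, h2, h3⟩ := ih
    set S : Ω → ℝ := fun ω => ∑ i ∈ Finset.range N, ξ i ω * η i ω with hS
    have hp : MemLp (fun ω => ξ N ω * η N ω) 2 P :=
      memLp_mul_of_bounded (hξm N).aestronglyMeasurable (hC N) (hη2 N)
    have hSξ : MemLp (fun ω => ξ N ω * S ω) 2 P :=
      memLp_mul_of_bounded (hξm N).aestronglyMeasurable (hC N) h2
    have hi1 := indepFun_of_indep_comap ((hξ N).mul h1) (hind N)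
    have hi2 : IndepFun (fun ω => ξ N ω ^ 2) (fun ω => η N ω ^ 2) P :=
      (indepFun_of_indep_comap (hξ N) (hind N)).comp (measurable_id.pow_const 2)
        (measurable_id.pow_const 2)
    -- Cross term: `ξ N * S` is known at stage `N`, while `η N` is independent of that stage and
    -- centered.
    have e1 : ∫ ω, ξ N ω * S ω * η N ω ∂P = 0 := by
      have := hi1.integral_fun_mul_eq_mul_integral hSξ.1 (hηm N).aestronglyMeasurable
      simpa [hη0 N] using this
    have e2 : ∫ ω, ξ N ω ^ 2 * η N ω ^ 2 ∂P = (∫ ω, ξ N ω ^ 2 ∂P) * ∫ ω, η N ω ^ 2 ∂P :=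
      hi2.integral_fun_mul_eq_mul_integral ((hξm N).pow 2).aestronglyMeasurable
        ((hηm N).pow 2).aestronglyMeasurable
    simp only [Finset.sum_range_succ]
    refine ⟨(h1.mono (𝓖.mono N.le_succ)).add (((hξ N).mono (𝓖.mono N.le_succ)).mul (hη N)),
      h2.add hp, ?_⟩
    have hx : Integrable (fun ω => S ω * (ξ N ω * η N ω)) P := h2.integrable_mul hp
    calc ∫ ω, (S ω + ξ N ω * η N ω) ^ 2 ∂P
        = ∫ ω, (S ω ^ 2 + 2 * (S ω * (ξ N ω * η N ω)) + (ξ N ω * η N ω) ^ 2) ∂P := by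
          refine integral_congr_ae (Eventually.of_forall fun ω => ?_); dsimp only; ring
      _ = ∫ ω, S ω ^ 2 ∂P + 2 * ∫ ω, S ω * (ξ N ω * η N ω) ∂P +
            ∫ ω, (ξ N ω * η N ω) ^ 2 ∂P := by
          have hs : Integrable (fun ω => S ω ^ 2 + 2 * (S ω * (ξ N ω * η N ω))) P :=
            h2.integrable_sq.add (hx.const_mul 2)
          rw [integral_add hs hp.integrable_sq,
            integral_add h2.integrable_sq (hx.const_mul 2), integral_const_mul]
      _ = _ := by
          rw [h3, show (fun ω => S ω * (ξ N ω * η N ω)) = fun ω => ξ N ω * S ω * η N ω from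
            funext fun ω => by ring, e1, funext fun ω => mul_pow (ξ N ω) (η N ω) 2, e2]
          ring

end Orthogonality

/-! ### Uniform grids -/

/-- The `i`-th point of the uniform partition of `[0, T]` into `n` intervals. -/
def grid (T : ℝ≥0) (n i : ℕ) : ℝ≥0 := T * (i : ℝ≥0) / (n : ℝ≥0)

lemma grid_zero (T : ℝ≥0) (n : ℕ) : grid T n 0 = 0 := by simp [grid]

lemma grid_self (T : ℝ≥0) {n : ℕ} (hn : n ≠ 0) : grid T n n = T := by
  have : (n : ℝ≥0) ≠ 0 := by exact_mod_cast hn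
  simp [grid, this]

lemma coe_grid (T : ℝ≥0) (n i : ℕ) : (grid T n i : ℝ) = T * i / n := by simp [grid]

lemma grid_mono (T : ℝ≥0) (n : ℕ) : Monotone (grid T n) := by
  intro i j hij
  unfold grid
  gcongr

lemma grid_le (T : ℝ≥0) {n i : ℕ} (hi : i ≤ n) : grid T n i ≤ T := by
  rcases eq_or_ne n 0 with rfl | hn
  · simp [grid]
  · exact (grid_mono T n hi).trans_eq (grid_self T hn)

lemma grid_succ_sub (T : ℝ≥0) (n i : ℕ) :
    (grid T n (i + 1) : ℝ) - grid T n i = T / n := by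
  rw [coe_grid, coe_grid]; push_cast; ring

lemma grid_mul_mul (T : ℝ≥0) (n i : ℕ) {m : ℕ} (hm : m ≠ 0) :
    grid T (n * m) (i * m) = grid T n i := by
  have : (m : ℝ≥0) ≠ 0 := by exact_mod_cast hm
  unfold grid; push_cast
  rw [← mul_assoc, mul_div_mul_right _ _ this]

lemma grid_grid (T : ℝ≥0) (n m j : ℕ) {i : ℕ} (hi : i ≠ 0) :
    grid (grid T n i) (i * m) j = grid T (n * m) j := by
  have : (i : ℝ≥0) ≠ 0 := by exact_mod_cast hi
  unfold grid; push_cast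
  rw [div_mul_eq_mul_div, div_div, mul_right_comm, show (n : ℝ≥0) * (i * m) = n * m * i by ring,
    mul_div_mul_right _ _ this]

/-- The filtration along a grid. -/
def gridFiltration (𝓕 : Filtration ℝ≥0 mΩ) (T : ℝ≥0) (n : ℕ) : Filtration ℕ mΩ where
  seq i := 𝓕 (grid T n i)
  mono' _ _ hij := 𝓕.mono (grid_mono T n hij)
  le' _ := 𝓕.le _

lemma sum_range_mul_eq (n m : ℕ) (a : ℕ → ℝ) :
    ∑ j ∈ Finset.range (n * m), a j =
      ∑ i ∈ Finset.range n, ∑ j ∈ Finset.Ico (i * m) ((i + 1) * m), a j := by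
  induction n with
  | zero => simp
  | succ n ih =>
    rw [Finset.sum_range_succ, ← ih, Finset.sum_range_add_sum_Ico _ (by gcongr; omega)]

lemma div_eq_of_mem_Ico {i m j : ℕ} (h : j ∈ Finset.Ico (i * m) ((i + 1) * m)) : j / m = i := by
  rw [Finset.mem_Ico] at h
  have hm : 0 < m := Nat.pos_of_ne_zero fun h0 => by simp [h0] at h
  exact Nat.div_eq_of_lt_le h.1 h.2

/-! ### Brownian increments -/

namespace IsIndepBMPair

variable {P : Measure Ω} {𝓕 : Filtration ℝ≥0 mΩ} {Z X : ℝ≥0 → Ω → ℝ}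

lemma hasLaw_sub_Z (h : IsIndepBMPair P 𝓕 Z X) {s t : ℝ≥0} (hst : s ≤ t) :
    HasLaw (fun ω => Z t ω - Z s ω) (gaussianReal 0 (t - s)) P := by
  have := h.brownian_Z.hasLaw_sub t s
  have e : nndist t.1 s.1 = t - s := by
    ext
    rw [coe_nndist, Real.dist_eq, NNReal.coe_sub hst]
    exact abs_of_nonneg (sub_nonneg.2 hst)
  rwa [e] at this

lemma indep_sub_Z (h : IsIndepBMPair P 𝓕 Z X) {s t : ℝ≥0} (hst : s ≤ t) :
    Indep (MeasurableSpace.comap (fun ω => Z t ω - Z s ω) inferInstance) (𝓕 s) P := by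
  refine indep_of_indep_of_le_left (h.indep_increments s t hst) ?_
  have : (fun ω => Z t ω - Z s ω) = Prod.fst ∘ fun ω => (Z t ω - Z s ω, X t ω - X s ω) := rfl
  rw [this, ← MeasurableSpace.comap_comp]
  exact MeasurableSpace.comap_mono measurable_fst.comap_le

lemma stronglyMeasurable_sub_Z (h : IsIndepBMPair P 𝓕 Z X) {s t : ℝ≥0} (hst : s ≤ t) :
    StronglyMeasurable[𝓕 t] (fun ω => Z t ω - Z s ω) :=
  (h.adapted_Z t).sub ((h.adapted_Z s).mono (𝓕.mono hst))

lemma grid_step (T : ℝ≥0) (n i : ℕ) : grid T n (i + 1) - grid T n i = T / n := by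
  ext
  rw [NNReal.coe_sub (grid_mono T n i.le_succ), grid_succ_sub]; simp

lemma hasLaw_grid (h : IsIndepBMPair P 𝓕 Z X) (T : ℝ≥0) (n i : ℕ) :
    HasLaw (fun ω => Z (grid T n (i + 1)) ω - Z (grid T n i) ω) (gaussianReal 0 (T / n)) P := by
  rw [← grid_step T n i]
  exact h.hasLaw_sub_Z (grid_mono T n i.le_succ)

/-- Second moment of the Riemann sums of bounded adapted integrands against drifted Brownian
motion. -/
lemma integral_sum_mul_drifted_sq [IsProbabilityMeasure P] (h : IsIndepBMPair P 𝓕 Z X) (μ : ℝ)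
    (T : ℝ≥0) {N : ℕ} (hN : N ≠ 0) {ξ : ℕ → Ω → ℝ} {C : ℝ}
    (hξ : ∀ i, StronglyMeasurable[𝓕 (grid T N i)] (ξ i)) (hC : ∀ i ω, |ξ i ω| ≤ C) :
    MemLp (fun ω => ∑ i ∈ Finset.range N, ξ i ω *
      (drifted Z μ (grid T N (i + 1)) ω - drifted Z μ (grid T N i) ω)) 2 P ∧
    ∫ ω, (∑ i ∈ Finset.range N, ξ i ω *
      (drifted Z μ (grid T N (i + 1)) ω - drifted Z μ (grid T N i) ω)) ^ 2 ∂P ≤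
      2 * (1 + μ ^ 2 * T) * (T / N) * ∑ i ∈ Finset.range N, ∫ ω, ξ i ω ^ 2 ∂P := by
  have hN' : (0 : ℝ) < N := by positivity
  set η : ℕ → Ω → ℝ := fun i ω => Z (grid T N (i + 1)) ω - Z (grid T N i) ω with hη
  have hlaw : ∀ i, HasLaw (η i) (gaussianReal 0 (T / N)) P := h.hasLaw_grid T N
  have hηsq : ∀ i, ∫ ω, η i ω ^ 2 ∂P = T / N := fun i => by
    rw [integral_comp_of_hasLaw (hlaw i) (f := fun x => x ^ 2) (by fun_prop),
      integral_sq_gaussianReal]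
    simp
  obtain ⟨-, h2, h3⟩ := integral_sum_mul_sq (gridFiltration 𝓕 T N) (η := η) hξ hC
    (fun i => h.stronglyMeasurable_sub_Z (grid_mono T N i.le_succ))
    (fun i => HasAllMoments.of_hasLaw (hlaw i) 2 (by simp))
    (fun i => by
      rw [integral_comp_of_hasLaw (hlaw i) (f := fun x => x) (by fun_prop),
        integral_id_gaussianReal_zero])
    (fun i => h.indep_sub_Z (grid_mono T N i.le_succ)) N
  simp only [hηsq] at h3
  have hξL : ∀ i, MemLp (ξ i) 2 P := fun i =>
    MemLp.of_bound ((hξ i).mono (𝓕.le _)).aestronglyMeasurable C (Eventually.of_forall (hC i))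
  have hD : MemLp (fun ω => ∑ i ∈ Finset.range N, ξ i ω) 2 P :=
    memLp_finsetSum _ fun i _ => hξL i
  -- Cauchy–Schwarz for the drift part. The factor `N` is absorbed by `(T/N)²`, which leaves `T ·
  -- (T/N)`, the same order as the martingale part.
  have hD2 : ∫ ω, (∑ i ∈ Finset.range N, ξ i ω) ^ 2 ∂P ≤
      N * ∑ i ∈ Finset.range N, ∫ ω, ξ i ω ^ 2 ∂P := by
    rw [← integral_finsetSum _ fun i _ => (hξL i).integrable_sq, ← integral_const_mul]
    refine integral_mono hD.integrable_sq
      ((integrable_finsetSum _ fun i _ => (hξL i).integrable_sq).const_mul _) fun ω => ?_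
    simpa using sq_sum_le_card_mul_sum_sq (s := Finset.range N) (f := fun i => ξ i ω)
  have hsplit : ∀ ω, ∑ i ∈ Finset.range N, ξ i ω *
      (drifted Z μ (grid T N (i + 1)) ω - drifted Z μ (grid T N i) ω) =
      ∑ i ∈ Finset.range N, ξ i ω * η i ω + μ * (T / N) * ∑ i ∈ Finset.range N, ξ i ω := by
    intro ω
    rw [Finset.mul_sum, ← Finset.sum_add_distrib]
    refine Finset.sum_congr rfl fun i _ => ?_
    simp only [drifted, hη, ← grid_succ_sub T N i]
    ring
  simp only [hsplit]
  refine ⟨h2.add (hD.const_mul _), ?_⟩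
  calc ∫ ω, (∑ i ∈ Finset.range N, ξ i ω * η i ω +
        μ * (T / N) * ∑ i ∈ Finset.range N, ξ i ω) ^ 2 ∂P
      ≤ ∫ ω, (2 * (∑ i ∈ Finset.range N, ξ i ω * η i ω) ^ 2 +
        2 * (μ * (T / N)) ^ 2 * (∑ i ∈ Finset.range N, ξ i ω) ^ 2) ∂P := by
        refine integral_mono (h2.add (hD.const_mul _)).integrable_sq
          ((h2.integrable_sq.const_mul 2).add (hD.integrable_sq.const_mul _)) fun ω => ?_
        dsimp only
        nlinarith [sq_nonneg (∑ i ∈ Finset.range N, ξ i ω * η i ω -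
          μ * (T / N) * ∑ i ∈ Finset.range N, ξ i ω)]
    _ = 2 * ∫ ω, (∑ i ∈ Finset.range N, ξ i ω * η i ω) ^ 2 ∂P +
        2 * (μ * (T / N)) ^ 2 * ∫ ω, (∑ i ∈ Finset.range N, ξ i ω) ^ 2 ∂P := by
        rw [integral_add (h2.integrable_sq.const_mul 2) (hD.integrable_sq.const_mul _),
          integral_const_mul, integral_const_mul]
    _ ≤ 2 * (∑ i ∈ Finset.range N, (∫ ω, ξ i ω ^ 2 ∂P) * (T / N)) +
        2 * (μ * (T / N)) ^ 2 * (N * ∑ i ∈ Finset.range N, ∫ ω, ξ i ω ^ 2 ∂P) := by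
        rw [h3]; gcongr
    _ = _ := by
        rw [← Finset.sum_mul]; field_simp

end IsIndepBMPair

/-! ### Truncation -/

/-- Truncation to `[-K, K]`. -/
def clip (K x : ℝ) : ℝ := max (-K) (min K x)

lemma continuous_clip (K : ℝ) : Continuous (clip K) := by unfold clip; fun_prop

lemma abs_clip_le {K : ℝ} (hK : 0 ≤ K) (x : ℝ) : |clip K x| ≤ K :=
  abs_le.2 ⟨le_max_left _ _, max_le (by linarith) (min_le_left _ _)⟩

lemma clip_eq {K x : ℝ} (h : |x| ≤ K) : clip K x = x := by
  rw [abs_le] at h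
  rw [clip, min_eq_right h.2, max_eq_right h.1]

/-- A bounded process with continuous paths is uniformly continuous in mean square on compacts. -/
lemma exists_meanSquare_modulus {P : Measure Ω} [IsProbabilityMeasure P] {h : ℝ≥0 → Ω → ℝ} {K : ℝ}
    (hm : ∀ t, AEStronglyMeasurable (h t) P) (hK : ∀ t ω, |h t ω| ≤ K)
    (hc : ∀ᵐ ω ∂P, Continuous fun t => h t ω) (T : ℝ≥0) {ε : ℝ} (hε : 0 < ε) :
    ∀ᶠ n : ℕ in atTop, ∀ s ≤ T, ∀ t ≤ T, |(s : ℝ) - t| ≤ T / n →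
      ∫ ω, (h s ω - h t ω) ^ 2 ∂P ≤ ε := by
  -- Boundedness makes `g` continuous by dominated convergence, hence uniformly continuous on the
  -- compact square; since `g` vanishes on the diagonal, comparison of `(s, t)` with `(t, t)`
  -- suffices.
  set g : ℝ≥0 × ℝ≥0 → ℝ := fun p => ∫ ω, (h p.1 ω - h p.2 ω) ^ 2 ∂P with hg
  have hcont : Continuous g := by
    refine continuous_of_dominated (bound := fun _ => (2 * K) ^ 2)
      (fun p => ((hm p.1).sub (hm p.2)).pow 2) (fun p => Eventually.of_forall fun ω => ?_)
      (integrable_const _) ?_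
    · rw [Real.norm_eq_abs, abs_pow]
      gcongr
      exact (abs_sub _ _).trans (by linarith [hK p.1 ω, hK p.2 ω])
    · filter_upwards [hc] with ω hω
      exact ((hω.comp continuous_fst).sub (hω.comp continuous_snd)).pow 2
  have huc := (isCompact_Icc (a := (0 : ℝ≥0)) (b := T)).prod
    (isCompact_Icc (a := (0 : ℝ≥0)) (b := T)) |>.uniformContinuousOn_of_continuous
    hcont.continuousOn
  rw [Metric.uniformContinuousOn_iff] at huc
  obtain ⟨δ, hδ, hu⟩ := huc ε hε
  filter_upwards [(tendsto_const_div_atTop_nhds_zero_nat (T : ℝ)).eventually_lt_const hδ]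
    with n hn s hs t ht hst
  have := hu (s, t) ⟨⟨zero_le, hs⟩, ⟨zero_le, ht⟩⟩ (t, t)
    ⟨⟨zero_le, ht⟩, ⟨zero_le, ht⟩⟩ (by
      rw [Prod.dist_eq, dist_self, max_eq_left dist_nonneg]
      exact (NNReal.dist_eq s t).trans_lt (hst.trans_lt hn))
  rw [Real.dist_eq] at this
  have h0 : g (t, t) = 0 := by simp [hg]
  rw [h0, sub_zero] at this
  exact (le_abs_self _).trans this.le

/-! ### One-step estimates for the inverse of geometric Brownian motion -/

/-- One-step factor of `exp (-(α Z_t + (α μ - α ^ 2 / 2) t))`. -/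
def invFactor (α μ δ z : ℝ) : ℝ := Real.exp (-α * z - (α * μ - α ^ 2 / 2) * δ)

/-- Defect of the Euler step against the inverse factor. -/
def eulerDefect (α μ δ z : ℝ) : ℝ := (1 + α * (z + μ * δ)) * invFactor α μ δ z - 1

lemma invFactor_eq (α μ δ z : ℝ) :
    invFactor α μ δ z = Real.exp (-(α * μ - α ^ 2 / 2) * δ) * Real.exp (-α * z) := by
  rw [invFactor, ← Real.exp_add]; ring_nf

lemma invFactor_sq (α μ δ z : ℝ) :
    invFactor α μ δ z ^ 2 = Real.exp (-(2 * α * μ - α ^ 2) * δ) * Real.exp (-2 * α * z) := by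
  rw [invFactor, ← Real.exp_nat_mul, ← Real.exp_add]; push_cast; ring_nf

lemma continuous_invFactor (α μ δ : ℝ) : Continuous (invFactor α μ δ) := by
  unfold invFactor; fun_prop

lemma continuous_eulerDefect (α μ δ : ℝ) : Continuous (eulerDefect α μ δ) := by
  have := continuous_invFactor α μ δ
  unfold eulerDefect; fun_prop

lemma integrable_exp_gaussianReal' (v : ℝ≥0) (a : ℝ) :
    Integrable (fun z : ℝ => Real.exp (a * z)) (gaussianReal 0 v) :=
  integrable_exp_mul_gaussianReal a

/-- This and the two integrals below are needed in closed form only so that they can be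
differentiated in `v` at `0`. -/
lemma integral_invFactor_sub_one_sq (α μ : ℝ) (v : ℝ≥0) :
    ∫ z, (invFactor α μ v z - 1) ^ 2 ∂(gaussianReal 0 v) =
      Real.exp ((3 * α ^ 2 - 2 * α * μ) * v) - 2 * Real.exp ((α ^ 2 - α * μ) * v) + 1 := by
  have e : ∀ z, (invFactor α μ v z - 1) ^ 2 =
      Real.exp (-(2 * α * μ - α ^ 2) * v) * Real.exp (-2 * α * z) -
      2 * Real.exp (-(α * μ - α ^ 2 / 2) * v) * Real.exp (-α * z) + 1 := by
    intro z; rw [sub_sq, invFactor_sq, invFactor_eq]; ring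
  simp only [e]
  have hs : Integrable (fun z => Real.exp (-(2 * α * μ - α ^ 2) * v) * Real.exp (-2 * α * z) -
      2 * Real.exp (-(α * μ - α ^ 2 / 2) * v) * Real.exp (-α * z)) (gaussianReal 0 v) :=
    ((integrable_exp_gaussianReal' v _).const_mul _).sub
      ((integrable_exp_gaussianReal' v _).const_mul _)
  rw [integral_add hs (integrable_const _),
    integral_sub ((integrable_exp_gaussianReal' v _).const_mul _)
    ((integrable_exp_gaussianReal' v _).const_mul _), integral_const_mul, integral_const_mul,
    integral_exp_gaussianReal, integral_exp_gaussianReal, mul_assoc 2 (Real.exp _) (Real.exp _),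
        ← Real.exp_add,
    ← Real.exp_add]
  simp only [integral_const, probReal_univ, smul_eq_mul, one_mul]
  ring_nf

lemma integral_eulerDefect (α μ : ℝ) (v : ℝ≥0) :
    ∫ z, eulerDefect α μ v z ∂(gaussianReal 0 v) =
      Real.exp ((α ^ 2 - α * μ) * v) * (1 + (α * μ - α ^ 2) * v) - 1 := by
  have e : ∀ z, eulerDefect α μ v z =
      Real.exp (-(α * μ - α ^ 2 / 2) * v) * (1 + α * μ * v) * Real.exp (-α * z) +
      Real.exp (-(α * μ - α ^ 2 / 2) * v) * α * (z * Real.exp (-α * z)) - 1 := by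
    intro z; rw [eulerDefect, invFactor_eq]; ring
  have hi : Integrable (fun z : ℝ => z * Real.exp (-α * z)) (gaussianReal 0 v) := by
    simpa using integrable_pow_mul_exp_gaussianReal v (-α) 1
  simp only [e]
  have hs : Integrable (fun z =>
      Real.exp (-(α * μ - α ^ 2 / 2) * v) * (1 + α * μ * v) * Real.exp (-α * z) +
      Real.exp (-(α * μ - α ^ 2 / 2) * v) * α * (z * Real.exp (-α * z))) (gaussianReal 0 v) :=
    ((integrable_exp_gaussianReal' v _).const_mul _).add (hi.const_mul _)
  rw [integral_sub hs (integrable_const _), integral_add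
      ((integrable_exp_gaussianReal' v _).const_mul _)
    (hi.const_mul _), integral_const_mul, integral_const_mul, integral_exp_gaussianReal,
    integral_id_mul_exp_gaussianReal]
  simp only [integral_const, probReal_univ, smul_eq_mul, one_mul]
  have e2 : Real.exp ((α ^ 2 - α * μ) * v) =
      Real.exp (-(α * μ - α ^ 2 / 2) * v) * Real.exp (v * (-α) ^ 2 / 2) := by
    rw [← Real.exp_add]; ring_nf
  rw [e2]; ring

lemma integral_eulerDefect_sq (α μ : ℝ) (v : ℝ≥0) :
    ∫ z, eulerDefect α μ v z ^ 2 ∂(gaussianReal 0 v) =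
      Real.exp ((3 * α ^ 2 - 2 * α * μ) * v) *
        ((1 + α * μ * v) ^ 2 - 4 * α ^ 2 * v * (1 + α * μ * v) + α ^ 2 * (v + 4 * α ^ 2 * v ^ 2))
      - 2 * (Real.exp ((α ^ 2 - α * μ) * v) * (1 + (α * μ - α ^ 2) * v) - 1) - 1 := by
  set c := Real.exp (-(2 * α * μ - α ^ 2) * v) with hc
  have e : ∀ z, eulerDefect α μ v z ^ 2 =
      c * (1 + α * μ * v) ^ 2 * Real.exp (-2 * α * z) +
      c * (2 * α * (1 + α * μ * v)) * (z * Real.exp (-2 * α * z)) +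
      c * α ^ 2 * (z ^ 2 * Real.exp (-2 * α * z)) - 2 * eulerDefect α μ v z - 1 := by
    intro z
    have h := invFactor_sq α μ v z
    have h2 : eulerDefect α μ v z ^ 2 =
        (1 + α * (z + μ * v)) ^ 2 * invFactor α μ v z ^ 2 - 2 * eulerDefect α μ v z - 1 := by
      unfold eulerDefect; ring
    rw [h2, h]; ring
  have hi0 := integrable_exp_gaussianReal' v (-2 * α)
  have hi1 : Integrable (fun z : ℝ => z * Real.exp (-2 * α * z)) (gaussianReal 0 v) := by
    simpa using integrable_pow_mul_exp_gaussianReal v (-2 * α) 1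
  have hi2 := integrable_pow_mul_exp_gaussianReal v (-2 * α) 2
  have hiG : Integrable (fun z => eulerDefect α μ v z) (gaussianReal 0 v) := by
    have hi : Integrable (fun z : ℝ => z * Real.exp (-α * z)) (gaussianReal 0 v) := by
      simpa using integrable_pow_mul_exp_gaussianReal v (-α) 1
    refine ((((integrable_exp_gaussianReal' v (-α)).const_mul
      (Real.exp (-(α * μ - α ^ 2 / 2) * v) * (1 + α * μ * v))).add (hi.const_mul
      (Real.exp (-(α * μ - α ^ 2 / 2) * v) * α))).sub (integrable_const 1)).congr
      (Eventually.of_forall fun z => ?_)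
    simp only [Pi.sub_apply, Pi.add_apply, eulerDefect, invFactor_eq]; ring
  have hI := integral_eulerDefect α μ v
  have hs1 : Integrable (fun z => c * (1 + α * μ * v) ^ 2 * Real.exp (-2 * α * z) +
      c * (2 * α * (1 + α * μ * v)) * (z * Real.exp (-2 * α * z))) (gaussianReal 0 v) :=
    (hi0.const_mul _).add (hi1.const_mul _)
  have hs2 : Integrable (fun z => c * (1 + α * μ * v) ^ 2 * Real.exp (-2 * α * z) +
      c * (2 * α * (1 + α * μ * v)) * (z * Real.exp (-2 * α * z)) +
      c * α ^ 2 * (z ^ 2 * Real.exp (-2 * α * z))) (gaussianReal 0 v) :=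
    hs1.add (hi2.const_mul _)
  have hs3 : Integrable (fun z => c * (1 + α * μ * v) ^ 2 * Real.exp (-2 * α * z) +
      c * (2 * α * (1 + α * μ * v)) * (z * Real.exp (-2 * α * z)) +
      c * α ^ 2 * (z ^ 2 * Real.exp (-2 * α * z)) - 2 * eulerDefect α μ v z)
      (gaussianReal 0 v) := hs2.sub (hiG.const_mul 2)
  rw [funext e, integral_sub hs3 (integrable_const _), integral_sub hs2 (hiG.const_mul 2),
    integral_add hs1 (hi2.const_mul _), integral_add (hi0.const_mul _) (hi1.const_mul _),
    integral_const_mul, integral_const_mul, integral_const_mul, integral_const_mul, hI,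
    integral_exp_gaussianReal, integral_id_mul_exp_gaussianReal, integral_sq_mul_exp_gaussianReal]
  simp only [integral_const, probReal_univ, smul_eq_mul, one_mul]
  have e2 : Real.exp ((3 * α ^ 2 - 2 * α * μ) * v) =
      c * Real.exp (v * (-2 * α) ^ 2 / 2) := by
    rw [hc, ← Real.exp_add]; ring_nf
  rw [e2]; ring

lemma hasDerivAt_exp_mul_zero (a : ℝ) : HasDerivAt (fun x : ℝ => Real.exp (a * x)) a 0 := by
  have := ((hasDerivAt_id' (0 : ℝ)).const_mul a).exp
  simpa using this

lemma tendsto_nat_mul_integral_invFactor (α μ : ℝ) (T : ℝ≥0) :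
    Tendsto (fun n : ℕ => (n : ℝ) * ∫ z, (invFactor α μ (T / n : ℝ) z - 1) ^ 2 ∂(gaussianReal 0
        (T / n)))
      atTop (𝓝 (α ^ 2 * T)) := by
  have hd : HasDerivAt (fun x : ℝ => Real.exp ((3 * α ^ 2 - 2 * α * μ) * x) -
      2 * Real.exp ((α ^ 2 - α * μ) * x) + 1) (α ^ 2) 0 :=
    ((((hasDerivAt_exp_mul_zero (3 * α ^ 2 - 2 * α * μ)).sub
      ((hasDerivAt_exp_mul_zero (α ^ 2 - α * μ)).const_mul 2)).add_const 1)).congr_deriv (by ring)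
  refine (tendsto_nat_mul_comp_div hd (by norm_num) T).congr fun n => ?_
  have := integral_invFactor_sub_one_sq α μ (T / n)
  push_cast at this
  rw [this]

/-- To leading order the defect is `α²/2 · (δ - z²)`: its mean cancels at first order in `δ`, and
its second moment is of order `δ²`. The drift correction `-α²/2` in `invFactor` is what produces the
cancellation. -/
lemma tendsto_nat_mul_integral_eulerDefect (α μ : ℝ) (T : ℝ≥0) :
    Tendsto (fun n : ℕ => (n : ℝ) * ∫ z, eulerDefect α μ (T / n : ℝ) z ∂(gaussianReal 0 (T / n)))
      atTop (𝓝 0) := by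
  have hd : HasDerivAt (fun x : ℝ => Real.exp ((α ^ 2 - α * μ) * x) *
      (1 + (α * μ - α ^ 2) * x) - 1) 0 0 :=
    (((hasDerivAt_exp_mul_zero (α ^ 2 - α * μ)).mul
      (((hasDerivAt_id' (0 : ℝ)).const_mul (α * μ - α ^ 2)).const_add 1)).sub_const 1).congr_deriv
      (by simp)
  have := tendsto_nat_mul_comp_div hd (by norm_num) T
  rw [zero_mul] at this
  refine this.congr fun n => ?_
  have := integral_eulerDefect α μ (T / n)
  push_cast at this
  rw [this]

lemma tendsto_nat_mul_integral_eulerDefect_sq (α μ : ℝ) (T : ℝ≥0) :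
    Tendsto (fun n : ℕ => (n : ℝ) * ∫ z, eulerDefect α μ (T / n : ℝ) z ^ 2 ∂(gaussianReal 0
        (T / n)))
      atTop (𝓝 0) := by
  have hid := hasDerivAt_id' (0 : ℝ)
  have h1 : HasDerivAt (fun x : ℝ => 1 + α * μ * x) (α * μ) 0 := by
    simpa using (hid.const_mul (α * μ)).const_add 1
  have hd : HasDerivAt (fun x : ℝ => Real.exp ((3 * α ^ 2 - 2 * α * μ) * x) *
        ((1 + α * μ * x) ^ 2 - 4 * α ^ 2 * x * (1 + α * μ * x) + α ^ 2 * (x + 4 * α ^ 2 * x ^ 2))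
      - 2 * (Real.exp ((α ^ 2 - α * μ) * x) * (1 + (α * μ - α ^ 2) * x) - 1) - 1) 0 0 := by
    refine HasDerivAt.congr_deriv ((((hasDerivAt_exp_mul_zero (3 * α ^ 2 - 2 * α * μ)).mul
      (((h1.fun_pow 2).fun_sub ((hid.const_mul (4 * α ^ 2)).fun_mul h1)).fun_add
      ((hid.fun_add ((hid.fun_pow 2).const_mul (4 * α ^ 2))).const_mul (α ^ 2)))).fun_sub
      ((((hasDerivAt_exp_mul_zero (α ^ 2 - α * μ)).fun_mul
      ((hid.const_mul (α * μ - α ^ 2)).const_add 1)).sub_const 1).const_mul 2)).sub_const 1) ?_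
    simp; ring
  have := tendsto_nat_mul_comp_div hd (by norm_num) T
  rw [zero_mul] at this
  refine this.congr fun n => ?_
  have := integral_eulerDefect_sq α μ (T / n)
  push_cast at this
  rw [this]

/-! ### Uniqueness for the volatility equation -/

/-- Error of one Euler step of `dσ = α σ dB`. -/
def eulerError (σ B : ℝ≥0 → Ω → ℝ) (α : ℝ) (T : ℝ≥0) (n i : ℕ) (ω : Ω) : ℝ :=
  σ (grid T n (i + 1)) ω -
    σ (grid T n i) ω * (1 + α * (B (grid T n (i + 1)) ω - B (grid T n i) ω))

/-- Riemann sums, over the `i`-th interval of the `n`-grid, of `α (f_s - f_{t_i}) dB`. -/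
def blockSum (f B : ℝ≥0 → Ω → ℝ) (α : ℝ) (T : ℝ≥0) (n m i : ℕ) (ω : Ω) : ℝ :=
  ∑ j ∈ Finset.Ico (i * m) ((i + 1) * m),
    (f (grid T (n * m) j) ω - f (grid T n i) ω) *
      (α * (B (grid T (n * m) (j + 1)) ω - B (grid T (n * m) j) ω))

/-- Using `i * m` subintervals of `[0, t_i]` places the sample points on the grid `n * m` of `[0,
T]`. The integrals up to different `t_i` then share one grid and can be subtracted. For `i = 0` the
sums are empty, whence the condition on `I 0`. -/
lemma tendstoInMeasure_riemannSum_grid {P : Measure Ω} {H B I : ℝ≥0 → Ω → ℝ}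
    (h : IsItoIntegral P H B I) (hI : I 0 = 0) (T : ℝ≥0) (n i : ℕ) :
    TendstoInMeasure P (fun m ω => ∑ j ∈ Finset.range (i * m), H (grid T (n * m) j) ω *
      (B (grid T (n * m) (j + 1)) ω - B (grid T (n * m) j) ω)) atTop (I (grid T n i)) := by
  rcases eq_or_ne i 0 with rfl | hi
  · intro ε hε
    simp [grid_zero, hI, hε.ne']
  · have := (h (grid T n i)).comp (ns := fun m : ℕ => i * m) (v := atTop)
      (tendsto_id.const_mul_atTop' (Nat.pos_of_ne_zero hi))
    refine this.congr_left fun m => Eventually.of_forall fun ω => ?_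
    refine Finset.sum_congr rfl fun j _ => ?_
    have e1 : grid T n i * (j : ℝ≥0) / ((i * m : ℕ) : ℝ≥0) = grid T (n * m) j :=
      grid_grid T n m j hi
    have e2 : grid T n i * ((j : ℝ≥0) + 1) / ((i * m : ℕ) : ℝ≥0) = grid T (n * m) (j + 1) := by
      rw [← grid_grid T n m (j + 1) hi]; unfold grid; push_cast; rfl
    rw [e1, e2]

/-- The difference of the Riemann sums up to `t_{i+1}` and `t_i` tends to the increment of `σ`; the
frozen term `σ_{t_i} α dB` telescopes exactly. What remains is the Euler error, now exhibited as a
limit of sums with small integrands. -/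
lemma exists_blockSum_tendsto {P : Measure Ω} {σ B : ℝ≥0 → Ω → ℝ} {α : ℝ}
    (h : IsItoIntegral P σ (fun t ω => α * B t ω) (fun t ω => σ t ω - σ 0 ω))
    (T : ℝ≥0) (n : ℕ) :
    ∃ ms : ℕ → ℕ, (∀ k, ms k ≠ 0) ∧ ∀ i < n, ∀ᵐ ω ∂P,
      Tendsto (fun k => blockSum σ B α T n (ms k) i ω) atTop (𝓝 (eulerError σ B α T n i ω)) := by
  obtain ⟨ns, hns, hc⟩ := exists_common_seq_tendsto_ae (n + 1) fun i _ =>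
    tendstoInMeasure_riemannSum_grid h (by ext; simp) T n i
  -- The shift by one excludes `m = 0`, for which the refined grid degenerates.
  refine ⟨fun k => ns (k + 1), fun k => ?_, fun i hi => ?_⟩
  · have : k + 1 ≤ ns (k + 1) := hns.le_apply
    change ns (k + 1) ≠ 0
    omega
  · filter_upwards [hc i (by omega), hc (i + 1) (by omega)] with ω h1 h2
    have h3 := ((h2.sub h1).comp (tendsto_add_atTop_nat 1)).sub_const
      (σ (grid T n i) ω * (α * (B (grid T n (i + 1)) ω - B (grid T n i) ω)))
    refine Tendsto.congr (fun k => ?_) (h3.trans_eq ?_)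
    · have hm : ns (k + 1) ≠ 0 := by
        have : k + 1 ≤ ns (k + 1) := hns.le_apply
        omega
      simp only [Function.comp_apply, blockSum, sub_mul, Finset.sum_sub_distrib]
      rw [← Finset.sum_Ico_eq_sub _ (by gcongr; omega), ← Finset.mul_sum, ← Finset.mul_sum,
        Finset.sum_Ico_eq_sub (fun j => B (grid T (n * ns (k + 1)) (j + 1)) ω -
          B (grid T (n * ns (k + 1)) j) ω) (by gcongr; omega : i * ns (k + 1) ≤ _),
        Finset.sum_range_sub (fun j => B (grid T (n * ns (k + 1)) j) ω),
        Finset.sum_range_sub (fun j => B (grid T (n * ns (k + 1)) j) ω),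
        grid_mul_mul T n _ hm, grid_mul_mul T n _ hm]
      simp only [mul_sub]
      ring
    · congr 1
      simp only [eulerError]; ring

section

variable {P : Measure Ω} [IsProbabilityMeasure P] {𝓕 : Filtration ℝ≥0 mΩ} {Z X : ℝ≥0 → Ω → ℝ}

/-- All blocks together form one Riemann sum over the fine grid, so orthogonality acts across blocks
as well and the bound carries `∑ κ_i²`, not `(∑ κ_i)²`. The individual bounds `κ i` allow weights
supported on a single index; `L` only supplies uniform boundedness. -/
lemma integral_sum_mul_blockSum_sq (hb : IsIndepBMPair P 𝓕 Z X) (μ α : ℝ) {T : ℝ≥0} {n m : ℕ}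
    (hn : n ≠ 0) (hm : m ≠ 0) {h : ℝ≥0 → Ω → ℝ} {K ε : ℝ}
    (hh : StronglyAdapted 𝓕 h) (hK : ∀ t ω, |h t ω| ≤ K)
    (hmod : ∀ s ≤ T, ∀ t ≤ T, |(s : ℝ) - t| ≤ T / n → ∫ ω, (h s ω - h t ω) ^ 2 ∂P ≤ ε)
    {c : ℕ → Ω → ℝ} {κ : ℕ → ℝ} {L : ℝ} (hc : ∀ i, StronglyMeasurable[𝓕 (grid T n i)] (c i))
    (hcκ : ∀ i ω, |c i ω| ≤ κ i) (hκ : ∀ i, κ i ≤ L) :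
    MemLp (fun ω => ∑ i ∈ Finset.range n, c i ω * blockSum h (drifted Z μ) α T n m i ω) 2 P ∧
    ∫ ω, (∑ i ∈ Finset.range n, c i ω * blockSum h (drifted Z μ) α T n m i ω) ^ 2 ∂P ≤
      2 * (1 + μ ^ 2 * T) * α ^ 2 * (T / n) * ε * ∑ i ∈ Finset.range n, κ i ^ 2 := by
  have hn' : (0 : ℝ) < n := by positivity
  have hm' : (0 : ℝ) < m := by positivity
  -- Here `j / m` is the index of the coarse interval containing the fine point `j`. The integrand
  -- is measurable at that fine point because the coarse one does not lie after it.
  set ξ : ℕ → Ω → ℝ := fun j ω =>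
    c (j / m) ω * (α * (h (grid T (n * m) j) ω - h (grid T n (j / m)) ω)) with hξ
  have hle : ∀ j, grid T n (j / m) ≤ grid T (n * m) j := fun j => by
    rw [← grid_mul_mul T n (j / m) hm]
    exact grid_mono T (n * m) (Nat.div_mul_le_self j m)
  have hdist : ∀ j, (grid T (n * m) j : ℝ) - grid T n (j / m) ≤ T / n := fun j => by
    have h1 : j < (j / m + 1) * m := by
      rw [mul_comm]; exact Nat.lt_mul_div_succ j (Nat.pos_of_ne_zero hm)
    have h2 : grid T (n * m) j ≤ grid T n (j / m + 1) := by
      rw [← grid_mul_mul T n (j / m + 1) hm]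
      exact grid_mono T (n * m) h1.le
    rw [← grid_succ_sub T n (j / m)]
    have h3 : (grid T (n * m) j : ℝ) ≤ grid T n (j / m + 1) := by exact_mod_cast h2
    linarith
  have hκ0 : ∀ i, 0 ≤ κ i := fun i =>
    (abs_nonneg _).trans (hcκ i (Classical.choice (nonempty_of_isProbabilityMeasure P)))
  have hL : 0 ≤ L := (hκ0 0).trans (hκ 0)
  have hξm : ∀ j, StronglyMeasurable[𝓕 (grid T (n * m) j)] (ξ j) := fun j =>
    ((hc (j / m)).mono (𝓕.mono (hle j))).mul
      (((hh _).sub ((hh _).mono (𝓕.mono (hle j)))).const_mul α)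
  have hξb : ∀ j ω, |ξ j ω| ≤ L * (|α| * (2 * K)) := fun j ω => by
    simp only [hξ, abs_mul]
    gcongr
    · exact (hcκ _ ω).trans (hκ _)
    · exact (abs_sub _ _).trans (by linarith [hK (grid T (n * m) j) ω, hK (grid T n (j / m)) ω])
  obtain ⟨h1, h2⟩ := hb.integral_sum_mul_drifted_sq μ T (Nat.mul_ne_zero hn hm) hξm hξb
  have hsum : ∀ ω, ∑ j ∈ Finset.range (n * m), ξ j ω *
      (drifted Z μ (grid T (n * m) (j + 1)) ω - drifted Z μ (grid T (n * m) j) ω) =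
      ∑ i ∈ Finset.range n, c i ω * blockSum h (drifted Z μ) α T n m i ω := fun ω => by
    rw [sum_range_mul_eq]
    refine Finset.sum_congr rfl fun i _ => ?_
    rw [blockSum, Finset.mul_sum]
    refine Finset.sum_congr rfl fun j hj => ?_
    simp only [hξ, div_eq_of_mem_Ico hj]
    ring
  simp only [hsum] at h1 h2
  refine ⟨h1, h2.trans ?_⟩
  have hξ2 : ∀ j ∈ Finset.range (n * m), ∫ ω, ξ j ω ^ 2 ∂P ≤ κ (j / m) ^ 2 * (α ^ 2 * ε) := by
    intro j hj
    have hjn : j < n * m := Finset.mem_range.1 hj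
    have hjm : j / m ≤ n := (Nat.div_lt_of_lt_mul (by rwa [mul_comm] at hjn)).le
    have hd := hmod _ (grid_le T hjn.le) _ (grid_le T hjm) (by
      rw [abs_of_nonneg (sub_nonneg.2 (by exact_mod_cast hle j))]
      exact hdist j)
    have hdi : MemLp (fun ω => h (grid T (n * m) j) ω - h (grid T n (j / m)) ω) 2 P :=
      (MemLp.of_bound ((hh _).mono (𝓕.le _)).aestronglyMeasurable K
        (Eventually.of_forall (hK _))).sub
      (MemLp.of_bound ((hh _).mono (𝓕.le _)).aestronglyMeasurable K
        (Eventually.of_forall (hK _)))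
    calc ∫ ω, ξ j ω ^ 2 ∂P ≤ ∫ ω, κ (j / m) ^ 2 * α ^ 2 *
          (h (grid T (n * m) j) ω - h (grid T n (j / m)) ω) ^ 2 ∂P := by
          refine integral_mono (MemLp.of_bound ((hξm j).mono (𝓕.le _)).aestronglyMeasurable _
            (Eventually.of_forall (hξb j))).integrable_sq (hdi.integrable_sq.const_mul _)
            fun ω => ?_
          simp only [hξ, mul_pow, ← mul_assoc]
          exact mul_le_mul_of_nonneg_right (mul_le_mul_of_nonneg_right
            (sq_le_sq.2 ((hcκ _ ω).trans (le_abs_self _))) (sq_nonneg _)) (sq_nonneg _)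
      _ ≤ _ := by
          rw [integral_const_mul, mul_assoc]
          gcongr
  calc _ ≤ 2 * (1 + μ ^ 2 * T) * (T / (n * m : ℕ)) *
        ∑ j ∈ Finset.range (n * m), κ (j / m) ^ 2 * (α ^ 2 * ε) := by
        gcongr with j hj
        exact hξ2 j hj
    _ = 2 * (1 + μ ^ 2 * T) * (T / (n * m : ℕ)) *
        ∑ i ∈ Finset.range n, (m * (κ i ^ 2 * (α ^ 2 * ε))) := by
        rw [sum_range_mul_eq]
        congr 1
        refine Finset.sum_congr rfl fun i _ => ?_
        rw [Finset.sum_congr rfl fun j hj => by rw [div_eq_of_mem_Ico hj], Finset.sum_const,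
          Nat.card_Ico, nsmul_eq_mul]
        congr 2
        rw [← Nat.sub_mul]; simp
    _ = _ := by
        rw [← Finset.mul_sum, ← Finset.sum_mul]
        push_cast
        field_simp

/-- Mean-square bound for weighted sums of Euler errors, on the event that the solution is
bounded. -/
lemma integral_indicator_sum_mul_eulerError_sq (hb : IsIndepBMPair P 𝓕 Z X) {μ α : ℝ} {T : ℝ≥0}
    {n : ℕ} (hn : n ≠ 0) {σ : ℝ≥0 → Ω → ℝ} {K ε : ℝ} (hK0 : 0 ≤ K) (hσ : StronglyAdapted 𝓕 σ)
    (hsde : IsItoIntegral P σ (fun t ω => α * drifted Z μ t ω) (fun t ω => σ t ω - σ 0 ω))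
    (hmod : ∀ s ≤ T, ∀ t ≤ T, |(s : ℝ) - t| ≤ T / n →
      ∫ ω, (clip K (σ s ω) - clip K (σ t ω)) ^ 2 ∂P ≤ ε)
    {c : ℕ → Ω → ℝ} {κ : ℕ → ℝ} {L : ℝ} (hc : ∀ i, StronglyMeasurable[𝓕 (grid T n i)] (c i))
    (hcκ : ∀ i ω, |c i ω| ≤ κ i) (hκ : ∀ i, κ i ≤ L) {A : Set Ω} (hA : MeasurableSet A)
    (hAσ : ∀ ω ∈ A, ∀ n i, i ≤ n → |σ (grid T n i) ω| ≤ K) :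
    MemLp (A.indicator fun ω => ∑ i ∈ Finset.range n,
      c i ω * eulerError σ (drifted Z μ) α T n i ω) 2 P ∧
    ∫ ω, (A.indicator (fun ω => ∑ i ∈ Finset.range n,
      c i ω * eulerError σ (drifted Z μ) α T n i ω) ω) ^ 2 ∂P ≤
      2 * (1 + μ ^ 2 * T) * α ^ 2 * (T / n) * ε * ∑ i ∈ Finset.range n, κ i ^ 2 := by
  obtain ⟨ms, hms, hlim⟩ := exists_blockSum_tendsto hsde T n
  have hh : StronglyAdapted 𝓕 (fun t ω => clip K (σ t ω)) := fun t =>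
    (continuous_clip K).comp_stronglyMeasurable (hσ t)
  have hbd := fun k => integral_sum_mul_blockSum_sq hb μ α hn (hms k) hh
    (fun t ω => abs_clip_le hK0 _) hmod hc hcκ hκ
  -- The truncated process satisfies the bound on the whole space, and the indicator only decreases
  -- it. On `A` the truncation is inactive on every grid, including the refinements, so the limit
  -- there is the sum for `σ` itself.
  refine sq_fatou (f := fun k => A.indicator fun ω => ∑ i ∈ Finset.range n,
      c i ω * blockSum (fun t ω => clip K (σ t ω)) (drifted Z μ) α T n (ms k) i ω)
    (fun k => (hbd k).1.indicator hA) (fun k => ?_) ?_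
  · refine le_trans (integral_mono ((hbd k).1.indicator hA).integrable_sq
      (hbd k).1.integrable_sq fun ω => ?_) (hbd k).2
    by_cases hω : ω ∈ A
    · simp [hω]
    · simp [hω, sq_nonneg]
  · have hlim' : ∀ᵐ ω ∂P, ∀ i ∈ Finset.range n,
        Tendsto (fun k => blockSum σ (drifted Z μ) α T n (ms k) i ω) atTop
          (𝓝 (eulerError σ (drifted Z μ) α T n i ω)) :=
      (Finset.eventually_all _).2 fun i hi => hlim i (Finset.mem_range.1 hi)
    filter_upwards [hlim'] with ω hω
    by_cases hωA : ω ∈ A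
    · simp only [Set.indicator_of_mem hωA]
      refine tendsto_finsetSum _ fun i hi => ((hω i hi).const_mul (c i ω)).congr fun k => ?_
      congr 1
      refine Finset.sum_congr rfl fun j hj => ?_
      have hi' : i < n := Finset.mem_range.1 hi
      have hj' : j ≤ n * ms k := (Finset.mem_Ico.1 hj).2.le.trans (by gcongr; omega)
      dsimp only
      rw [clip_eq (hAσ ω hωA _ _ hj'), clip_eq (hAσ ω hωA n i hi'.le)]
    · simp only [Set.indicator_of_notMem hωA]
      exact tendsto_const_nhds

end

/-- The inverse of the geometric Brownian motion with volatility `α` driven by `Z^{[μ]}`. -/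
def invGeom (Z : ℝ≥0 → Ω → ℝ) (α μ : ℝ) (t : ℝ≥0) (ω : Ω) : ℝ :=
  Real.exp (-(α * Z t ω + (α * μ - α ^ 2 / 2) * t))

lemma invGeom_grid_succ (Z : ℝ≥0 → Ω → ℝ) (α μ : ℝ) (T : ℝ≥0) (n i : ℕ) (ω : Ω) :
    invGeom Z α μ (grid T n (i + 1)) ω = invGeom Z α μ (grid T n i) ω *
      invFactor α μ (T / n : ℝ) (Z (grid T n (i + 1)) ω - Z (grid T n i) ω) := by
  rw [invGeom, invGeom, invFactor, ← Real.exp_add, ← grid_succ_sub T n i]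
  ring_nf

/-- A discrete product rule. If `σ' = σ (1 + α ΔB) + E` and `Y' = Y f`, then `σ'Y' - σY = Y E + Y (f
- 1) E + σY ((1 + α ΔB) f - 1)`; these increments are summed. -/
lemma mul_invGeom_sub_eq (Z σ : ℝ≥0 → Ω → ℝ) (α μ : ℝ) (T : ℝ≥0) {n : ℕ} (hn : n ≠ 0) (ω : Ω) :
    σ T ω * invGeom Z α μ T ω - σ 0 ω * invGeom Z α μ 0 ω =
      ∑ i ∈ Finset.range n, invGeom Z α μ (grid T n i) ω *
        eulerError σ (drifted Z μ) α T n i ω +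
      ∑ i ∈ Finset.range n, invGeom Z α μ (grid T n i) ω *
        (invFactor α μ (T / n : ℝ) (Z (grid T n (i + 1)) ω - Z (grid T n i) ω) - 1) *
        eulerError σ (drifted Z μ) α T n i ω +
      ∑ i ∈ Finset.range n, σ (grid T n i) ω * invGeom Z α μ (grid T n i) ω *
        eulerDefect α μ (T / n : ℝ) (Z (grid T n (i + 1)) ω - Z (grid T n i) ω) := by
  have h := Finset.sum_range_sub
    (fun i => σ (grid T n i) ω * invGeom Z α μ (grid T n i) ω) n
  rw [grid_self T hn, grid_zero] at h
  rw [← h, ← Finset.sum_add_distrib, ← Finset.sum_add_distrib]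
  refine Finset.sum_congr rfl fun i _ => ?_
  rw [invGeom_grid_succ, eulerDefect, eulerError]
  simp only [drifted]
  rw [show Z (grid T n (i + 1)) ω + μ * (grid T n (i + 1) : ℝ) -
    (Z (grid T n i) ω + μ * (grid T n i : ℝ)) =
    Z (grid T n (i + 1)) ω - Z (grid T n i) ω + μ * (T / n) by rw [← grid_succ_sub T n i]; ring]
  ring

lemma abs_le_half_add_sq_div {x η : ℝ} (hη : 0 < η) : |x| ≤ η / 2 + x ^ 2 / (2 * η) := by
  have : 0 ≤ (|x| - η) ^ 2 / (2 * η) := by positivity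
  have e : (|x| - η) ^ 2 / (2 * η) = η / 2 + x ^ 2 / (2 * η) - |x| := by
    rw [← sq_abs x]; field_simp; ring
  linarith

lemma abs_mul_le_sq_add_sq_div {x y η : ℝ} (hη : 0 < η) :
    |x| * |y| ≤ η / 2 * x ^ 2 + y ^ 2 / (2 * η) := by
  have : 0 ≤ (η * |x| - |y|) ^ 2 / (2 * η) := by positivity
  have e : (η * |x| - |y|) ^ 2 / (2 * η) = η / 2 * x ^ 2 + y ^ 2 / (2 * η) - |x| * |y| := by
    rw [← sq_abs x, ← sq_abs y]; field_simp; ring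
  linarith

section

variable {P : Measure Ω} {𝓕 : Filtration ℝ≥0 mΩ} {Z X : ℝ≥0 → Ω → ℝ}

lemma stronglyAdapted_invGeom (hb : IsIndepBMPair P 𝓕 Z X) (α μ : ℝ) :
    StronglyAdapted 𝓕 (invGeom Z α μ) := fun t =>
  Real.continuous_exp.comp_stronglyMeasurable
    ((((hb.adapted_Z t).const_mul α).add stronglyMeasurable_const).neg)

lemma memLp_eulerDefect [IsProbabilityMeasure P] {f : Ω → ℝ} {v : ℝ≥0} (hf : HasLaw f
    (gaussianReal 0 v) P) (α μ δ : ℝ) :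
    HasAllMoments (fun ω => invFactor α μ δ (f ω)) P ∧
      HasAllMoments (fun ω => eulerDefect α μ δ (f ω)) P := by
  have h1 : HasAllMoments (fun ω => invFactor α μ δ (f ω)) P := by
    simp only [invFactor_eq]
    exact (HasAllMoments.exp_of_hasLaw hf _).const_mul _
  refine ⟨h1, ?_⟩
  exact (((HasAllMoments.const 1).add (((HasAllMoments.of_hasLaw hf).add
    (HasAllMoments.const _)).const_mul α)).mul h1).sub (HasAllMoments.const 1)

/-- Mean-square bound for the accumulated defects of the Euler steps. -/
lemma integral_sum_mul_eulerDefect_sq [IsProbabilityMeasure P] (hb : IsIndepBMPair P 𝓕 Z X)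
    (α μ : ℝ) (T : ℝ≥0) {n : ℕ}
    {ξ : ℕ → Ω → ℝ} {C : ℝ}
    (hξ : ∀ i, StronglyMeasurable[𝓕 (grid T n i)] (ξ i)) (hC : ∀ i ω, |ξ i ω| ≤ C) :
    MemLp (fun ω => ∑ i ∈ Finset.range n, ξ i ω *
      eulerDefect α μ (T / n : ℝ) (Z (grid T n (i + 1)) ω - Z (grid T n i) ω)) 2 P ∧
    ∫ ω, (∑ i ∈ Finset.range n, ξ i ω *
      eulerDefect α μ (T / n : ℝ) (Z (grid T n (i + 1)) ω - Z (grid T n i) ω)) ^ 2 ∂P ≤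
      2 * C ^ 2 * (n * ∫ z, eulerDefect α μ (T / n : ℝ) z ^ 2 ∂(gaussianReal 0 (T / n))) +
      2 * C ^ 2 * (n * ∫ z, eulerDefect α μ (T / n : ℝ) z ∂(gaussianReal 0 (T / n))) ^ 2 := by
  set g := ∫ z, eulerDefect α μ (T / n : ℝ) z ∂(gaussianReal 0 (T / n)) with hg
  set γ := ∫ z, eulerDefect α μ (T / n : ℝ) z ^ 2 ∂(gaussianReal 0 (T / n)) with hγ
  have hcont := continuous_eulerDefect α μ (T / n : ℝ)
  -- Centering the defects: the fluctuations are orthogonal and contribute `n γ`, while the means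
  -- may add up coherently and contribute `(n g)²`.
  set η : ℕ → Ω → ℝ := fun i ω =>
    eulerDefect α μ (T / n : ℝ) (Z (grid T n (i + 1)) ω - Z (grid T n i) ω) - g with hη
  have hlaw := hb.hasLaw_grid T n
  have hmom : ∀ i, HasAllMoments (fun ω =>
      eulerDefect α μ (T / n : ℝ) (Z (grid T n (i + 1)) ω - Z (grid T n i) ω)) P := fun i =>
    (memLp_eulerDefect (hlaw i) α μ _).2
  have hη2 : ∀ i, MemLp (η i) 2 P := fun i =>
    (hmom i).sub (HasAllMoments.const g) 2 (by simp)
  have hint : ∀ i, ∫ ω, eulerDefect α μ (T / n : ℝ)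
      (Z (grid T n (i + 1)) ω - Z (grid T n i) ω) ∂P = g := fun i =>
    integral_comp_of_hasLaw (hlaw i) hcont
  have hintsq : ∀ i, ∫ ω, eulerDefect α μ (T / n : ℝ)
      (Z (grid T n (i + 1)) ω - Z (grid T n i) ω) ^ 2 ∂P = γ := fun i =>
    integral_comp_of_hasLaw (hlaw i) (hcont.pow 2)
  have hηsq : ∀ i, ∫ ω, η i ω ^ 2 ∂P ≤ γ := fun i => by
    have e : ∀ ω, η i ω ^ 2 = eulerDefect α μ (T / n : ℝ)
        (Z (grid T n (i + 1)) ω - Z (grid T n i) ω) ^ 2 - (2 * g) * eulerDefect α μ (T / n : ℝ)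
        (Z (grid T n (i + 1)) ω - Z (grid T n i) ω) + g ^ 2 := fun ω => by
      simp only [hη]; ring
    have hi1 := ((hmom i).pow 2).integrable
    have hi2 := ((hmom i).const_mul (2 * g)).integrable
    have hi3 : Integrable (fun ω => eulerDefect α μ (T / n : ℝ)
        (Z (grid T n (i + 1)) ω - Z (grid T n i) ω) ^ 2 - (2 * g) * eulerDefect α μ (T / n : ℝ)
        (Z (grid T n (i + 1)) ω - Z (grid T n i) ω)) P := hi1.sub hi2
    rw [funext e, integral_add hi3 (integrable_const _), integral_sub hi1 hi2, hintsq,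
      integral_const_mul, hint]
    simp only [integral_const, probReal_univ, smul_eq_mul, one_mul]
    nlinarith [sq_nonneg g]
  have hγ0 : 0 ≤ γ := integral_nonneg fun _ => sq_nonneg _
  obtain ⟨-, h2, h3⟩ := integral_sum_mul_sq (gridFiltration 𝓕 T n) (η := η) hξ hC
    (fun i => ((hcont.comp_stronglyMeasurable
      (hb.stronglyMeasurable_sub_Z (grid_mono T n i.le_succ))).sub stronglyMeasurable_const))
    hη2
    (fun i => by
      simp only [hη]
      rw [integral_sub (hmom i).integrable (integrable_const _), hint]
      simp)
    (fun i => by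
      refine indep_of_indep_of_le_left (hb.indep_sub_Z (grid_mono T n i.le_succ)) ?_
      have : η i = (fun z => eulerDefect α μ (T / n : ℝ) z - g) ∘
        fun ω => Z (grid T n (i + 1)) ω - Z (grid T n i) ω := rfl
      rw [this, ← MeasurableSpace.comap_comp]
      exact MeasurableSpace.comap_mono (hcont.measurable.sub_const g).comap_le) n
  have hC0 : 0 ≤ C := (abs_nonneg _).trans
    (hC 0 (Classical.choice (nonempty_of_isProbabilityMeasure P)))
  have hξm : ∀ i, AEStronglyMeasurable (ξ i) P := fun i =>
    ((hξ i).mono (𝓕.le _)).aestronglyMeasurable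
  have hξL : ∀ i, MemLp (ξ i) 2 P := fun i =>
    MemLp.of_bound (hξm i) C (Eventually.of_forall (hC i))
  have hD : MemLp (fun ω => ∑ i ∈ Finset.range n, ξ i ω) 2 P :=
    memLp_finsetSum _ fun i _ => hξL i
  have hDb : ∀ ω, (∑ i ∈ Finset.range n, ξ i ω) ^ 2 ≤ (n * C) ^ 2 := fun ω => by
    rw [sq_le_sq]
    refine (Finset.abs_sum_le_sum_abs _ _).trans ((Finset.sum_le_sum fun i _ => hC i ω).trans ?_)
    simp [abs_of_nonneg hC0]
  have hsplit : ∀ ω, ∑ i ∈ Finset.range n, ξ i ω *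
      eulerDefect α μ (T / n : ℝ) (Z (grid T n (i + 1)) ω - Z (grid T n i) ω) =
      ∑ i ∈ Finset.range n, ξ i ω * η i ω + g * ∑ i ∈ Finset.range n, ξ i ω := by
    intro ω
    rw [Finset.mul_sum, ← Finset.sum_add_distrib]
    refine Finset.sum_congr rfl fun i _ => ?_
    simp only [hη]; ring
  simp only [hsplit]
  refine ⟨h2.add (hD.const_mul _), ?_⟩
  have hvar : ∫ ω, (∑ i ∈ Finset.range n, ξ i ω * η i ω) ^ 2 ∂P ≤ n * (C ^ 2 * γ) := by
    rw [h3]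
    calc _ ≤ ∑ i ∈ Finset.range n, C ^ 2 * γ := by
          refine Finset.sum_le_sum fun i _ => ?_
          refine mul_le_mul ?_ (hηsq i) (integral_nonneg fun _ => sq_nonneg _) (sq_nonneg _)
          calc ∫ ω, ξ i ω ^ 2 ∂P ≤ ∫ _, C ^ 2 ∂P :=
                integral_mono (hξL i).integrable_sq (integrable_const _) fun ω =>
                  sq_le_sq.2 ((hC i ω).trans (le_abs_self _))
            _ = C ^ 2 := by simp
      _ = _ := by simp
  calc ∫ ω, (∑ i ∈ Finset.range n, ξ i ω * η i ω + g * ∑ i ∈ Finset.range n, ξ i ω) ^ 2 ∂P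
      ≤ ∫ ω, (2 * (∑ i ∈ Finset.range n, ξ i ω * η i ω) ^ 2 + 2 * (g ^ 2 * (n * C) ^ 2)) ∂P := by
        refine integral_mono (h2.add (hD.const_mul _)).integrable_sq
          ((h2.integrable_sq.const_mul 2).add (integrable_const _)) fun ω => ?_
        have := mul_le_mul_of_nonneg_left (hDb ω) (sq_nonneg g)
        dsimp only
        nlinarith [sq_nonneg (∑ i ∈ Finset.range n, ξ i ω * η i ω -
          g * ∑ i ∈ Finset.range n, ξ i ω)]
    _ = 2 * ∫ ω, (∑ i ∈ Finset.range n, ξ i ω * η i ω) ^ 2 ∂P + 2 * (g ^ 2 * (n * C) ^ 2) := by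
        rw [integral_add (h2.integrable_sq.const_mul 2) (integrable_const _),
          integral_const_mul]
        simp
    _ ≤ 2 * (n * (C ^ 2 * γ)) + 2 * (g ^ 2 * (n * C) ^ 2) := by gcongr
    _ = _ := by ring

/-- On `A` each of the three sums of `mul_invGeom_sub_eq` is bounded by Young's inequality with
weight `η`. The Euler-error sums have squared norm of order `η²`, so division by `2η` leaves order
`η`. In the cross sum the squared increments of `Y` carry the small factor `η/2`, and their total
stays bounded. The defect term has the bad factor `1/η` but tends to zero as `n → ∞` with `η` fixed.
-/
lemma integral_indicator_abs_mul_invGeom_sub_le [IsProbabilityMeasure P]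
    (hb : IsIndepBMPair P 𝓕 Z X) {μ α : ℝ} {T : ℝ≥0}
    {n : ℕ} (hn : n ≠ 0) {σ : ℝ≥0 → Ω → ℝ} {K η : ℝ} (hK0 : 0 ≤ K) (hη : 0 < η)
    (hσ : StronglyAdapted 𝓕 σ)
    (hsde : IsItoIntegral P σ (fun t ω => α * drifted Z μ t ω) (fun t ω => σ t ω - σ 0 ω))
    (hmod : ∀ s ≤ T, ∀ t ≤ T, |(s : ℝ) - t| ≤ T / n →
      ∫ ω, (clip K (σ s ω) - clip K (σ t ω)) ^ 2 ∂P ≤ η ^ 2)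
    {A : Set Ω} (hA : MeasurableSet A)
    (hAσ : ∀ ω ∈ A, ∀ n i, i ≤ n → |σ (grid T n i) ω| ≤ K)
    (hAY : ∀ ω ∈ A, ∀ n i, i ≤ n → |invGeom Z α μ (grid T n i) ω| ≤ K) :
    Integrable (A.indicator fun ω =>
      |σ T ω * invGeom Z α μ T ω - σ 0 ω * invGeom Z α μ 0 ω|) P ∧
    ∫ ω, A.indicator (fun ω =>
      |σ T ω * invGeom Z α μ T ω - σ 0 ω * invGeom Z α μ 0 ω|) ω ∂P ≤
      η + (1 + μ ^ 2 * T) * α ^ 2 * T * (K ^ 2 + 1) * η +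
      η / 2 * K ^ 2 *
        (n * ∫ z, (invFactor α μ (T / n : ℝ) z - 1) ^ 2 ∂(gaussianReal 0 (T / n))) +
      (K ^ 2) ^ 2 / η * ((n * ∫ z, eulerDefect α μ (T / n : ℝ) z ^ 2 ∂(gaussianReal 0 (T / n))) +
        (n * ∫ z, eulerDefect α μ (T / n : ℝ) z ∂(gaussianReal 0 (T / n))) ^ 2) := by
  have hn' : (0 : ℝ) < n := by positivity
  set ψ := ∫ z, (invFactor α μ (T / n : ℝ) z - 1) ^ 2 ∂(gaussianReal 0 (T / n)) with hψ
  have hY := stronglyAdapted_invGeom hb α μ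
  set y : ℕ → Ω → ℝ := fun i ω => clip K (invGeom Z α μ (grid T n i) ω) with hy
  have hym : ∀ i, StronglyMeasurable[𝓕 (grid T n i)] (y i) := fun i =>
    (continuous_clip K).comp_stronglyMeasurable (hY _)
  have hyK : ∀ i ω, |y i ω| ≤ K := fun i ω => abs_clip_le hK0 _
  -- the three contributions
  obtain ⟨hW1, hW1'⟩ := integral_indicator_sum_mul_eulerError_sq hb hn hK0 hσ hsde hmod hym
    (κ := fun _ => K) hyK (fun _ => le_rfl) hA hAσ
  set W1 := A.indicator fun ω => ∑ i ∈ Finset.range n,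
    y i ω * eulerError σ (drifted Z μ) α T n i ω with hW1def
  have hE : ∀ i ∈ Finset.range n,
      MemLp (A.indicator fun ω => eulerError σ (drifted Z μ) α T n i ω) 2 P ∧
      ∫ ω, (A.indicator (fun ω => eulerError σ (drifted Z μ) α T n i ω) ω) ^ 2 ∂P ≤
        2 * (1 + μ ^ 2 * T) * α ^ 2 * (T / n) * η ^ 2 := by
    intro i hi
    -- Kronecker weights isolate one Euler error; `∑ κ_k² = 1` then gives a bound of order `1/n` for
    -- each, so that the `n` errors sum to order `η²`.
    have := integral_indicator_sum_mul_eulerError_sq hb hn hK0 hσ hsde hmod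
      (c := fun k _ => if k = i then 1 else 0) (κ := fun k => if k = i then 1 else 0) (L := 1)
      (fun _ => stronglyMeasurable_const)
      (fun k ω => by split_ifs <;> simp)
      (fun k => by split_ifs <;> simp) hA hAσ
    simpa [Finset.mem_range.1 hi] using this
  set e : ℕ → Ω → ℝ := fun i => A.indicator fun ω => eulerError σ (drifted Z μ) α T n i ω with he
  set v : ℕ → Ω → ℝ := fun i ω => y i ω *
    (invFactor α μ (T / n : ℝ) (Z (grid T n (i + 1)) ω - Z (grid T n i) ω) - 1) with hv
  have hVm : ∀ i, MemLp (fun ω =>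
      invFactor α μ (T / n : ℝ) (Z (grid T n (i + 1)) ω - Z (grid T n i) ω) - 1) 2 P := fun i =>
    ((memLp_eulerDefect (hb.hasLaw_grid T n i) α μ _).1.sub (HasAllMoments.const 1)) 2 (by simp)
  have hvL : ∀ i, MemLp (v i) 2 P := fun i =>
    memLp_mul_of_bounded ((hym i).mono (𝓕.le _)).aestronglyMeasurable (hyK i) (hVm i)
  have hv2 : ∀ i, ∫ ω, v i ω ^ 2 ∂P ≤ K ^ 2 * ψ := fun i => by
    rw [hψ, ← integral_comp_of_hasLaw (hb.hasLaw_grid T n i)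
      (f := fun z => (invFactor α μ (T / n : ℝ) z - 1) ^ 2)
      (((continuous_invFactor α μ _).sub continuous_const).pow 2), ← integral_const_mul]
    refine integral_mono (hvL i).integrable_sq ((hVm i).integrable_sq.const_mul _) fun ω => ?_
    simp only [hv, mul_pow]
    exact mul_le_mul_of_nonneg_right (sq_le_sq.2 ((hyK i ω).trans (le_abs_self _))) (sq_nonneg _)
  obtain ⟨hW3, hW3'⟩ := integral_sum_mul_eulerDefect_sq hb α μ T (n := n)
    (ξ := fun i ω => clip K (σ (grid T n i) ω) * y i ω) (C := K ^ 2)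
    (fun i => ((continuous_clip K).comp_stronglyMeasurable (hσ _)).mul (hym i))
    (fun i ω => by
      rw [abs_mul, sq]
      exact mul_le_mul (abs_clip_le hK0 _) (hyK i ω) (abs_nonneg _) hK0)
  set W3 : Ω → ℝ := fun ω => ∑ i ∈ Finset.range n, clip K (σ (grid T n i) ω) * y i ω *
    eulerDefect α μ (T / n : ℝ) (Z (grid T n (i + 1)) ω - Z (grid T n i) ω) with hW3def
  have hpt : ∀ ω, A.indicator (fun ω =>
      |σ T ω * invGeom Z α μ T ω - σ 0 ω * invGeom Z α μ 0 ω|) ω ≤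
      (η / 2 + W1 ω ^ 2 / (2 * η)) +
      ∑ i ∈ Finset.range n, (η / 2 * v i ω ^ 2 + e i ω ^ 2 / (2 * η)) +
      (η / 2 + W3 ω ^ 2 / (2 * η)) := by
    intro ω
    by_cases hω : ω ∈ A
    · rw [Set.indicator_of_mem hω, mul_invGeom_sub_eq Z σ α μ T hn]
      have hyeq : ∀ i ∈ Finset.range n, invGeom Z α μ (grid T n i) ω = y i ω := fun i hi =>
        (clip_eq (hAY ω hω n i (Finset.mem_range.1 hi).le)).symm
      have hσeq : ∀ i ∈ Finset.range n, σ (grid T n i) ω = clip K (σ (grid T n i) ω) :=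
        fun i hi => (clip_eq (hAσ ω hω n i (Finset.mem_range.1 hi).le)).symm
      have e1 : ∑ i ∈ Finset.range n, invGeom Z α μ (grid T n i) ω *
          eulerError σ (drifted Z μ) α T n i ω = W1 ω := by
        rw [hW1def, Set.indicator_of_mem hω]
        exact Finset.sum_congr rfl fun i hi => by rw [hyeq i hi]
      have e2 : ∑ i ∈ Finset.range n, invGeom Z α μ (grid T n i) ω *
          (invFactor α μ (T / n : ℝ) (Z (grid T n (i + 1)) ω - Z (grid T n i) ω) - 1) *
          eulerError σ (drifted Z μ) α T n i ω = ∑ i ∈ Finset.range n, v i ω * e i ω :=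
        Finset.sum_congr rfl fun i hi => by
          rw [hyeq i hi]; simp only [hv, he, Set.indicator_of_mem hω]
      have e3 : ∑ i ∈ Finset.range n, σ (grid T n i) ω * invGeom Z α μ (grid T n i) ω *
          eulerDefect α μ (T / n : ℝ) (Z (grid T n (i + 1)) ω - Z (grid T n i) ω) = W3 ω :=
        Finset.sum_congr rfl fun i hi => by rw [hyeq i hi, ← hσeq i hi]
      rw [e1, e2, e3]
      refine (abs_add_three _ _ _).trans (add_le_add_three (abs_le_half_add_sq_div hη) ?_
        (abs_le_half_add_sq_div hη))
      refine (Finset.abs_sum_le_sum_abs _ _).trans (Finset.sum_le_sum fun i _ => ?_)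
      rw [abs_mul]
      exact abs_mul_le_sq_add_sq_div hη
    · rw [Set.indicator_of_notMem hω]
      have : 0 ≤ ∑ i ∈ Finset.range n, (η / 2 * v i ω ^ 2 + e i ω ^ 2 / (2 * η)) :=
        Finset.sum_nonneg fun i _ => by positivity
      positivity
  have hi1 : Integrable (fun ω => η / 2 + W1 ω ^ 2 / (2 * η)) P :=
    (integrable_const _).add (hW1.integrable_sq.div_const _)
  have hi3 : Integrable (fun ω => η / 2 + W3 ω ^ 2 / (2 * η)) P :=
    (integrable_const _).add (hW3.integrable_sq.div_const _)
  have hiv : ∀ i ∈ Finset.range n, Integrable (fun ω => η / 2 * v i ω ^ 2) P := fun i _ =>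
    (hvL i).integrable_sq.const_mul _
  have hie : ∀ i ∈ Finset.range n, Integrable (fun ω => e i ω ^ 2 / (2 * η)) P := fun i hi =>
    (hE i hi).1.integrable_sq.div_const _
  have hi2' : ∀ i ∈ Finset.range n,
      Integrable (fun ω => η / 2 * v i ω ^ 2 + e i ω ^ 2 / (2 * η)) P := fun i hi =>
    (hiv i hi).add (hie i hi)
  have hi2 : Integrable (fun ω => ∑ i ∈ Finset.range n,
      (η / 2 * v i ω ^ 2 + e i ω ^ 2 / (2 * η))) P := integrable_finsetSum _ hi2'
  have hi12 : Integrable (fun ω => (η / 2 + W1 ω ^ 2 / (2 * η)) +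
      ∑ i ∈ Finset.range n, (η / 2 * v i ω ^ 2 + e i ω ^ 2 / (2 * η))) P := hi1.add hi2
  have hmeas : AEStronglyMeasurable (A.indicator fun ω =>
      |σ T ω * invGeom Z α μ T ω - σ 0 ω * invGeom Z α μ 0 ω|) P := by
    have h1 : ∀ t, AEStronglyMeasurable (fun ω => σ t ω * invGeom Z α μ t ω) P := fun t =>
      (((hσ t).mul (hY t)).mono (𝓕.le t)).aestronglyMeasurable
    exact ((h1 T).sub (h1 0)).norm.indicator hA
  have hint : Integrable (A.indicator fun ω =>
      |σ T ω * invGeom Z α μ T ω - σ 0 ω * invGeom Z α μ 0 ω|) P := by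
    refine Integrable.mono' (hi12.add hi3) hmeas (Eventually.of_forall fun ω => ?_)
    rw [Real.norm_eq_abs, abs_of_nonneg (Set.indicator_nonneg (fun _ _ => abs_nonneg _) ω)]
    exact hpt ω
  refine ⟨hint, (integral_mono hint (hi12.add hi3) hpt).trans ?_⟩
  simp only [Pi.add_apply]
  rw [integral_add hi12 hi3, integral_add hi1 hi2,
    integral_add (integrable_const _) (hW1.integrable_sq.div_const _),
    integral_add (integrable_const _) (hW3.integrable_sq.div_const _),
    integral_finsetSum _ hi2', integral_div (2 * η) (fun ω => W1 ω ^ 2),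
    integral_div (2 * η) (fun ω => W3 ω ^ 2)]
  simp only [integral_const, probReal_univ, smul_eq_mul, one_mul]
  have hs : ∑ i ∈ Finset.range n, ∫ ω, (η / 2 * v i ω ^ 2 + e i ω ^ 2 / (2 * η)) ∂P ≤
      ∑ _i ∈ Finset.range n, (η / 2 * (K ^ 2 * ψ) +
        2 * (1 + μ ^ 2 * T) * α ^ 2 * (T / n) * η ^ 2 / (2 * η)) := by
    refine Finset.sum_le_sum fun i hi => ?_
    rw [integral_add (hiv i hi) (hie i hi), integral_const_mul, integral_div]
    gcongr
    · exact hv2 i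
    · exact (hE i hi).2
  rw [Finset.sum_const, Finset.card_range, nsmul_eq_mul] at hs
  have h1 : (∫ ω, W1 ω ^ 2 ∂P) / (2 * η) ≤ (1 + μ ^ 2 * T) * α ^ 2 * T * K ^ 2 * η := by
    rw [div_le_iff₀ (by positivity)]
    refine hW1'.trans_eq ?_
    rw [Finset.sum_const, Finset.card_range, nsmul_eq_mul]
    field_simp
  have h3 : (∫ ω, W3 ω ^ 2 ∂P) / (2 * η) ≤ (K ^ 2) ^ 2 / η *
      ((n * ∫ z, eulerDefect α μ (T / n : ℝ) z ^ 2 ∂(gaussianReal 0 (T / n))) +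
        (n * ∫ z, eulerDefect α μ (T / n : ℝ) z ∂(gaussianReal 0 (T / n))) ^ 2) := by
    rw [div_le_iff₀ (by positivity)]
    refine hW3'.trans_eq ?_
    field_simp
  have h2 : (n : ℝ) * (η / 2 * (K ^ 2 * ψ) +
      2 * (1 + μ ^ 2 * T) * α ^ 2 * (T / n) * η ^ 2 / (2 * η)) =
      η / 2 * K ^ 2 * (n * ψ) + (1 + μ ^ 2 * T) * α ^ 2 * T * η := by
    field_simp
  rw [h2] at hs
  linarith

/-- The volatility equation has only the geometric Brownian motion as a solution. -/
theorem volatility_eq [IsProbabilityMeasure P] (hb : IsIndepBMPair P 𝓕 Z X) {μ α : ℝ}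
    {σ : ℝ≥0 → Ω → ℝ}
    (hσ : StronglyAdapted 𝓕 σ) (hσc : ∀ᵐ ω ∂P, Continuous fun t => σ t ω)
    (hsde : IsItoIntegral P σ (fun t ω => α * drifted Z μ t ω) (fun t ω => σ t ω - σ 0 ω))
    (T : ℝ≥0) :
    ∀ᵐ ω ∂P, σ T ω = σ 0 ω * Real.exp (α * Z T ω + (α * μ - α ^ 2 / 2) * T) := by
  set D : Ω → ℝ := fun ω => |σ T ω * invGeom Z α μ T ω - σ 0 ω * invGeom Z α μ 0 ω| with hD
  have hY := stronglyAdapted_invGeom hb α μ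
  -- Boundedness is required only on the countable union of all uniform grids, so that `A K` is
  -- measurable.
  set A : ℕ → Set Ω := fun K => {ω | ∀ n i : ℕ, i ≤ n →
    |σ (grid T n i) ω| ≤ K ∧ |invGeom Z α μ (grid T n i) ω| ≤ K} with hAdef
  have hA : ∀ K, MeasurableSet (A K) := fun K => by
    have hset : A K = ⋂ n : ℕ, ⋂ i : ℕ, ⋂ _ : i ≤ n, {ω | |σ (grid T n i) ω| ≤ K} ∩
        {ω | |invGeom Z α μ (grid T n i) ω| ≤ K} := by
      ext ω; simp [hAdef]
    rw [hset]
    refine MeasurableSet.iInter fun n => MeasurableSet.iInter fun i => MeasurableSet.iInter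
      fun _ => MeasurableSet.inter ?_ ?_
    · exact measurableSet_le ((hσ _).mono (𝓕.le _)).measurable.abs measurable_const
    · exact measurableSet_le ((hY _).mono (𝓕.le _)).measurable.abs measurable_const
  have hzero : ∀ K : ℕ, ∀ᵐ ω ∂P, ω ∈ A K → D ω = 0 := by
    intro K
    have hmodK := fun η (hη : 0 < η) => exists_meanSquare_modulus (P := P)
      (h := fun t ω => clip (K : ℝ) (σ t ω)) (K := K)
      (fun t => ((continuous_clip K).comp_stronglyMeasurable
        ((hσ t).mono (𝓕.le t))).aestronglyMeasurable)
      (fun t ω => abs_clip_le (Nat.cast_nonneg K) _)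
      (hσc.mono fun ω h => (continuous_clip K).comp h) T (ε := η ^ 2) (by positivity)
    have hbound := fun η (hη : 0 < η) n (hn : n ≠ 0) hm =>
      integral_indicator_abs_mul_invGeom_sub_le hb (μ := μ) (α := α) (T := T) hn
      (Nat.cast_nonneg K) hη hσ hsde hm (hA K) (fun ω hω n i hi => (hω n i hi).1)
      (fun ω hω n i hi => (hω n i hi).2)
    -- The coefficient of `η` left after `n → ∞`, with `α² T` the limit of the summed squared
    -- increments. It does not depend on `η`, so `η → 0` gives zero.
    set C : ℝ := 1 + (1 + μ ^ 2 * T) * α ^ 2 * T * ((K : ℝ) ^ 2 + 1) +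
      1 / 2 * (K : ℝ) ^ 2 * (α ^ 2 * T) with hCdef
    have hle : ∀ η : ℝ, 0 < η → Integrable ((A K).indicator D) P ∧
        ∫ ω, (A K).indicator D ω ∂P ≤ C * η := by
      intro η hη
      have hev := ((hmodK η hη).and (eventually_ne_atTop 0)).mono fun n hn =>
        hbound η hη n hn.2 hn.1
      refine ⟨hev.exists.choose_spec.1, ?_⟩
      have hlim := (((tendsto_nat_mul_integral_invFactor α μ T).const_mul
        (η / 2 * (K : ℝ) ^ 2)).const_add
        (η + (1 + μ ^ 2 * T) * α ^ 2 * T * ((K : ℝ) ^ 2 + 1) * η)).add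
        (((tendsto_nat_mul_integral_eulerDefect_sq α μ T).add
        ((tendsto_nat_mul_integral_eulerDefect α μ T).pow 2)).const_mul (((K : ℝ) ^ 2) ^ 2 / η))
      refine (ge_of_tendsto hlim (hev.mono fun n hn => hn.2)).trans_eq ?_
      rw [hCdef]; ring
    have hint := (hle 1 one_pos).1
    have hI : ∫ ω, (A K).indicator D ω ∂P ≤ 0 := by
      have hlim : Tendsto (fun η : ℝ => C * η) (𝓝[>] 0) (𝓝 0) := by
        have : Tendsto (fun η : ℝ => C * η) (𝓝 0) (𝓝 (C * 0)) := tendsto_id.const_mul C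
        rw [mul_zero] at this
        exact this.mono_left nhdsWithin_le_nhds
      exact ge_of_tendsto hlim (eventually_mem_nhdsWithin.mono fun η hη => (hle η hη).2)
    have hnn : 0 ≤ (A K).indicator D := fun ω =>
      Set.indicator_nonneg (fun _ _ => abs_nonneg _) ω
    have h0 := (integral_eq_zero_iff_of_nonneg hnn hint).1 (le_antisymm hI (integral_nonneg hnn))
    filter_upwards [h0] with ω hω hωA
    simpa [Set.indicator_of_mem hωA] using hω
  -- Continuous paths of `σ` and `Y` are bounded on the compact interval `[0, T]`.
  have hcover : ∀ᵐ ω ∂P, ∃ K : ℕ, ω ∈ A K := by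
    filter_upwards [hσc, hb.brownian_Z.cont] with ω h1 h2
    have h3 : Continuous fun t => invGeom Z α μ t ω := by unfold invGeom; fun_prop
    obtain ⟨C1, hC1⟩ := (isCompact_Icc (a := (0 : ℝ≥0)) (b := T)).exists_bound_of_continuousOn
      h1.continuousOn
    obtain ⟨C2, hC2⟩ := (isCompact_Icc (a := (0 : ℝ≥0)) (b := T)).exists_bound_of_continuousOn
      h3.continuousOn
    obtain ⟨K, hK⟩ := exists_nat_ge (max C1 C2)
    refine ⟨K, fun n i hi => ⟨?_, ?_⟩⟩
    · exact (hC1 _ ⟨zero_le, grid_le T hi⟩).trans ((le_max_left _ _).trans hK)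
    · exact (hC2 _ ⟨zero_le, grid_le T hi⟩).trans ((le_max_right _ _).trans hK)
  filter_upwards [hcover, ae_all_iff.2 hzero, hb.brownian_Z.eval_zero_ae_eq_zero]
    with ω ⟨K, hK⟩ h0 hZ
  have h1 := h0 K hK
  simp only [hD, abs_eq_zero, invGeom, hZ, mul_zero, NNReal.coe_zero, add_zero,
    Real.exp_zero, Real.exp_neg, inv_one, mul_one] at h1
  have hpos := Real.exp_pos (α * Z T ω + (α * μ - α ^ 2 / 2) * T)
  rw [← div_eq_mul_inv, sub_eq_zero, div_eq_iff hpos.ne'] at h1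
  exact h1

end

/-! ### Geometric Brownian motion and the Gaussian mixture -/

/-- Geometric Brownian motion with volatility `α` driven by `Z^{[λ α / 2]}`, started at `1`. -/
def geom (Z : ℝ≥0 → Ω → ℝ) (α lam : ℝ) (t : ℝ≥0) (ω : Ω) : ℝ :=
  Real.exp (α * Z t ω + (lam - 1) / 2 * α ^ 2 * t)

/-- Riemann sums of the integral of `α` times geometric Brownian motion against `X`. -/
def mixSum (Z X : ℝ≥0 → Ω → ℝ) (α lam : ℝ) (T : ℝ≥0) (n : ℕ) (ω : Ω) : ℝ :=
  ∑ i ∈ Finset.range n, α * geom Z α lam (grid T n i) ω *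
    (X (grid T n (i + 1)) ω - X (grid T n i) ω)

/-- The conditional variance of `mixSum` given `Z`. -/
def mixVar (Z : ℝ≥0 → Ω → ℝ) (α lam : ℝ) (T : ℝ≥0) (n : ℕ) (ω : Ω) : ℝ :=
  ∑ i ∈ Finset.range n, (α * geom Z α lam (grid T n i) ω) ^ 2 * (T / n)

/-- Geometric Brownian motion at time `T`, centered. -/
def centeredGeom (Z : ℝ≥0 → Ω → ℝ) (α lam : ℝ) (T : ℝ≥0) (ω : Ω) : ℝ :=
  geom Z α lam T ω - Real.exp (lam * (α ^ 2 * T) / 2)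

lemma mixVar_eq (Z : ℝ≥0 → Ω → ℝ) (α lam : ℝ) (T : ℝ≥0) (n : ℕ) (ω : Ω) :
    mixVar Z α lam T n ω = α ^ 2 * T / n *
      ∑ i ∈ Finset.range n, geom Z α lam (grid T n i) ω ^ 2 := by
  rw [mixVar, Finset.mul_sum]
  exact Finset.sum_congr rfl fun i _ => by ring

section

variable {P : Measure Ω} {𝓕 : Filtration ℝ≥0 mΩ} {Z X : ℝ≥0 → Ω → ℝ}

namespace IsIndepBMPair

lemma measurable_Z (h : IsIndepBMPair P 𝓕 Z X) (t : ℝ≥0) : Measurable (Z t) :=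
  ((h.adapted_Z t).mono (𝓕.le t)).measurable

lemma measurable_X (h : IsIndepBMPair P 𝓕 Z X) (t : ℝ≥0) : Measurable (X t) :=
  ((h.adapted_X t).mono (𝓕.le t)).measurable

lemma hasLaw_sub_X (h : IsIndepBMPair P 𝓕 Z X) {s t : ℝ≥0} (hst : s ≤ t) :
    HasLaw (fun ω => X t ω - X s ω) (gaussianReal 0 (t - s)) P := by
  have := h.brownian_X.hasLaw_sub t s
  have e : nndist t.1 s.1 = t - s := by
    ext
    rw [coe_nndist, Real.dist_eq, NNReal.coe_sub hst]
    exact abs_of_nonneg (sub_nonneg.2 hst)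
  rwa [e] at this

lemma indep_sub_X (h : IsIndepBMPair P 𝓕 Z X) {s t : ℝ≥0} (hst : s ≤ t) :
    Indep (MeasurableSpace.comap (fun ω => X t ω - X s ω) inferInstance) (𝓕 s) P := by
  refine indep_of_indep_of_le_left (h.indep_increments s t hst) ?_
  have : (fun ω => X t ω - X s ω) = Prod.snd ∘ fun ω => (Z t ω - Z s ω, X t ω - X s ω) := rfl
  rw [this, ← MeasurableSpace.comap_comp]
  exact MeasurableSpace.comap_mono measurable_snd.comap_le

lemma hasLaw_grid_X (h : IsIndepBMPair P 𝓕 Z X) (T : ℝ≥0) (n i : ℕ) :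
    HasLaw (fun ω => X (grid T n (i + 1)) ω - X (grid T n i) ω) (gaussianReal 0 (T / n)) P := by
  rw [← grid_step T n i]
  exact h.hasLaw_sub_X (grid_mono T n i.le_succ)

lemma stronglyMeasurable_sum_X (h : IsIndepBMPair P 𝓕 Z X) (T : ℝ≥0) (n : ℕ) (c : ℕ → ℝ)
    (N : ℕ) : StronglyMeasurable[𝓕 (grid T n N)] (fun ω => ∑ i ∈ Finset.range N,
      c i * (X (grid T n (i + 1)) ω - X (grid T n i) ω)) := by
  refine Finset.stronglyMeasurable_fun_sum _ fun i hi => ?_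
  have hi' : i < N := Finset.mem_range.1 hi
  exact (((h.adapted_X _).mono (𝓕.mono (grid_mono T n hi'))).sub
    ((h.adapted_X _).mono (𝓕.mono (grid_mono T n hi'.le)))).const_mul (c i)

/-- The law of a deterministic linear combination of increments of `X`. -/
lemma hasLaw_sum_X [IsProbabilityMeasure P] (h : IsIndepBMPair P 𝓕 Z X) (T : ℝ≥0) (n : ℕ)
    (c : ℕ → ℝ) (N : ℕ) :
    HasLaw (fun ω => ∑ i ∈ Finset.range N, c i * (X (grid T n (i + 1)) ω - X (grid T n i) ω))
      (gaussianReal 0 (∑ i ∈ Finset.range N, .mk (c i ^ 2) (sq_nonneg _) * (T / n))) P := by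
  induction N with
  | zero =>
    simp only [Finset.range_zero, Finset.sum_empty, gaussianReal_zero_var]
    exact ⟨by fun_prop, by rw [Measure.map_const]; simp⟩
  | succ N ih =>
    simp only [Finset.sum_range_succ]
    have h1 : HasLaw (fun ω => c N * (X (grid T n (N + 1)) ω - X (grid T n N) ω))
        (gaussianReal 0 (.mk (c N ^ 2) (sq_nonneg _) * (T / n))) P := by
      simpa using gaussianReal_const_mul (h.hasLaw_grid_X T n N) (c N)
    have hind : IndepFun (fun ω => ∑ i ∈ Finset.range N,
        c i * (X (grid T n (i + 1)) ω - X (grid T n i) ω))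
        (fun ω => c N * (X (grid T n (N + 1)) ω - X (grid T n N) ω)) P :=
      (indepFun_of_indep_comap (h.stronglyMeasurable_sum_X T n c N)
        (h.indep_sub_X (grid_mono T n N.le_succ))).comp measurable_id (measurable_const_mul (c N))
    refine ⟨ih.aemeasurable.add h1.aemeasurable, ?_⟩
    have := gaussianReal_add_gaussianReal_of_indepFun hind ih.map_eq h1.map_eq
    rwa [add_zero] at this

end IsIndepBMPair

/-- Fubini for a pair of independent random elements. -/
lemma integral_comp_prod_of_indepFun [IsProbabilityMeasure P] {E F : Type*} [MeasurableSpace E]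
    [MeasurableSpace F] {V : Ω → E} {W : Ω → F} (hVW : IndepFun V W P) (hV : Measurable V)
    (hW : Measurable W) {f : E × F → ℝ} (hf : Measurable f)
    (hi : Integrable (fun ω => f (V ω, W ω)) P) :
    ∫ ω, f (V ω, W ω) ∂P = ∫ ω, ∫ ω', f (V ω, W ω') ∂P ∂P := by
  have hmap := hVW.map_prod_eq_prod_map_map hV.aemeasurable hW.aemeasurable
  have hVW' : AEMeasurable (fun ω => (V ω, W ω)) P := (hV.prodMk hW).aemeasurable
  have := Measure.isProbabilityMeasure_map (μ := P) hV.aemeasurable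
  have := Measure.isProbabilityMeasure_map (μ := P) hW.aemeasurable
  have hi' : Integrable f ((P.map V).prod (P.map W)) := by
    rw [← hmap]
    exact (integrable_map_measure hf.aestronglyMeasurable hVW').2 hi
  rw [← integral_map hVW' hf.aestronglyMeasurable (f := f), hmap, integral_prod f hi',
    integral_map hV.aemeasurable]
  · refine integral_congr_ae (Eventually.of_forall fun ω => ?_)
    dsimp only
    rw [integral_map hW.aemeasurable (f := fun y => f (V ω, y))]
    exact (hf.comp measurable_prodMk_left).aestronglyMeasurable
  · exact hf.stronglyMeasurable.integral_prod_right'.aestronglyMeasurable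

lemma measurable_geom (h : IsIndepBMPair P 𝓕 Z X) (α lam : ℝ) (t : ℝ≥0) :
    Measurable (geom Z α lam t) := by
  have := h.measurable_Z t
  unfold geom; fun_prop

lemma hasAllMoments_geom (h : IsIndepBMPair P 𝓕 Z X) (α lam : ℝ) (t : ℝ≥0) :
    HasAllMoments (geom Z α lam t) P := by
  have e : geom Z α lam t = fun ω =>
      Real.exp ((lam - 1) / 2 * α ^ 2 * t) * Real.exp (α * Z t ω) := by
    ext ω; rw [geom, ← Real.exp_add]; ring_nf
  rw [e]
  exact (HasAllMoments.exp_of_hasLaw (h.brownian_Z.hasLaw_eval t) α).const_mul _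

lemma hasAllMoments_centeredGeom [IsProbabilityMeasure P] (h : IsIndepBMPair P 𝓕 Z X) (α lam : ℝ)
    (T : ℝ≥0) :
    HasAllMoments (centeredGeom Z α lam T) P :=
  (hasAllMoments_geom h α lam T).sub (HasAllMoments.const _)

lemma hasAllMoments_mixSum (h : IsIndepBMPair P 𝓕 Z X) (α lam : ℝ) (T : ℝ≥0) (n : ℕ) :
    HasAllMoments (mixSum Z X α lam T n) P :=
  HasAllMoments.sum _ fun i _ => ((hasAllMoments_geom h α lam _).const_mul α).mul
    (HasAllMoments.of_hasLaw (h.hasLaw_grid_X T n i))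

lemma hasAllMoments_mixVar [IsProbabilityMeasure P] (h : IsIndepBMPair P 𝓕 Z X) (α lam : ℝ)
    (T : ℝ≥0) (n : ℕ) :
    HasAllMoments (mixVar Z α lam T n) P :=
  HasAllMoments.sum _ fun _ _ =>
    (((hasAllMoments_geom h α lam _).const_mul α).pow 2).mul (HasAllMoments.const _)

/-- Conditionally on `Z`, `mixSum` is centered Gaussian with variance `mixVar`. -/
lemma integral_mul_mixSum_pow [IsProbabilityMeasure P] (h : IsIndepBMPair P 𝓕 Z X) (α lam : ℝ)
    (T : ℝ≥0) (n : ℕ)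
    (j k : ℕ) {M : ℝ → ℝ} (hM : ∀ v : ℝ≥0, ∫ x, x ^ k ∂(gaussianReal 0 v) = M v) :
    ∫ ω, centeredGeom Z α lam T ω ^ j * mixSum Z X α lam T n ω ^ k ∂P =
      ∫ ω, centeredGeom Z α lam T ω ^ j * M (mixVar Z α lam T n ω) ∂P := by
  -- `V` collects what depends on `Z` and `W` what depends on `X`. By Fubini `Z` can be frozen, and
  -- the inner integral is a moment of a Gaussian linear combination of increments of `X`.
  set V : Ω → ℝ × (ℕ → ℝ) := fun ω =>
    (centeredGeom Z α lam T ω ^ j, fun i => α * geom Z α lam (grid T n i) ω) with hV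
  set W : Ω → ℕ → ℝ := fun ω i => X (grid T n (i + 1)) ω - X (grid T n i) ω with hW
  set f : (ℝ × (ℕ → ℝ)) × (ℕ → ℝ) → ℝ := fun p =>
    p.1.1 * (∑ i ∈ Finset.range n, p.1.2 i * p.2 i) ^ k with hf
  have hgm := fun t => measurable_geom h α lam t
  have hVm : Measurable V := by
    refine Measurable.prodMk (((hgm T).sub_const _).pow_const j) ?_
    exact measurable_pi_lambda _ fun i => (hgm _).const_mul α
  have hWm : Measurable W :=
    measurable_pi_lambda _ fun i => (h.measurable_X _).sub (h.measurable_X _)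
  have hfm : Measurable f := by
    refine (measurable_fst.comp measurable_fst).mul (Measurable.pow_const ?_ k)
    exact Finset.measurable_fun_sum _ fun i _ => ((measurable_pi_apply i).comp
      (measurable_snd.comp measurable_fst)).mul ((measurable_pi_apply i).comp measurable_snd)
  have hind : IndepFun V W P := by
    have hφ : Measurable (fun z : ℝ≥0 → ℝ =>
        (((Real.exp (α * z T + (lam - 1) / 2 * α ^ 2 * T) -
          Real.exp (lam * (α ^ 2 * T) / 2)) ^ j,
        fun i : ℕ => α * Real.exp (α * z (grid T n i) + (lam - 1) / 2 * α ^ 2 * grid T n i)) :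
          ℝ × (ℕ → ℝ))) := by fun_prop
    have hψ : Measurable (fun (x : ℝ≥0 → ℝ) (i : ℕ) => x (grid T n (i + 1)) - x (grid T n i)) := by
      fun_prop
    exact h.indep.comp hφ hψ
  have hi : Integrable (fun ω => f (V ω, W ω)) P :=
    (((hasAllMoments_centeredGeom h α lam T).pow j).mul
      ((hasAllMoments_mixSum h α lam T n).pow k)).integrable
  have hmain := integral_comp_prod_of_indepFun hind hVm hWm hfm hi
  refine hmain.trans (integral_congr_ae (Eventually.of_forall fun ω => ?_))
  simp only [hf, hV, hW]
  rw [integral_const_mul]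
  congr 1
  rw [integral_comp_of_hasLaw (h.hasLaw_sum_X T n (fun i => α * geom Z α lam (grid T n i) ω) n)
    (f := fun x => x ^ k) (by fun_prop), hM, mixVar]
  congr 1
  push_cast
  rfl

/-- Joint moments of geometric Brownian motion. -/
lemma integral_geom_pow_mul_geom_pow (h : IsIndepBMPair P 𝓕 Z X) (α lam : ℝ) {s t : ℝ≥0}
    (hst : s ≤ t) (a b : ℕ) :
    ∫ ω, geom Z α lam s ω ^ a * geom Z α lam t ω ^ b ∂P =
      Real.exp (α ^ 2 * (((a + b) ^ 2 * s + b ^ 2 * (t - s)) / 2 +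
        (lam - 1) / 2 * (a * s + b * t))) := by
  -- Splitting `Z_t = Z_s + (Z_t - Z_s)` makes the two exponentials independent.
  have e : ∀ ω, geom Z α lam s ω ^ a * geom Z α lam t ω ^ b =
      Real.exp ((lam - 1) / 2 * α ^ 2 * (a * s + b * t)) *
        (Real.exp ((a + b) * α * Z s ω) * Real.exp (b * α * (Z t ω - Z s ω))) := fun ω => by
    rw [geom, geom, ← Real.exp_nat_mul, ← Real.exp_nat_mul, ← Real.exp_add, ← Real.exp_add,
      ← Real.exp_add]
    ring_nf
  have hind : IndepFun (fun ω => Real.exp ((a + b) * α * Z s ω))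
      (fun ω => Real.exp (b * α * (Z t ω - Z s ω))) P :=
    (indepFun_of_indep_comap (h.adapted_Z s) (h.indep_sub_Z hst)).comp
      (φ := fun x => Real.exp ((a + b) * α * x)) (ψ := fun x => Real.exp (b * α * x))
      (by fun_prop) (by fun_prop)
  have hm1 := h.measurable_Z s
  have hm2 := h.measurable_Z t
  simp only [e]
  rw [integral_const_mul, hind.integral_fun_mul_eq_mul_integral
    (Measurable.aestronglyMeasurable (by fun_prop)) (Measurable.aestronglyMeasurable (by fun_prop)),
    integral_comp_of_hasLaw (h.brownian_Z.hasLaw_eval s)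
      (f := fun x => Real.exp ((a + b) * α * x)) (by fun_prop),
    integral_comp_of_hasLaw (h.hasLaw_sub_Z hst)
      (f := fun x => Real.exp (b * α * x)) (by fun_prop),
    integral_exp_gaussianReal, integral_exp_gaussianReal, NNReal.coe_sub hst, ← Real.exp_add,
    ← Real.exp_add]
  ring_nf

lemma integral_geom_pow (h : IsIndepBMPair P 𝓕 Z X) (α lam : ℝ) (t : ℝ≥0) (b : ℕ) :
    ∫ ω, geom Z α lam t ω ^ b ∂P =
      Real.exp (α ^ 2 * (b ^ 2 * t / 2 + (lam - 1) / 2 * (b * t))) := by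
  have := integral_geom_pow_mul_geom_pow h α lam (le_refl t) 0 b
  simpa using this

end

/-! ### Moments of the discretized terminal value -/

/-- Discretization of the canonical terminal value. -/
def mixture (Z X : ℝ≥0 → Ω → ℝ) (α lam ρ : ℝ) (T : ℝ≥0) (n : ℕ) (ω : Ω) : ℝ :=
  ρ * centeredGeom Z α lam T ω + √(1 - ρ ^ 2) * mixSum Z X α lam T n ω

section

variable {P : Measure Ω} [IsProbabilityMeasure P] {𝓕 : Filtration ℝ≥0 mΩ} {Z X : ℝ≥0 → Ω → ℝ}

lemma hasAllMoments_mixture (h : IsIndepBMPair P 𝓕 Z X) (α lam ρ : ℝ) (T : ℝ≥0) (n : ℕ) :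
    HasAllMoments (mixture Z X α lam ρ T n) P :=
  ((hasAllMoments_centeredGeom h α lam T).const_mul ρ).add
    ((hasAllMoments_mixSum h α lam T n).const_mul _)

lemma integral_mixture_pow (h : IsIndepBMPair P 𝓕 Z X) (α lam ρ : ℝ) (T : ℝ≥0) (n k : ℕ) :
    ∫ ω, mixture Z X α lam ρ T n ω ^ k ∂P =
      ∑ j ∈ Finset.range (k + 1), ρ ^ j * √(1 - ρ ^ 2) ^ (k - j) * (k.choose j : ℝ) *
        ∫ ω, centeredGeom Z α lam T ω ^ j * mixSum Z X α lam T n ω ^ (k - j) ∂P := by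
  have e : ∀ ω, mixture Z X α lam ρ T n ω ^ k =
      ∑ j ∈ Finset.range (k + 1), ρ ^ j * √(1 - ρ ^ 2) ^ (k - j) * (k.choose j : ℝ) *
        (centeredGeom Z α lam T ω ^ j * mixSum Z X α lam T n ω ^ (k - j)) := fun ω => by
    rw [mixture, add_pow]
    refine Finset.sum_congr rfl fun j _ => ?_
    rw [mul_pow, mul_pow]; ring
  simp only [e]
  rw [integral_finsetSum]
  · simp only [integral_const_mul]
  · intro j _
    exact ((((hasAllMoments_centeredGeom h α lam T).pow j).mul
      ((hasAllMoments_mixSum h α lam T n).pow (k - j))).const_mul _).integrable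

/-- Everything follows from `E G_T^b = m^b w^{b(b-1)/2}` and the binomial theorem. The cubic and
sextic polynomials in `w` are the expanded forms of the factors with `(w - 1)²` in `mu3` and `mu4`.
-/
lemma integral_centeredGeom_pow (h : IsIndepBMPair P 𝓕 Z X) (α lam : ℝ) (T : ℝ≥0) {m w : ℝ}
    (hm : m = Real.exp (lam * (α ^ 2 * T) / 2)) (hw : w = Real.exp (α ^ 2 * T)) :
    ∫ ω, centeredGeom Z α lam T ω ∂P = 0 ∧
    ∫ ω, centeredGeom Z α lam T ω ^ 2 ∂P = m ^ 2 * (w - 1) ∧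
    ∫ ω, centeredGeom Z α lam T ω ^ 3 ∂P = m ^ 3 * (w ^ 3 - 3 * w + 2) ∧
    ∫ ω, centeredGeom Z α lam T ω ^ 4 ∂P = m ^ 4 * (w ^ 6 - 4 * w ^ 3 + 6 * w - 3) := by
  have hg := hasAllMoments_geom h α lam T
  have hi : ∀ b : ℕ, Integrable (fun ω => geom Z α lam T ω ^ b) P := fun b => (hg.pow b).integrable
  have h1 : ∫ ω, geom Z α lam T ω ∂P = m := by
    have := integral_geom_pow h α lam T 1
    simp only [pow_one] at this
    rw [this, hm]; congr 1; push_cast; ring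
  have h2 : ∫ ω, geom Z α lam T ω ^ 2 ∂P = m ^ 2 * w := by
    rw [integral_geom_pow h α lam T 2, hm, hw, ← Real.exp_nat_mul, ← Real.exp_add]
    congr 1; push_cast; ring
  have h3 : ∫ ω, geom Z α lam T ω ^ 3 ∂P = m ^ 3 * w ^ 3 := by
    rw [integral_geom_pow h α lam T 3, hm, hw, ← Real.exp_nat_mul, ← Real.exp_nat_mul,
      ← Real.exp_add]
    congr 1; push_cast; ring
  have h4 : ∫ ω, geom Z α lam T ω ^ 4 ∂P = m ^ 4 * w ^ 6 := by
    rw [integral_geom_pow h α lam T 4, hm, hw, ← Real.exp_nat_mul, ← Real.exp_nat_mul,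
      ← Real.exp_add]
    congr 1; push_cast; ring
  have hc : ∀ ω, centeredGeom Z α lam T ω = geom Z α lam T ω - m := fun ω => by
    rw [centeredGeom, hm]
  simp only [hc]
  have key : ∀ k : ℕ, ∫ ω, (geom Z α lam T ω - m) ^ k ∂P =
      ∑ j ∈ Finset.range (k + 1), (-m) ^ (k - j) * (k.choose j : ℝ) *
        ∫ ω, geom Z α lam T ω ^ j ∂P := by
    intro k
    have e : ∀ ω, (geom Z α lam T ω - m) ^ k = ∑ j ∈ Finset.range (k + 1),
        (-m) ^ (k - j) * (k.choose j : ℝ) * geom Z α lam T ω ^ j := fun ω => by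
      rw [sub_eq_add_neg, add_pow]
      exact Finset.sum_congr rfl fun j _ => by ring
    simp only [e]
    rw [integral_finsetSum _ fun j _ => (hi j).const_mul _]
    simp only [integral_const_mul]
  have k1 := key 1
  simp only [pow_one] at k1
  refine ⟨?_, ?_, ?_, ?_⟩
  · rw [k1]; simp [Finset.sum_range_succ, h1]
  · rw [key]; simp [Finset.sum_range_succ, Nat.choose, h1, h2]; ring
  · rw [key]; simp [Finset.sum_range_succ, Nat.choose, h1, h2, h3]; ring
  · rw [key]; simp [Finset.sum_range_succ, Nat.choose, h1, h2, h3, h4]; ring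

/-- For `s ≤ T`, measured in units of `α²`, `E (G_s² G_T^j)` depends on `s` through `e^{(1+2j+λ)s}`
alone. This is the origin of the indices `1 + λ`, `3 + λ`, `5 + λ`. -/
lemma tendsto_integral_geom_pow_mul_mixVar (h : IsIndepBMPair P 𝓕 Z X) (α lam : ℝ) (T : ℝ≥0)
    (j : ℕ) :
    Tendsto (fun n => ∫ ω, geom Z α lam T ω ^ j * mixVar Z α lam T n ω ∂P) atTop
      (𝓝 (Real.exp ((j ^ 2 - j) / 2 * (α ^ 2 * T) + j * (lam * (α ^ 2 * T) / 2)) *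
        powQuot (Real.exp (α ^ 2 * T)) (1 + 2 * j + lam))) := by
  refine ((tendsto_sum_exp_powQuot (S := α ^ 2 * T) (by positivity)
    (1 + 2 * j + lam)).const_mul _).congr' ?_
  filter_upwards [eventually_ne_atTop 0] with n hn
  have hi : ∀ i ∈ Finset.range n, Integrable
      (fun ω => geom Z α lam (grid T n i) ω ^ 2 * geom Z α lam T ω ^ j) P := fun i _ =>
    (((hasAllMoments_geom h α lam _).pow 2).mul ((hasAllMoments_geom h α lam T).pow j)).integrable
  have e : ∀ ω, geom Z α lam T ω ^ j * mixVar Z α lam T n ω = α ^ 2 * T / n *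
      ∑ i ∈ Finset.range n, geom Z α lam (grid T n i) ω ^ 2 * geom Z α lam T ω ^ j := fun ω => by
    rw [mixVar_eq, ← Finset.sum_mul]; ring
  simp only [e]
  rw [integral_const_mul, integral_finsetSum _ hi, mul_left_comm, Finset.mul_sum]
  congr 1
  refine Finset.sum_congr rfl fun i hi => ?_
  rw [integral_geom_pow_mul_geom_pow h α lam (grid_le T (Finset.mem_range.1 hi).le), coe_grid,
    ← Real.exp_add]
  congr 1; push_cast; ring

lemma tendsto_integral_mixVar_sq (h : IsIndepBMPair P 𝓕 Z X) (α lam : ℝ) (T : ℝ≥0) {w : ℝ}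
    (hw : w = Real.exp (α ^ 2 * T)) :
    Tendsto (fun n => ∫ ω, mixVar Z α lam T n ω ^ 2 ∂P) atTop
      (𝓝 (1 / 2 * (-(w ^ (1 + lam) * powQuot w (5 + lam)) +
        (w ^ (3 + lam) + 1) * powQuot w (3 + lam) - powQuot w (1 + lam)))) := by
  rw [hw]
  refine (tendsto_double_sum_exp (S := α ^ 2 * T) (by positivity) lam
    (f := fun n i k => ∫ ω, geom Z α lam (grid T n i) ω ^ 2 * geom Z α lam (grid T n k) ω ^ 2 ∂P)
    (fun n i k => by simp only [mul_comm]) (fun n i k hik => ?_)).congr fun n => ?_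
  · rw [integral_geom_pow_mul_geom_pow h α lam (grid_mono T n hik), coe_grid, coe_grid]
    congr 1; push_cast; ring
  · have hi : ∀ i k : ℕ, Integrable (fun ω =>
        geom Z α lam (grid T n i) ω ^ 2 * geom Z α lam (grid T n k) ω ^ 2) P := fun i k =>
      (((hasAllMoments_geom h α lam _).pow 2).mul ((hasAllMoments_geom h α lam _).pow 2)).integrable
    have e : ∀ ω, mixVar Z α lam T n ω ^ 2 = (α ^ 2 * T / n) ^ 2 *
        ∑ i ∈ Finset.range n, ∑ k ∈ Finset.range n,
          geom Z α lam (grid T n i) ω ^ 2 * geom Z α lam (grid T n k) ω ^ 2 := fun ω => by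
      rw [mixVar_eq, mul_pow, sq (∑ i ∈ Finset.range n, _), Finset.sum_mul_sum]
    simp only [e]
    rw [integral_const_mul,
        integral_finsetSum _ fun i _ => integrable_finsetSum _ fun k _ => hi i k]
    congr 1
    exact Finset.sum_congr rfl fun i _ => (integral_finsetSum _ fun k _ => hi i k).symm

/-- The power mean inequality reduces the bound to `E G_t^8`, uniformly for `t ≤ T`. In the
exponent, `32 = 8²/2` and `4 = 8/2`. -/
lemma integral_mixVar_pow_four_le (h : IsIndepBMPair P 𝓕 Z X) (α lam : ℝ) (T : ℝ≥0) (n : ℕ) :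
    ∫ ω, mixVar Z α lam T n ω ^ 4 ∂P ≤
      (α ^ 2 * T) ^ 4 * Real.exp (α ^ 2 * ((32 + 4 * |lam - 1|) * T)) := by
  rcases eq_or_ne n 0 with rfl | hn
  · simp only [mixVar, Finset.range_zero, Finset.sum_empty]
    simp only [ne_eq, OfNat.ofNat_ne_zero, not_false_eq_true, zero_pow, integral_zero]
    positivity
  have hn' : (0 : ℝ) < n := by positivity
  have hi : ∀ i ∈ Finset.range n, Integrable (fun ω => geom Z α lam (grid T n i) ω ^ 8) P :=
    fun i _ => ((hasAllMoments_geom h α lam _).pow 8).integrable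
  calc ∫ ω, mixVar Z α lam T n ω ^ 4 ∂P
      ≤ ∫ ω, (α ^ 2 * T / n) ^ 4 * (n ^ 3 *
          ∑ i ∈ Finset.range n, geom Z α lam (grid T n i) ω ^ 8) ∂P := by
        refine integral_mono ((hasAllMoments_mixVar h α lam T n).pow 4).integrable
          (((integrable_finsetSum _ hi).const_mul _).const_mul _) fun ω => ?_
        dsimp only
        rw [mixVar_eq, mul_pow]
        gcongr
        have := pow_sum_le_card_mul_sum_pow (s := Finset.range n)
          (f := fun i => geom Z α lam (grid T n i) ω ^ 2) (fun i _ => sq_nonneg _) 3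
        simpa only [Finset.card_range, ← pow_mul] using this
    _ = (α ^ 2 * T / n) ^ 4 * (n ^ 3 *
          ∑ i ∈ Finset.range n, ∫ ω, geom Z α lam (grid T n i) ω ^ 8 ∂P) := by
        rw [integral_const_mul, integral_const_mul, integral_finsetSum _ hi]
    _ ≤ (α ^ 2 * T / n) ^ 4 * (n ^ 3 *
          ∑ _i ∈ Finset.range n, Real.exp (α ^ 2 * ((32 + 4 * |lam - 1|) * T))) := by
        gcongr with i hi
        rw [integral_geom_pow h]
        have h1 : (grid T n i : ℝ) ≤ T := by exact_mod_cast grid_le T (Finset.mem_range.1 hi).le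
        have h2 : (0 : ℝ) ≤ grid T n i := (grid T n i).2
        gcongr
        push_cast
        calc (8 : ℝ) ^ 2 * grid T n i / 2 + (lam - 1) / 2 * (8 * grid T n i)
            = (32 + 4 * (lam - 1)) * grid T n i := by ring
          _ ≤ (32 + 4 * |lam - 1|) * grid T n i := by gcongr; exact le_abs_self _
          _ ≤ _ := by gcongr
    _ = _ := by
        rw [Finset.sum_const, Finset.card_range, nsmul_eq_mul]
        field_simp

/-- This is an `L²` bound, uniform in the grid, for the fourth powers; it is what allows fourth
moments to pass to the limit. -/
lemma exists_integral_mixture_pow_eight_le (h : IsIndepBMPair P 𝓕 Z X) (α lam ρ : ℝ)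
    (T : ℝ≥0) : ∃ C : ℝ, ∀ n, ∫ ω, mixture Z X α lam ρ T n ω ^ 8 ∂P ≤ C := by
  set c := ∫ x, x ^ 8 ∂(gaussianReal 0 1) with hc
  have hc0 : 0 ≤ c := integral_nonneg fun x => by positivity
  refine ⟨2 ^ 7 * (ρ ^ 8 * ∫ ω, centeredGeom Z α lam T ω ^ 8 ∂P) + 2 ^ 7 * (√(1 - ρ ^ 2) ^ 8 *
    (c * ((α ^ 2 * T) ^ 4 * Real.exp (α ^ 2 * ((32 + 4 * |lam - 1|) * T))))), fun n => ?_⟩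
  have hU := ((hasAllMoments_centeredGeom h α lam T).pow 8).integrable
  have hR := ((hasAllMoments_mixSum h α lam T n).pow 8).integrable
  have hR8 : ∫ ω, mixSum Z X α lam T n ω ^ 8 ∂P = c * ∫ ω, mixVar Z α lam T n ω ^ 4 ∂P := by
    have := integral_mul_mixSum_pow h α lam T n 0 8 (M := fun v => v ^ 4 * c) fun v =>
      integral_pow_gaussianReal_scale v 4
    simp only [pow_zero, one_mul] at this
    rw [this, integral_mul_const, mul_comm]
  calc ∫ ω, mixture Z X α lam ρ T n ω ^ 8 ∂P
      ≤ ∫ ω, (2 ^ 7 * (ρ ^ 8 * centeredGeom Z α lam T ω ^ 8) +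
        2 ^ 7 * (√(1 - ρ ^ 2) ^ 8 * mixSum Z X α lam T n ω ^ 8)) ∂P := by
        refine integral_mono ((hasAllMoments_mixture h α lam ρ T n).pow 8).integrable
          (((hU.const_mul _).const_mul _).add ((hR.const_mul _).const_mul _)) fun ω => ?_
        have key : ∀ x y : ℝ, (x + y) ^ 8 ≤ 2 ^ 7 * x ^ 8 + 2 ^ 7 * y ^ 8 := fun x y => by
          have h1 : (x + y) ^ 2 ≤ 2 * (x ^ 2 + y ^ 2) := by nlinarith [sq_nonneg (x - y)]
          have h2 := add_pow_le (sq_nonneg x) (sq_nonneg y) 4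
          calc (x + y) ^ 8 = ((x + y) ^ 2) ^ 4 := by ring
            _ ≤ (2 * (x ^ 2 + y ^ 2)) ^ 4 := by gcongr
            _ = 2 ^ 4 * (x ^ 2 + y ^ 2) ^ 4 := by ring
            _ ≤ 2 ^ 4 * (2 ^ (4 - 1) * ((x ^ 2) ^ 4 + (y ^ 2) ^ 4)) := by gcongr
            _ = _ := by norm_num; ring
        have := key (ρ * centeredGeom Z α lam T ω) (√(1 - ρ ^ 2) * mixSum Z X α lam T n ω)
        rw [mul_pow, mul_pow] at this
        exact this
    _ = 2 ^ 7 * (ρ ^ 8 * ∫ ω, centeredGeom Z α lam T ω ^ 8 ∂P) +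
        2 ^ 7 * (√(1 - ρ ^ 2) ^ 8 * ∫ ω, mixSum Z X α lam T n ω ^ 8 ∂P) := by
        rw [integral_add ((hU.const_mul _).const_mul _) ((hR.const_mul _).const_mul _)]
        simp only [integral_const_mul]
    _ ≤ _ := by
        rw [hR8]
        have := integral_mixVar_pow_four_le h α lam T n
        gcongr

/-- The moments of the discretized terminal value converge to the moment formulas. -/
lemma tendsto_integral_mixture_pow (h : IsIndepBMPair P 𝓕 Z X) (α lam : ℝ) {ρ : ℝ}
    (hρ : |ρ| ≤ 1) (T : ℝ≥0) {w : ℝ} (hw : w = Real.exp (α ^ 2 * T)) :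
    Tendsto (fun n => ∫ ω, mixture Z X α lam ρ T n ω ∂P) atTop (𝓝 0) ∧
    Tendsto (fun n => ∫ ω, mixture Z X α lam ρ T n ω ^ 2 ∂P) atTop (𝓝 (mu2 ρ lam w)) ∧
    Tendsto (fun n => ∫ ω, mixture Z X α lam ρ T n ω ^ 3 ∂P) atTop (𝓝 (mu3 ρ lam w)) ∧
    Tendsto (fun n => ∫ ω, mixture Z X α lam ρ T n ω ^ 4 ∂P) atTop (𝓝 (mu4 ρ lam w)) := by
  set m := Real.exp (lam * (α ^ 2 * T) / 2) with hm
  obtain ⟨u1, u2, u3, u4⟩ := integral_centeredGeom_pow h α lam T hm hw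
  have hr2 : √(1 - ρ ^ 2) ^ 2 = 1 - ρ ^ 2 := Real.sq_sqrt (by
    have : ρ ^ 2 ≤ 1 := by simpa using (sq_le_one_iff_abs_le_one ρ).2 hρ
    linarith)
  have hr4 : √(1 - ρ ^ 2) ^ 4 = (1 - ρ ^ 2) ^ 2 := by
    rw [show √(1 - ρ ^ 2) ^ 4 = (√(1 - ρ ^ 2) ^ 2) ^ 2 by ring, hr2]
  -- powers of `w`
  have p1 : w ^ (1 / 2 * lam) = m := by rw [hw, ← Real.exp_mul, hm]; congr 1; ring
  have p2 : w ^ lam = m ^ 2 := by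
    rw [hw, ← Real.exp_mul, hm, ← Real.exp_nat_mul]; congr 1; push_cast; ring
  have p3 : w ^ (3 / 2 * lam) = m ^ 3 := by
    rw [hw, ← Real.exp_mul, hm, ← Real.exp_nat_mul]; congr 1; push_cast; ring
  have p4 : w ^ (2 * lam) = m ^ 4 := by
    rw [hw, ← Real.exp_mul, hm, ← Real.exp_nat_mul]; congr 1; push_cast; ring
  -- mixed moments
  have hm1 : ∀ n j, ∫ ω, centeredGeom Z α lam T ω ^ j * mixSum Z X α lam T n ω ^ 1 ∂P = 0 :=
    fun n j => by
      rw [integral_mul_mixSum_pow h α lam T n j 1 (M := fun _ => 0) (fun v => by simp)]; simp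
  have hm2 : ∀ n j, ∫ ω, centeredGeom Z α lam T ω ^ j * mixSum Z X α lam T n ω ^ 2 ∂P =
      ∫ ω, centeredGeom Z α lam T ω ^ j * mixVar Z α lam T n ω ∂P := fun n j =>
    integral_mul_mixSum_pow h α lam T n j 2 (M := fun v => v) integral_sq_gaussianReal
  have hm3 : ∀ n j, ∫ ω, centeredGeom Z α lam T ω ^ j * mixSum Z X α lam T n ω ^ 3 ∂P = 0 :=
    fun n j => by
      rw [integral_mul_mixSum_pow h α lam T n j 3 (M := fun _ => 0) integral_cube_gaussianReal]
      simp
  have hm4 : ∀ n, ∫ ω, centeredGeom Z α lam T ω ^ 0 * mixSum Z X α lam T n ω ^ 4 ∂P =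
      3 * ∫ ω, mixVar Z α lam T n ω ^ 2 ∂P := fun n => by
    rw [integral_mul_mixSum_pow h α lam T n 0 4 (M := fun v => 3 * v ^ 2)
      integral_pow_four_gaussianReal, ← integral_const_mul]
    simp
  have hUg : ∀ ω, centeredGeom Z α lam T ω = geom Z α lam T ω - m := fun ω => rfl
  have hgi : ∀ n (j : ℕ), Integrable (fun ω => geom Z α lam T ω ^ j * mixVar Z α lam T n ω) P :=
    fun n j => (((hasAllMoments_geom h α lam T).pow j).mul
      (hasAllMoments_mixVar h α lam T n)).integrable
  have t0 := tendsto_integral_geom_pow_mul_mixVar h α lam T 0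
  have t1 := tendsto_integral_geom_pow_mul_mixVar h α lam T 1
  have t2 := tendsto_integral_geom_pow_mul_mixVar h α lam T 2
  have e1 : Real.exp ((((1 : ℕ) : ℝ) ^ 2 - ((1 : ℕ) : ℝ)) / 2 * (α ^ 2 * T) +
      ((1 : ℕ) : ℝ) * (lam * (α ^ 2 * T) / 2)) = m := by rw [hm]; congr 1; push_cast; ring
  have e2 : Real.exp ((((2 : ℕ) : ℝ) ^ 2 - ((2 : ℕ) : ℝ)) / 2 * (α ^ 2 * T) +
      ((2 : ℕ) : ℝ) * (lam * (α ^ 2 * T) / 2)) = m ^ 2 * w := by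
    rw [hm, hw, ← Real.exp_nat_mul, ← Real.exp_add]; congr 1; push_cast; ring
  have s0 : (1 : ℝ) + 2 * ((0 : ℕ) : ℝ) + lam = 1 + lam := by push_cast; ring
  have s1 : (1 : ℝ) + 2 * ((1 : ℕ) : ℝ) + lam = 3 + lam := by push_cast; ring
  have s2 : (1 : ℝ) + 2 * ((2 : ℕ) : ℝ) + lam = 5 + lam := by push_cast; ring
  rw [s0, ← hw] at t0
  rw [s1, ← hw, e1] at t1
  rw [s2, ← hw, e2] at t2
  have t0' : Tendsto (fun n => ∫ ω, mixVar Z α lam T n ω ∂P) atTop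
      (𝓝 (powQuot w (1 + lam))) := by simpa using t0
  have v1 : Tendsto (fun n => ∫ ω, centeredGeom Z α lam T ω ^ 1 * mixVar Z α lam T n ω ∂P) atTop
      (𝓝 (m * powQuot w (3 + lam) - m * powQuot w (1 + lam))) := by
    refine (t1.sub (t0'.const_mul m)).congr fun n => ?_
    rw [← integral_const_mul, ← integral_sub (hgi n 1) (by simpa using (hgi n 0).const_mul m)]
    refine integral_congr_ae (Eventually.of_forall fun ω => ?_)
    simp only [hUg]; ring
  have v2 : Tendsto (fun n => ∫ ω, centeredGeom Z α lam T ω ^ 2 * mixVar Z α lam T n ω ∂P) atTop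
      (𝓝 (m ^ 2 * w * powQuot w (5 + lam) - 2 * m * (m * powQuot w (3 + lam)) +
        m ^ 2 * powQuot w (1 + lam))) := by
    refine ((t2.sub (t1.const_mul (2 * m))).add (t0'.const_mul (m ^ 2))).congr fun n => ?_
    have i1 : Integrable (fun ω => geom Z α lam T ω ^ 2 * mixVar Z α lam T n ω -
        2 * m * (geom Z α lam T ω ^ 1 * mixVar Z α lam T n ω)) P :=
      (hgi n 2).sub ((hgi n 1).const_mul (2 * m))
    rw [← integral_const_mul, ← integral_const_mul, ← integral_sub (hgi n 2)
      ((hgi n 1).const_mul (2 * m)), ← integral_add i1 (by simpa using (hgi n 0).const_mul (m ^ 2))]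
    refine integral_congr_ae (Eventually.of_forall fun ω => ?_)
    simp only [hUg]; ring
  have t4 := tendsto_integral_mixVar_sq h α lam T hw
  -- The identities `q1`–`q4` are exact for every `n`; the discretization enters only through the
  -- integrals of `mixVar`.
  have q1 : ∀ n, ∫ ω, mixture Z X α lam ρ T n ω ∂P = 0 := fun n => by
    have := integral_mixture_pow h α lam ρ T n 1
    simp only [Finset.sum_range_succ, Finset.range_zero, Finset.sum_empty, Nat.sub_zero,
        hm1] at this
    simpa [u1] using this
  have q2 : ∀ n, ∫ ω, mixture Z X α lam ρ T n ω ^ 2 ∂P =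
      ρ ^ 2 * (m ^ 2 * (w - 1)) + (1 - ρ ^ 2) * ∫ ω, mixVar Z α lam T n ω ∂P := fun n => by
    rw [integral_mixture_pow h α lam ρ T n 2]
    simp only [Finset.sum_range_succ, Finset.range_zero, Finset.sum_empty, Nat.sub_zero,
      Nat.reduceSub, hm1, hm2, hr2]
    simp [u2]; ring
  have q3 : ∀ n, ∫ ω, mixture Z X α lam ρ T n ω ^ 3 ∂P =
      ρ ^ 3 * (m ^ 3 * (w ^ 3 - 3 * w + 2)) + 3 * ρ * (1 - ρ ^ 2) *
        ∫ ω, centeredGeom Z α lam T ω ^ 1 * mixVar Z α lam T n ω ∂P := fun n => by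
    rw [integral_mixture_pow h α lam ρ T n 3]
    simp only [Finset.sum_range_succ, Finset.range_zero, Finset.sum_empty, Nat.sub_zero,
      Nat.reduceSub, hm1, hm2, hm3, hr2]
    simp [u3, Nat.choose]; ring
  have q4 : ∀ n, ∫ ω, mixture Z X α lam ρ T n ω ^ 4 ∂P =
      ρ ^ 4 * (m ^ 4 * (w ^ 6 - 4 * w ^ 3 + 6 * w - 3)) + 6 * ρ ^ 2 * (1 - ρ ^ 2) *
        ∫ ω, centeredGeom Z α lam T ω ^ 2 * mixVar Z α lam T n ω ∂P +
      (1 - ρ ^ 2) ^ 2 * (3 * ∫ ω, mixVar Z α lam T n ω ^ 2 ∂P) := fun n => by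
    rw [integral_mixture_pow h α lam ρ T n 4]
    simp only [Finset.sum_range_succ, Finset.range_zero, Finset.sum_empty, Nat.sub_zero,
      Nat.reduceSub, hm1, hm2, hm3, hm4, hr2, hr4]
    simp [u4, Nat.choose]; ring
  simp only [q1, q2, q3, q4]
  refine ⟨tendsto_const_nhds, ?_, ?_, ?_⟩
  · refine ((t0'.const_mul (1 - ρ ^ 2)).const_add (ρ ^ 2 * (m ^ 2 * (w - 1)))).trans_eq ?_
    rw [mu2, p2]; ring_nf
  · refine ((v1.const_mul (3 * ρ * (1 - ρ ^ 2))).const_add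
      (ρ ^ 3 * (m ^ 3 * (w ^ 3 - 3 * w + 2)))).trans_eq ?_
    rw [mu3, p3, p1]; ring_nf
  · refine (((v2.const_mul (6 * ρ ^ 2 * (1 - ρ ^ 2))).const_add
      (ρ ^ 4 * (m ^ 4 * (w ^ 6 - 4 * w ^ 3 + 6 * w - 3)))).add
      ((t4.const_mul 3).const_mul ((1 - ρ ^ 2) ^ 2))).trans_eq ?_
    rw [mu4, p4, p2]; ring_nf

end

/-! ### The moments of a solution -/

lemma memLp_four_of_integrable_pow {P : Measure Ω} {f : Ω → ℝ} (hm : AEStronglyMeasurable f P)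
    (hf : Integrable (fun ω => f ω ^ 4) P) : MemLp f 4 P := by
  rw [← integrable_norm_rpow_iff hm (by norm_num) (by norm_num)]
  refine hf.congr (Eventually.of_forall fun ω => ?_)
  have : ((4 : ENNReal).toReal : ℝ) = ((4 : ℕ) : ℝ) := by norm_num
  simp only [this, Real.rpow_natCast, Real.norm_eq_abs]
  exact ((by decide : Even 4).pow_abs _).symm

section

variable {P : Measure Ω} [IsProbabilityMeasure P] {𝓕 : Filtration ℝ≥0 mΩ}
  {Z X F σ : ℝ≥0 → Ω → ℝ} {F₀ σ₀ α ρ lam : ℝ}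

lemma IsSolution.volatility_ae_eq (h : IsSolution P 𝓕 Z X F σ F₀ σ₀ α ρ lam) (t : ℝ≥0) :
    ∀ᵐ ω ∂P, σ t ω = σ₀ * geom Z α lam t ω := by
  filter_upwards [volatility_eq h.bm h.adapted_σ h.continuous_σ h.sde_σ t, h.init_σ] with ω h1 h2
  rw [h1, h2, geom]
  congr 3
  ring

/-- The change of variables that takes a solution to the canonical form. -/
def canonical (F : ℝ≥0 → Ω → ℝ) (F₀ σ₀ α ρ lam : ℝ) (T : ℝ≥0) (ω : Ω) : ℝ :=
  α / σ₀ * (F T ω - Fbar F₀ σ₀ α ρ lam T)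

/-- In the `F`-sum minus `ρ/α` times the `σ`-sum the increments of drifted `Z` cancel term by term,
leaving `√(1 - ρ²)` times a sum against `X`. On the limit side the same combination leaves a
multiple of `σ_T`, which `volatility_ae_eq` identifies. -/
lemma IsSolution.exists_seq_tendsto_canonical (h : IsSolution P 𝓕 Z X F σ F₀ σ₀ α ρ lam)
    (hσ₀ : σ₀ ≠ 0) (hα : α ≠ 0) (T : ℝ≥0) :
    ∃ ns : ℕ → ℕ, StrictMono ns ∧ ∀ᵐ ω ∂P,
      Tendsto (fun m => mixture Z X α lam ρ T (ns m) ω) atTop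
        (𝓝 (canonical F F₀ σ₀ α ρ lam T ω)) := by
  -- Index `0` is the equation for `F`, index `1` that for `σ`; subtracting them requires a common
  -- subsequence.
  obtain ⟨ns, hns, hlim⟩ := exists_common_seq_tendsto_ae (P := P)
    (f := fun j n ω => ∑ i ∈ Finset.range n, σ (grid T n i) ω *
      (if j = 0 then
        (ρ * drifted Z (lam * α / 2) (grid T n (i + 1)) ω + √(1 - ρ ^ 2) * X (grid T n (i + 1)) ω) -
          (ρ * drifted Z (lam * α / 2) (grid T n i) ω + √(1 - ρ ^ 2) * X (grid T n i) ω)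
      else α * drifted Z (lam * α / 2) (grid T n (i + 1)) ω -
        α * drifted Z (lam * α / 2) (grid T n i) ω))
    (g := fun j ω => if j = 0 then F T ω - F 0 ω else σ T ω - σ 0 ω) 2 (fun j hj => by
      interval_cases j
      · simpa [grid] using h.sde_F T
      · simpa [grid] using h.sde_σ T)
  refine ⟨ns, hns, ?_⟩
  have hgrid : ∀ᵐ ω ∂P, ∀ n i, σ (grid T n i) ω = σ₀ * geom Z α lam (grid T n i) ω :=
    ae_all_iff.2 fun n => ae_all_iff.2 fun i => h.volatility_ae_eq _
  filter_upwards [hlim 0 (by norm_num), hlim 1 (by norm_num), hgrid, h.volatility_ae_eq T,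
    h.init_F, h.init_σ] with ω l0 l1 hg hT hF0 hσ0
  simp only [if_true, one_ne_zero, if_false] at l0 l1
  have l2 := ((l0.sub (l1.const_mul (ρ / α))).const_mul (α / σ₀)).const_add
    (ρ * centeredGeom Z α lam T ω)
  have hlimit : ρ * centeredGeom Z α lam T ω +
      α / σ₀ * (F T ω - F 0 ω - ρ / α * (σ T ω - σ 0 ω)) = canonical F F₀ σ₀ α ρ lam T ω := by
    rw [hF0, hσ0, hT, canonical, Fbar, centeredGeom,
      show lam * α ^ 2 * (T : ℝ) / 2 = lam * (α ^ 2 * T) / 2 by ring]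
    field_simp
    ring
  rw [hlimit] at l2
  refine l2.congr fun m => ?_
  rw [mixture, mixSum, Finset.mul_sum, Finset.mul_sum, ← Finset.sum_sub_distrib, Finset.mul_sum]
  congr 1
  refine Finset.sum_congr rfl fun i _ => ?_
  rw [hg]
  field_simp
  ring

lemma IsSolution.moments_canonical (h : IsSolution P 𝓕 Z X F σ F₀ σ₀ α ρ lam)
    (hρ : |ρ| ≤ 1) (hσ₀ : σ₀ ≠ 0) (hα : α ≠ 0) (T : ℝ≥0) {w : ℝ}
    (hw : w = Real.exp (α ^ 2 * T)) :
    MemLp (canonical F F₀ σ₀ α ρ lam T) 4 P ∧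
    ∫ ω, canonical F F₀ σ₀ α ρ lam T ω ∂P = 0 ∧
    ∫ ω, canonical F F₀ σ₀ α ρ lam T ω ^ 2 ∂P = mu2 ρ lam w ∧
    ∫ ω, canonical F F₀ σ₀ α ρ lam T ω ^ 3 ∂P = mu3 ρ lam w ∧
    ∫ ω, canonical F F₀ σ₀ α ρ lam T ω ^ 4 ∂P = mu4 ρ lam w := by
  obtain ⟨ns, hns, hlim⟩ := h.exists_seq_tendsto_canonical hσ₀ hα T
  obtain ⟨C, hC⟩ := exists_integral_mixture_pow_eight_le h.bm α lam ρ T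
  obtain ⟨m1, m2, m3, m4⟩ := tendsto_integral_mixture_pow h.bm α lam hρ T hw
  have hmom := fun n => hasAllMoments_mixture h.bm α lam ρ T n
  have hLp : ∀ k n, MemLp (fun ω => mixture Z X α lam ρ T n ω ^ k) 2 P := fun k n =>
    (hmom n).pow k 2 (by norm_num)
  -- For `k ≤ 4`, `x^{2k} ≤ 1 + x^8`, so one eighth-moment bound serves every power.
  have hbound : ∀ k ≤ 4, ∀ n, ∫ ω, (mixture Z X α lam ρ T n ω ^ k) ^ 2 ∂P ≤ 1 + C := by
    intro k hk n
    calc ∫ ω, (mixture Z X α lam ρ T n ω ^ k) ^ 2 ∂P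
        ≤ ∫ ω, (1 + mixture Z X α lam ρ T n ω ^ 8) ∂P := by
          refine integral_mono (hLp k n).integrable_sq
            ((integrable_const 1).add ((hmom n).pow 8).integrable) fun ω => ?_
          show (mixture Z X α lam ρ T n ω ^ k) ^ 2 ≤ 1 + mixture Z X α lam ρ T n ω ^ 8
          generalize mixture Z X α lam ρ T n ω = x
          have e1 : (x ^ k) ^ 2 = (x ^ 2) ^ k := by rw [← pow_mul, ← pow_mul, mul_comm]
          have e2 : x ^ 8 = (x ^ 2) ^ 4 := by ring
          rw [e1, e2]
          rcases le_total (x ^ 2) 1 with h1 | h1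
          · have := pow_le_one₀ (n := k) (sq_nonneg x) h1
            have : 0 ≤ (x ^ 2) ^ 4 := by positivity
            linarith
          · have := pow_le_pow_right₀ h1 hk
            linarith
      _ = 1 + ∫ ω, mixture Z X α lam ρ T n ω ^ 8 ∂P := by
          rw [integral_add (integrable_const 1) ((hmom n).pow 8).integrable]; simp
      _ ≤ 1 + C := by linarith [hC n]
  have hpow : ∀ k ≤ 4, Tendsto (fun m => ∫ ω, mixture Z X α lam ρ T (ns m) ω ^ k ∂P) atTop
      (𝓝 (∫ ω, canonical F F₀ σ₀ α ρ lam T ω ^ k ∂P)) := fun k hk =>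
    tendsto_integral_of_sq_bounded (fun m => hLp k (ns m)) (fun m => hbound k hk (ns m))
      (hlim.mono fun ω hω => hω.pow k)
  have hmeas : AEStronglyMeasurable (canonical F F₀ σ₀ α ρ lam T) P :=
    aestronglyMeasurable_of_tendsto_ae _ (fun m => ((hmom (ns m)) 2 (by norm_num)).1) hlim
  have h4 := (sq_fatou (fun m => hLp 4 (ns m)) (fun m => hbound 4 le_rfl (ns m))
    (hlim.mono fun ω hω => hω.pow 4)).1
  refine ⟨memLp_four_of_integrable_pow hmeas (h4.integrable (by norm_num)), ?_, ?_, ?_, ?_⟩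
  · have := hpow 1 (by norm_num)
    simp only [pow_one] at this
    exact tendsto_nhds_unique this (m1.comp hns.tendsto_atTop)
  · exact tendsto_nhds_unique (hpow 2 (by norm_num)) (m2.comp hns.tendsto_atTop)
  · exact tendsto_nhds_unique (hpow 3 (by norm_num)) (m3.comp hns.tendsto_atTop)
  · exact tendsto_nhds_unique (hpow 4 (by norm_num)) (m4.comp hns.tendsto_atTop)

/-- `F_T` is an affine image of the canonical variable with slope `σ₀/α > 0`: central moments scale
by powers of the slope, and the normalized ratios are unchanged. -/
lemma IsSolution.moments (h : IsSolution P 𝓕 Z X F σ F₀ σ₀ α ρ lam)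
    (hρ : |ρ| ≤ 1) (hσ₀ : 0 < σ₀) (hα : 0 < α) (T : ℝ≥0) {w : ℝ}
    (hw : w = Real.exp (α ^ 2 * T)) :
    MemLp (F T) 4 P ∧
    ∫ ω, F T ω ∂P = Fbar F₀ σ₀ α ρ lam T ∧
    ∫ ω, (F T ω - Fbar F₀ σ₀ α ρ lam T) ^ 2 ∂P = (σ₀ / α) ^ 2 * mu2 ρ lam w ∧
    ∫ ω, (F T ω - Fbar F₀ σ₀ α ρ lam T) ^ 3 ∂P = (σ₀ / α) ^ 3 * mu3 ρ lam w ∧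
    ∫ ω, (F T ω - Fbar F₀ σ₀ α ρ lam T) ^ 4 ∂P = (σ₀ / α) ^ 4 * mu4 ρ lam w ∧
    (0 < T →
      skewness (F T) P = mu3 ρ lam w / mu2 ρ lam w ^ (3 / 2 : ℝ) ∧
      exKurtosis (F T) P = mu4 ρ lam w / mu2 ρ lam w ^ 2 - 3) := by
  obtain ⟨d0, d1, d2, d3, d4⟩ := h.moments_canonical hρ hσ₀.ne' hα.ne' T hw
  set Y := canonical F F₀ σ₀ α ρ lam T with hY
  set c := σ₀ / α with hc
  have hc0 : 0 < c := div_pos hσ₀ hα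
  have hsub : ∀ ω, F T ω - Fbar F₀ σ₀ α ρ lam T = c * Y ω := fun ω => by
    rw [hY, canonical, hc]; field_simp
  have hF : ∀ ω, F T ω = Fbar F₀ σ₀ α ρ lam T + c * Y ω := fun ω => by rw [← hsub]; ring
  have hpow : ∀ k, ∫ ω, (F T ω - Fbar F₀ σ₀ α ρ lam T) ^ k ∂P = c ^ k * ∫ ω, Y ω ^ k ∂P :=
    fun k => by simp_rw [hsub, mul_pow, integral_const_mul]
  have hmean : ∫ ω, F T ω ∂P = Fbar F₀ σ₀ α ρ lam T := by
    simp_rw [hF]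
    rw [integral_add (integrable_const _) ((d0.integrable (by norm_num)).const_mul c),
      integral_const_mul, d1]
    simp
  have hcm : ∀ k, centralMoment (F T) k P = c ^ k * ∫ ω, Y ω ^ k ∂P := fun k => by
    rw [← hpow, centralMoment, hmean]; rfl
  have hLp : MemLp (F T) 4 P := by
    have := (memLp_const (Fbar F₀ σ₀ α ρ lam T)).add (d0.const_mul c)
    exact this.ae_eq (Eventually.of_forall fun ω => (hF ω).symm)
  refine ⟨hLp, hmean, by rw [hpow, d2], by rw [hpow, d3], by rw [hpow, d4], fun hT => ?_⟩
  have hT' : (0 : ℝ) < α ^ 2 * T := by positivity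
  have hpos : 0 < mu2 ρ lam w := hw ▸ mu2_pos hρ lam hT'
  have hroot : (c ^ 2) ^ (3 / 2 : ℝ) = c ^ 3 := by
    rw [← Real.rpow_natCast c 2, ← Real.rpow_mul hc0.le, ← Real.rpow_natCast c 3]
    norm_num
  constructor
  · rw [skewness, hcm, hcm, d2, d3, Real.mul_rpow (by positivity) hpos.le, hroot,
      mul_div_mul_left _ _ (by positivity)]
  · rw [exKurtosis, hcm, hcm, d2, d4, mul_pow, ← pow_mul, mul_div_mul_left _ _ (by positivity)]

end

end NSVh

end

theorem corollary5 (ρ lam : ℝ) (hρ : |ρ| ≤ 1) :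
    -- the canonical form
    (∀ (Ω : Type*) [mΩ : MeasurableSpace Ω] (P : Measure Ω) [IsProbabilityMeasure P]
      (𝓕 : Filtration ℝ≥0 mΩ) (Z X F σ : ℝ≥0 → Ω → ℝ) (S : ℝ≥0),
      NSVh.IsCanonicalSolution P 𝓕 Z X F σ S ρ lam →
      ∀ w : ℝ, w = Real.exp (S : ℝ) →
        MemLp (F S) 4 P ∧
        ∫ ω, F S ω ∂P = 0 ∧
        ∫ ω, F S ω ^ 2 ∂P = NSVh.mu2 ρ lam w ∧
        ∫ ω, F S ω ^ 3 ∂P = NSVh.mu3 ρ lam w ∧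
        ∫ ω, F S ω ^ 4 ∂P = NSVh.mu4 ρ lam w ∧
        (0 < S →
          0 < NSVh.mu2 ρ lam w ∧
          NSVh.skewness (F S) P = NSVh.mu3 ρ lam w / NSVh.mu2 ρ lam w ^ (3 / 2 : ℝ) ∧
          NSVh.exKurtosis (F S) P = NSVh.mu4 ρ lam w / NSVh.mu2 ρ lam w ^ 2 - 3)) ∧
    -- the original form
    (∀ (Ω : Type*) [mΩ : MeasurableSpace Ω] (P : Measure Ω) [IsProbabilityMeasure P]
      (𝓕 : Filtration ℝ≥0 mΩ) (Z X F σ : ℝ≥0 → Ω → ℝ) (F₀ σ₀ α : ℝ) (T : ℝ≥0),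
      0 < σ₀ → 0 < α → NSVh.IsSolution P 𝓕 Z X F σ F₀ σ₀ α ρ lam →
      ∀ w : ℝ, w = Real.exp (α ^ 2 * (T : ℝ)) →
        MemLp (F T) 4 P ∧
        ∫ ω, F T ω ∂P = NSVh.Fbar F₀ σ₀ α ρ lam T ∧
        ∫ ω, (F T ω - NSVh.Fbar F₀ σ₀ α ρ lam T) ^ 2 ∂P = (σ₀ / α) ^ 2 * NSVh.mu2 ρ lam w ∧
        ∫ ω, (F T ω - NSVh.Fbar F₀ σ₀ α ρ lam T) ^ 3 ∂P = (σ₀ / α) ^ 3 * NSVh.mu3 ρ lam w ∧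
        ∫ ω, (F T ω - NSVh.Fbar F₀ σ₀ α ρ lam T) ^ 4 ∂P = (σ₀ / α) ^ 4 * NSVh.mu4 ρ lam w ∧
        (0 < T →
          NSVh.skewness (F T) P = NSVh.mu3 ρ lam w / NSVh.mu2 ρ lam w ^ (3 / 2 : ℝ) ∧
          NSVh.exKurtosis (F T) P = NSVh.mu4 ρ lam w / NSVh.mu2 ρ lam w ^ 2 - 3)) ∧
    -- the normal SABR case
    (lam = 0 → ∀ S : ℝ, 0 < S → ∀ w : ℝ, w = Real.exp S →
      NSVh.mu2 ρ lam w = w - 1 ∧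
      NSVh.mu3 ρ lam w / NSVh.mu2 ρ lam w ^ (3 / 2 : ℝ) = ρ * (w + 2) * √(w - 1) ∧
      NSVh.mu4 ρ lam w / NSVh.mu2 ρ lam w ^ 2 - 3 =
        (w - 1) * ((4 * ρ ^ 2 + 1) / 5 * (w ^ 3 + 3 * w ^ 2 + 6 * w + 5) + 1)) := by
  refine ⟨?_, ?_, ?_⟩
  · intro Ω mΩ P _ 𝓕 Z X F σ S hs w hw
    have hw' : w = Real.exp ((1 : ℝ) ^ 2 * (S : ℝ)) := by rw [hw, one_pow, one_mul]
    -- The canonical initial value is exactly the one that centers the terminal value when `α = σ₀ =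
    -- 1`, so the canonical form is a special case of the original one.
    have hbar : NSVh.Fbar (-(ρ * (Real.exp (lam * (S : ℝ) / 2) - 1))) 1 1 ρ lam S = 0 := by
      simp [NSVh.Fbar]
    obtain ⟨h0, h1, h2, h3, h4, h5⟩ := NSVh.IsSolution.moments hs hρ one_pos one_pos S hw'
    simp only [hbar, sub_zero, div_one, one_pow, one_mul] at h1 h2 h3 h4
    exact ⟨h0, h1, h2, h3, h4, fun hS => ⟨hw ▸ NSVh.mu2_pos hρ lam (by exact_mod_cast hS), h5 hS⟩⟩
  · intro Ω mΩ P _ 𝓕 Z X F σ F₀ σ₀ α T hσ₀ hα hs w hw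
    exact hs.moments hρ hσ₀ hα T hw
  · rintro rfl S hS w hw
    have hw1 : 1 < w := hw ▸ Real.one_lt_exp_iff.2 hS
    exact ⟨NSVh.normalSABR_mu2 ρ w, NSVh.normalSABR_skewness ρ hw1, NSVh.normalSABR_kurtosis ρ hw1⟩
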